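/- Let $n\ge 1$ and $m\ge 0$ be integers, let $a,c_1,c_2\in\mathbb R$ with $(c_1,c_2)\ne(0,0)$, and put $c=\sqrt{c_1^2+c_2^2}$ and $b=2(c_1^2+c_2^2)-a^2$. For real $\epsilon$ near $0$ let $\lambda=\lambda_0+\epsilon^2$ with $\lambda_0=-\frac a2+ic$, and let $u=\epsilon\sqrt{-2ic-\epsilon^2}$ (principal square root). This is a square root of $-(\lambda+\frac a2)^2-c^2$ that is smooth in $\epsilon$ (the only other one is $-u$). Let $\Phi=(f,g,h)^T$, where $$f=\sum_{j=1}^2K_je^{u_jx+(2\lambda-a)u_jt},\quad g=\sum_{j=1}^2\frac{-c_1K_j}{u_j-i\lambda-i\frac a2}e^{u_jx+(2\lambda-a)u_jt},\quad h=\sum_{j=1}^2\frac{-c_2K_j}{u_j-i\lambda-i\frac a2}e^{u_jx+(2\lambda-a)u_jt},$$ with $u_1=u$, $u_2=-u$, $K_1=\epsilon^m$, $K_2=-\epsilon^m$. Then $\Psi=R\Phi$ with $R=\mathrm{diag}(e^{i(ax+bt)/2},e^{-i(ax+bt)/2},e^{-i(ax+bt)/2})$ is the eigenfunction of the Lax pair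 of the Manakov system $$iq_{1t}+q_{1xx}+2(|q_1|^2+|q_2|^2)q_1=0,\qquad iq_{2t}+q_{2xx}+2(|q_1|^2+|q_2|^2)q_2=0$$ for the seed $q_k=c_ke^{i(ax+bt)}$ and the spectral parameter $\lambda$. Let $n$ eigenfunctions $\Psi_k=R\Phi_k$, $\Phi_k=(f_k,g_k,h_k)^T$, $1\le k\le n$, be attached in this way to $\lambda_k=\lambda_0+\epsilon^2$. Let $\Omega_2$ be the $3n\times 3n$ matrix whose rows $3k-2,3k-1,3k$ are $$\bigl(\lambda_k^l(f_k,g_k,h_k)\bigr)_{l=0}^{n-1},\quad \bigl((\lambda_k^*)^l(-g_k^*,f_k^*,0)\bigr)_{l=0}^{n-1},\quad \bigl((\lambda_k^*)^l(-h_k^*,0,f_k^*)\bigr)_{l=0}^{n-1}.$$ Thus its columns are of the types $f,g,h,\lambda f,\lambda g,\lambda h,\dots,\lambda^{n-1}f,\lambda^{n-1}g,\lambda^{n-1}h$. Let $\Omega_1$ and $\Omega_3$ be the same with the last three columns replaced by columns of the types $\lambda^{n-1}f,\lambda^{n-1}h,\lambda^nf$, respectively $\lambda^{n-1}f,\lambda^{n-1}g,\lambda^nf$.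 Let $\Omega_1',\Omega_2',\Omega_3'$ arise from them by differentiating every entry of row $i$ exactly $n_i=2\lfloor\frac{i-1}3\rfloor+1+m$ times in $\epsilon$ at $\epsilon=0$. Then: (1) $|\Omega_2'|\neq0$ for all real $(x,t)\ne(0,0)$, and the functions $$q_1^{[n]}=\Bigl(c_1+2i\frac{|\Omega_1'|}{|\Omega_2'|}\Bigr)e^{i(ax+bt)},\qquad q_2^{[n]}=\Bigl(c_2-2i\frac{|\Omega_3'|}{|\Omega_2'|}\Bigr)e^{i(ax+bt)}$$ extend smoothly to $(0,0)$. The extensions form an $n$th-order vector rogue wave of the Manakov system, that is: they are a smooth solution of it on $\mathbb R^2$; $q_k^{[n]}=e^{i(ax+bt)}P_k/H$ with complex polynomials $P_1,P_2$ and a real polynomial $H>0$ on $\mathbb R^2$ in $x,t$, where $P_1,P_2,H$ have no common factor and $H$ has total degree $n(n+1)$; $|q_k^{[n]}|\to|c_k|$ as $(x,t)\to\infty$ in $\mathbb R^2$ (double localization); and $|q_1^{[n]}|^2+|q_2^{[n]}|^2>c_1^2+c_2^2$ at some point. (2) If $c_1=c_2=\frac{\sqrt2}2$ and $a=0$, then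 $q^{[n]}=\sqrt2\,q_1^{[n]}=\sqrt2\,q_2^{[n]}$ is an $n$th-order (in the same sense, with background $e^{2it}$) doubly-localized rogue wave of the NLS equation $iq_t+q_{xx}+2|q|^2q=0$. It is non-symmetric: $|q^{[n]}(-x,t)|$ and $|q^{[n]}(x,t)|$ are not identically equal, and for $n=2,3$ there is no $x_0\in\mathbb R$ for which $|q^{[n]}(2x_0-x,t)|$ and $|q^{[n]}(x,t)|$ are identically equal. For $n=2,3$, with $H_2,H_3>0$ on $\mathbb R^2$, $$q_1^{[2]}=\Bigl(\frac{\sqrt2}2+\frac{F_2}{H_2}\Bigr)e^{2it},\qquad q_1^{[3]}=\Bigl(\frac{\sqrt2}2+\frac{F_3}{H_3}\Bigr)e^{2it},$$ where $$\begin{aligned}F_2=12i\sqrt2\,(&12t-32t^{3}-12xt+16x^{3}t+64t^{3}x-8x^{4}t-64x^{2}t^{3}-128t^{5}+48i x^{2}t^{2}-4i x^{3}+6i x^{2}+160i t^{4}-48i xt^{2}+48i t^{2}+2i x^{4}-3i x),\end{aligned}$$ $$\begin{aligned}H_2=&1024t^{6}+768x^{2}t^{4}-768t^{4}x+1920t^{4}+192x^{4}t^{2}-384x^{3}t^{2}+288xt^{2}+288t^{2}+16x^{6}-48x^{5}+72x^{4}-72x^{3}+72x^{2}-36x+9,\end{aligned}$$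 $$\begin{aligned}F_3=2\sqrt2\,(&-256x^{12}-6144x^{10}t^{2}-61440x^{8}t^{4}-327680x^{6}t^{6}-983040x^{4}t^{8}-1572864x^{2}t^{10}-1048576t^{12}+1536x^{11}+3072i x^{10}t+30720x^{9}t^{2}\\ &+61440i x^{8}t^{3}+245760x^{7}t^{4}+491520i x^{6}t^{5}+983040x^{5}t^{6}+1966080i x^{4}t^{7}+1966080x^{3}t^{8}+3932160i x^{2}t^{9}+1572864xt^{10}\\ &+3145728i t^{11}-3840x^{10}-15360i x^{9}t-245760i x^{7}t^{3}+368640x^{6}t^{4}-1474560i t^{5}x^{5}+1966080x^{4}t^{6}-3932160i t^{7}x^{3}\\ &+2949120x^{2}t^{8}-3932160i t^{9}x+5760x^{9}+23040i x^{8}t-184320x^{7}t^{2}-2027520x^{5}t^{4}-737280i t^{5}x^{4}-5898240x^{3}t^{6}-4423680xt^{8}\\ &+5898240i t^{9}-5760x^{8}+322560x^{6}t^{2}+921600i x^{5}t^{3}+2764800x^{4}t^{4}+4423680i x^{3}t^{5}-3686400x^{2}t^{6}+2949120i xt^{7}+10321920t^{8}\\ &+4320x^{7}-69120i tx^{6}-155520x^{5}t^{2}-1843200i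 t^{3}x^{4}-2188800x^{3}t^{4}+1105920i x^{2}t^{5}+8755200xt^{6}-11796480i t^{7}-2880x^{6}\\ &+146880i x^{5}t-259200x^{4}t^{2}+2188800i x^{3}t^{3}+1382400x^{2}t^{4}-5391360i t^{5}x-92160t^{6}+4320x^{5}-216000i tx^{4}+604800x^{3}t^{2}\\ &-2764800i t^{3}x^{2}-691200xt^{4}-5391360i t^{5}-16200x^{4}+172800i x^{3}t-1036800x^{2}t^{2}+1555200i xt^{3}-3542400t^{4}+21600x^{3}+648000xt^{2}\\ &-432000i t^{3}-18225x^{2}-64800i xt-267300t^{2}+6075x+36450i t),\end{aligned}$$ $$\begin{aligned}H_3=&512x^{12}+12288x^{10}t^{2}+122880x^{8}t^{4}+655360x^{6}t^{6}+1966080x^{4}t^{8}+3145728x^{2}t^{10}+2097152t^{12}-3072x^{11}-61440x^{9}t^{2}\\ &-491520x^{7}t^{4}-1966080x^{5}t^{6}-3932160x^{3}t^{8}-3145728xt^{10}+9216x^{10}+92160x^{8}t^{2}+491520x^{6}t^{4}+2949120x^{4}t^{6}+11796480x^{2}t^{8}\\ &+17301504t^{10}-19200x^{9}+368640x^{5}t^{4}-1966080x^{3}t^{6}-8847360xt^{8}+34560x^{8}-92160x^{6}t^{2}-1843200x^{4}t^{4}+28016640x^{2}t^{6}\\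 &+32440320t^{8}-54720x^{7}+34560x^{5}t^{2}+4377600x^{3}t^{4}-27832320xt^{6}+86400x^{6}+518400x^{4}t^{2}+5529600x^{2}t^{4}+14929920t^{6}-108000x^{5}\\ &-691200x^{3}t^{2}-9331200xt^{4}+97200x^{4}+7430400t^{4}-64800x^{3}+259200xt^{2}+36450x^{2}+145800t^{2}-12150x+2025.\end{aligned}$$ -/

import Mathlib

open Complex ComplexConjugate Filter Topology
open scoped ContDiff

noncomputable section

namespace Manakov

/-! ## The equations -/

/-- `(q₁, q₂)` is a smooth solution on the whole `(x, t)`-plane of the Manakov system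
`i ∂ₜ qₖ + ∂ₓ² qₖ + 2 (|q₁|² + |q₂|²) qₖ = 0`, `k = 1, 2`. -/
structure IsManakovSolution (q₁ q₂ : ℝ → ℝ → ℂ) : Prop where
  smooth₁ : ContDiff ℝ ∞ (fun p : ℝ × ℝ => q₁ p.1 p.2)
  smooth₂ : ContDiff ℝ ∞ (fun p : ℝ × ℝ => q₂ p.1 p.2)
  eq₁ : ∀ x t : ℝ, I * deriv (fun s => q₁ x s) t + iteratedDeriv 2 (fun y => q₁ y t) x
    + 2 * ((‖q₁ x t‖ ^ 2 + ‖q₂ x t‖ ^ 2 : ℝ) : ℂ) * q₁ x t = 0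
  eq₂ : ∀ x t : ℝ, I * deriv (fun s => q₂ x s) t + iteratedDeriv 2 (fun y => q₂ y t) x
    + 2 * ((‖q₁ x t‖ ^ 2 + ‖q₂ x t‖ ^ 2 : ℝ) : ℂ) * q₂ x t = 0

/-- `q` is a smooth solution on the whole `(x, t)`-plane of the nonlinear Schrödinger equation
`i ∂ₜ q + ∂ₓ² q + 2 |q|² q = 0`. -/
structure IsNLSSolution (q : ℝ → ℝ → ℂ) : Prop where
  smooth : ContDiff ℝ ∞ (fun p : ℝ × ℝ => q p.1 p.2)
  eq : ∀ x t : ℝ, I * deriv (fun s => q x s) t + iteratedDeriv 2 (fun y => q y t) x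
    + 2 * ((‖q x t‖ ^ 2 : ℝ) : ℂ) * q x t = 0

/-! ## Rogue waves -/

/-- The frequency `b` of the plane wave `cₖ exp (i (a x + b t))` with wave number `a` and
amplitudes `cₖ`, given by the dispersion relation. -/
def freq {ι : Type} [Fintype ι] (a : ℝ) (c : ι → ℝ) : ℝ := 2 * ∑ k, c k ^ 2 - a ^ 2

/-- The carrier `exp (i (a x + b t))`. -/
def carrier (a b x t : ℝ) : ℂ := exp (I * (a * x + b * t))

/-- The shape of a rogue wave of order `n` over the plane wave with wave number `a` and amplitudes
`c k`, for a wave with components indexed by `ι`. -/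
structure IsRogueProfile {ι : Type} [Fintype ι] (n : ℕ) (a : ℝ) (c : ι → ℝ)
    (q : ι → ℝ → ℝ → ℂ) : Prop where
  /-- The wave is the carrier times fractions `P k / H` of polynomials in `x`, `t` in lowest terms,
  where `H` is real, positive on the plane, and of degree `n (n + 1)`. -/
  rational : ∃ (P : ι → MvPolynomial (Fin 2) ℂ) (H : MvPolynomial (Fin 2) ℝ),
    H.totalDegree = n * (n + 1) ∧
    (∀ x t : ℝ, 0 < MvPolynomial.eval ![x, t] H) ∧
    (∀ D : MvPolynomial (Fin 2) ℂ,
      (∀ k, D ∣ P k) → D ∣ MvPolynomial.map ofRealHom H → IsUnit D) ∧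
    ∀ k, ∀ x t : ℝ, q k x t =
      MvPolynomial.eval ![(x : ℂ), (t : ℂ)] (P k) / ((MvPolynomial.eval ![x, t] H : ℝ) : ℂ) *
        carrier a (freq a c) x t
  /-- Double localization: the height tends to that of the plane wave as `(x, t) → ∞`. -/
  localized : ∀ k, Tendsto (fun p : ℝ × ℝ => ‖q k p.1 p.2‖) (cocompact (ℝ × ℝ)) (𝓝 |c k|)
  /-- Somewhere the wave rises above the plane wave. -/
  rises : ∃ x t : ℝ, ∑ k, c k ^ 2 < ∑ k, ‖q k x t‖ ^ 2

/-- `(q₁, q₂)` is a vector rogue wave of order `n` of the Manakov system. -/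
structure IsVectorRogueWave (n : ℕ) (a c₁ c₂ : ℝ) (q₁ q₂ : ℝ → ℝ → ℂ) : Prop where
  solution : IsManakovSolution q₁ q₂
  profile : IsRogueProfile n a ![c₁, c₂] ![q₁, q₂]

/-- `q` is a rogue wave of order `n` of the nonlinear Schrödinger equation. -/
structure IsNLSRogueWave (n : ℕ) (a c : ℝ) (q : ℝ → ℝ → ℂ) : Prop where
  solution : IsNLSSolution q
  profile : IsRogueProfile n a (fun _ : Unit => c) (fun _ => q)

/-! ## Eigenfunctions at `λ = λ₀ + ε²` -/

/-- `λ₀ = -a/2 + i √(c₁² + c₂²)`. -/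
def lam₀ (a c₁ c₂ : ℝ) : ℂ := -(a / 2) + I * (√(c₁ ^ 2 + c₂ ^ 2) : ℝ)

/-- `λ = λ₀ + ε²`. -/
def lam (a c₁ c₂ ε : ℝ) : ℂ := lam₀ a c₁ c₂ + (ε : ℂ) ^ 2

/-- The root `u₁ = √(-4λ² - 4λa - a² - 4c₁² - 4c₂²) / 2`. The radicand divided by `4` is
`ε² (-2 i √(c₁² + c₂²) - ε²)`, and the branch of its square root is the one that is smooth in `ε`
near `0` (the principal root is taken of the second factor). -/
def root (c₁ c₂ ε : ℝ) : ℂ :=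
  ε * (-2 * I * (√(c₁ ^ 2 + c₂ ^ 2) : ℝ) - (ε : ℂ) ^ 2) ^ (1 / 2 : ℂ)

theorem root_sq (a c₁ c₂ ε : ℝ) : root c₁ c₂ ε ^ 2 =
    (-4 * lam a c₁ c₂ ε ^ 2 - 4 * lam a c₁ c₂ ε * a - a ^ 2 - 4 * c₁ ^ 2 - 4 * c₂ ^ 2) / 4 := by
  have h : ((√(c₁ ^ 2 + c₂ ^ 2) : ℝ) : ℂ) ^ 2 = c₁ ^ 2 + c₂ ^ 2 := by
    have := Real.sq_sqrt (show (0 : ℝ) ≤ c₁ ^ 2 + c₂ ^ 2 by positivity)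
    exact_mod_cast this
  have h2 : ∀ z : ℂ, (z ^ (1 / 2 : ℂ)) ^ 2 = z := fun z => by simp
  rw [root, mul_pow, h2, lam, lam₀]
  linear_combination (-1 : ℂ) * h + ((√(c₁ ^ 2 + c₂ ^ 2) : ℝ) : ℂ) ^ 2 * I_sq

/-- `exp (u x + (2λ - a) u t)`, for `u` one of the roots. -/
def mode (a c₁ c₂ : ℝ) (u : ℂ) (x t ε : ℝ) : ℂ :=
  exp (u * x + (2 * lam a c₁ c₂ ε - a) * u * t)

/-- The factor `1 / (u - iλ - ia/2)` in the last two components of the eigenfunction. -/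
def weight (a c₁ c₂ : ℝ) (u : ℂ) (ε : ℝ) : ℂ :=
  1 / (u - I * lam a c₁ c₂ ε - I * a / 2)

/-- The component `f` of `Φ = (f, g, h)`, where `u₂ = -u₁` and `K₁ = ε ^ m`, `K₂ = -ε ^ m`, `K₃ = 0`. -/
def eigenF (m : ℕ) (a c₁ c₂ x t ε : ℝ) : ℂ :=
  let u := root c₁ c₂ ε
  (ε : ℂ) ^ m * mode a c₁ c₂ u x t ε - (ε : ℂ) ^ m * mode a c₁ c₂ (-u) x t ε

/-- The component `g` of `Φ`, see `eigenF`. -/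
def eigenG (m : ℕ) (a c₁ c₂ x t ε : ℝ) : ℂ :=
  let u := root c₁ c₂ ε
  (ε : ℂ) ^ m * (-c₁ * weight a c₁ c₂ u ε) * mode a c₁ c₂ u x t ε
    - (ε : ℂ) ^ m * (-c₁ * weight a c₁ c₂ (-u) ε) * mode a c₁ c₂ (-u) x t ε

/-- The component `h` of `Φ`, see `eigenF`. -/
def eigenH (m : ℕ) (a c₁ c₂ x t ε : ℝ) : ℂ :=
  let u := root c₁ c₂ ε
  (ε : ℂ) ^ m * (-c₂ * weight a c₁ c₂ u ε) * mode a c₁ c₂ u x t ε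
    - (ε : ℂ) ^ m * (-c₂ * weight a c₁ c₂ (-u) ε) * mode a c₁ c₂ (-u) x t ε

/-! ## The determinants -/

/-- The three rows `(f, g, h)`, `(-g*, f*, 0)`, `(-h*, 0, f*)`. -/
def block (m : ℕ) (a c₁ c₂ x t ε : ℝ) : Matrix (Fin 3) (Fin 3) ℂ :=
  let f := eigenF m a c₁ c₂ x t ε
  let g := eigenG m a c₁ c₂ x t ε
  let h := eigenH m a c₁ c₂ x t ε
  !![f, g, h;
     -conj g, conj f, 0;
     -conj h, 0, conj f]

/-- The spectral parameters `λ`, `λ*`, `λ*` of these three rows. -/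
def rowLam (a c₁ c₂ ε : ℝ) : Fin 3 → ℂ :=
  ![lam a c₁ c₂ ε, conj (lam a c₁ c₂ ε), conj (lam a c₁ c₂ ε)]

/-- A column of the big matrices is `λ ^ k` times one of the columns `f, g, h` (coded `0, 1, 2`).
In `Ω₂` they are `f, g, h, λf, λg, λh, …, λⁿ⁻¹f, λⁿ⁻¹g, λⁿ⁻¹h`. Columns are numbered from `0`. -/
def col₂ (_n j : ℕ) : ℕ × Fin 3 := (j / 3, Fin.ofNat 3 j)

/-- The columns of `Ω₁`: as for `Ω₂`, but ending in `λⁿ⁻¹f, λⁿ⁻¹h, λⁿf`. -/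
def col₁ (n j : ℕ) : ℕ × Fin 3 :=
  if j + 2 = 3 * n then (n - 1, 2) else if j + 1 = 3 * n then (n, 0) else col₂ n j

/-- The columns of `Ω₃`: as for `Ω₂`, but ending in `λⁿ⁻¹f, λⁿ⁻¹g, λⁿf`. -/
def col₃ (n j : ℕ) : ℕ × Fin 3 :=
  if j + 1 = 3 * n then (n, 0) else col₂ n j

/-- The `3n × 3n` matrix `Ω'` with the given columns. Rows `3k, 3k+1, 3k+2` (numbered from `0`)
belong to the eigenfunction `Ψ_{k+1}`, and are differentiated `2k + 1 + m` times at `ε = 0`. -/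
def omega (col : ℕ → ℕ → ℕ × Fin 3) (n m : ℕ) (a c₁ c₂ x t : ℝ) :
    Matrix (Fin (3 * n)) (Fin (3 * n)) ℂ :=
  Matrix.of fun i j => iteratedDeriv (2 * ((i : ℕ) / 3) + 1 + m)
    (fun ε : ℝ => rowLam a c₁ c₂ ε (Fin.ofNat 3 i) ^ (col n j).1 *
      block m a c₁ c₂ x t ε (Fin.ofNat 3 i) (col n j).2) 0

/-- `(c₁ + 2i |Ω₁'| / |Ω₂'|) exp (i (a x + b t))`. -/
def formula₁ (n m : ℕ) (a c₁ c₂ x t : ℝ) : ℂ :=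
  (c₁ + 2 * I * ((omega col₁ n m a c₁ c₂ x t).det / (omega col₂ n m a c₁ c₂ x t).det)) *
    carrier a (freq a ![c₁, c₂]) x t

/-- `(c₂ - 2i |Ω₃'| / |Ω₂'|) exp (i (a x + b t))`. -/
def formula₂ (n m : ℕ) (a c₁ c₂ x t : ℝ) : ℂ :=
  (c₂ - 2 * I * ((omega col₃ n m a c₁ c₂ x t).det / (omega col₂ n m a c₁ c₂ x t).det)) *
    carrier a (freq a ![c₁, c₂]) x t

/-! ## The explicit waves -/

/-- The numerator of the second-order wave for `a = 0`, `c₁ = c₂ = √2 / 2`. -/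
def secondNum (x t : ℂ) : ℂ :=
  12 * I * (√2 : ℝ) * (
    12 * t - 32 * t ^ 3 - 12 * x * t + 16 * x ^ 3 * t + 64 * x * t ^ 3 - 8 * x ^ 4 * t
    - 64 * x ^ 2 * t ^ 3 - 128 * t ^ 5 + 48 * I * x ^ 2 * t ^ 2 - 4 * I * x ^ 3 + 6 * I * x ^ 2
    + 160 * I * t ^ 4 - 48 * I * x * t ^ 2 + 48 * I * t ^ 2 + 2 * I * x ^ 4 - 3 * I * x)

/-- The denominator of the second-order wave for `a = 0`, `c₁ = c₂ = √2 / 2`. -/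
def secondDen (x t : ℝ) : ℝ :=
    1024 * t ^ 6 + 768 * x ^ 2 * t ^ 4 - 768 * x * t ^ 4 + 1920 * t ^ 4 + 192 * x ^ 4 * t ^ 2
    - 384 * x ^ 3 * t ^ 2 + 288 * x * t ^ 2 + 288 * t ^ 2 + 16 * x ^ 6 - 48 * x ^ 5
    + 72 * x ^ 4 - 72 * x ^ 3 + 72 * x ^ 2 - 36 * x + 9

/-- The numerator of the third-order wave for `a = 0`, `c₁ = c₂ = √2 / 2`. -/
def thirdNum (x t : ℂ) : ℂ :=
  2 * (√2 : ℝ) * (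
    -256 * x ^ 12 - 6144 * x ^ 10 * t ^ 2 - 61440 * x ^ 8 * t ^ 4 - 327680 * x ^ 6 * t ^ 6
    - 983040 * x ^ 4 * t ^ 8 - 1572864 * x ^ 2 * t ^ 10 - 1048576 * t ^ 12 + 1536 * x ^ 11
    + 3072 * I * x ^ 10 * t + 30720 * x ^ 9 * t ^ 2 + 61440 * I * x ^ 8 * t ^ 3
    + 245760 * x ^ 7 * t ^ 4 + 491520 * I * x ^ 6 * t ^ 5 + 983040 * x ^ 5 * t ^ 6
    + 1966080 * I * x ^ 4 * t ^ 7 + 1966080 * x ^ 3 * t ^ 8 + 3932160 * I * x ^ 2 * t ^ 9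
    + 1572864 * x * t ^ 10 + 3145728 * I * t ^ 11 - 3840 * x ^ 10 - 15360 * I * x ^ 9 * t
    - 245760 * I * x ^ 7 * t ^ 3 + 368640 * x ^ 6 * t ^ 4 - 1474560 * I * x ^ 5 * t ^ 5
    + 1966080 * x ^ 4 * t ^ 6 - 3932160 * I * x ^ 3 * t ^ 7 + 2949120 * x ^ 2 * t ^ 8
    - 3932160 * I * x * t ^ 9 + 5760 * x ^ 9 + 23040 * I * x ^ 8 * t - 184320 * x ^ 7 * t ^ 2
    - 2027520 * x ^ 5 * t ^ 4 - 737280 * I * x ^ 4 * t ^ 5 - 5898240 * x ^ 3 * t ^ 6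
    - 4423680 * x * t ^ 8 + 5898240 * I * t ^ 9 - 5760 * x ^ 8 + 322560 * x ^ 6 * t ^ 2
    + 921600 * I * x ^ 5 * t ^ 3 + 2764800 * x ^ 4 * t ^ 4 + 4423680 * I * x ^ 3 * t ^ 5
    - 3686400 * x ^ 2 * t ^ 6 + 2949120 * I * x * t ^ 7 + 10321920 * t ^ 8 + 4320 * x ^ 7
    - 69120 * I * x ^ 6 * t - 155520 * x ^ 5 * t ^ 2 - 1843200 * I * x ^ 4 * t ^ 3
    - 2188800 * x ^ 3 * t ^ 4 + 1105920 * I * x ^ 2 * t ^ 5 + 8755200 * x * t ^ 6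
    - 11796480 * I * t ^ 7 - 2880 * x ^ 6 + 146880 * I * x ^ 5 * t - 259200 * x ^ 4 * t ^ 2
    + 2188800 * I * x ^ 3 * t ^ 3 + 1382400 * x ^ 2 * t ^ 4 - 5391360 * I * x * t ^ 5
    - 92160 * t ^ 6 + 4320 * x ^ 5 - 216000 * I * x ^ 4 * t + 604800 * x ^ 3 * t ^ 2
    - 2764800 * I * x ^ 2 * t ^ 3 - 691200 * x * t ^ 4 - 5391360 * I * t ^ 5 - 16200 * x ^ 4
    + 172800 * I * x ^ 3 * t - 1036800 * x ^ 2 * t ^ 2 + 1555200 * I * x * t ^ 3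
    - 3542400 * t ^ 4 + 21600 * x ^ 3 + 648000 * x * t ^ 2 - 432000 * I * t ^ 3 - 18225 * x ^ 2
    - 64800 * I * x * t - 267300 * t ^ 2 + 6075 * x + 36450 * I * t)

/-- The denominator of the third-order wave for `a = 0`, `c₁ = c₂ = √2 / 2`. -/
def thirdDen (x t : ℝ) : ℝ :=
    512 * x ^ 12 + 12288 * x ^ 10 * t ^ 2 + 122880 * x ^ 8 * t ^ 4 + 655360 * x ^ 6 * t ^ 6
    + 1966080 * x ^ 4 * t ^ 8 + 3145728 * x ^ 2 * t ^ 10 + 2097152 * t ^ 12 - 3072 * x ^ 11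
    - 61440 * x ^ 9 * t ^ 2 - 491520 * x ^ 7 * t ^ 4 - 1966080 * x ^ 5 * t ^ 6
    - 3932160 * x ^ 3 * t ^ 8 - 3145728 * x * t ^ 10 + 9216 * x ^ 10 + 92160 * x ^ 8 * t ^ 2
    + 491520 * x ^ 6 * t ^ 4 + 2949120 * x ^ 4 * t ^ 6 + 11796480 * x ^ 2 * t ^ 8
    + 17301504 * t ^ 10 - 19200 * x ^ 9 + 368640 * x ^ 5 * t ^ 4 - 1966080 * x ^ 3 * t ^ 6
    - 8847360 * x * t ^ 8 + 34560 * x ^ 8 - 92160 * x ^ 6 * t ^ 2 - 1843200 * x ^ 4 * t ^ 4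
    + 28016640 * x ^ 2 * t ^ 6 + 32440320 * t ^ 8 - 54720 * x ^ 7 + 34560 * x ^ 5 * t ^ 2
    + 4377600 * x ^ 3 * t ^ 4 - 27832320 * x * t ^ 6 + 86400 * x ^ 6 + 518400 * x ^ 4 * t ^ 2
    + 5529600 * x ^ 2 * t ^ 4 + 14929920 * t ^ 6 - 108000 * x ^ 5 - 691200 * x ^ 3 * t ^ 2
    - 9331200 * x * t ^ 4 + 97200 * x ^ 4 + 7430400 * t ^ 4 - 64800 * x ^ 3
    + 259200 * x * t ^ 2 + 36450 * x ^ 2 + 145800 * t ^ 2 - 12150 * x + 2025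

end Manakov

end

/-! Put `c = √(c₁² + c₂²)`, `s = ε² = λ - λ₀`, `z = x - 2at + 2ict` and `w = z + 2st`. Since `u² =
-s(2ic + s)`, the eigenfunction is a common factor times `(f, (c₁/c) g, (c₂/c) g)`, where `f =
sinh(uw)/u` and `g = (cosh(uw) + i(ic + s) f)/c` are power series in `s` with polynomial
coefficients in `x, t`. The common factor is `ε^(m+1)` times an even series in `ε`, so the
derivatives of orders `2k + 1 + m` see exactly the coefficients of `s^k`, `k < n`, and `m` drops
out. Both components of the solution turn out to be `c_k/c` times one scalar wave `W` times the
carrier. The vector statement thus becomes a statement about the scalar NLS equation with amplitude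
`c`.

The wave. Modulo `s^n`, multiplication by `ic + s` is a matrix `Λ`, and the truncated `f, g` solve
the Lax pair with `Λ` as spectral parameter. If `ΛN - NΛ† = ic(ff† + gg†)`, then `W = c(1 + 2
g†N⁻¹f)` is a binary Darboux transform of the plane wave and solves NLS (`IsDarboux.nls`,
`IsDarboux.wave_nls`). The Sylvester equation is uniquely solvable, which forces the derivatives of
`N` (`isDarboux_of_sylvester`). Its solution is explicit: `N = Σ e_p e_p†` with `(2ic + s) e_(p+2) =
s e_p`, because the Sylvester expression telescopes (`sylvester_gramMat`). A triangular family of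
constant coefficients makes `N` positive definite (`posDef_gramMat`). So `W` is smooth on the plane
and rational with denominator `H = det N > 0`.

Infinity. With `z` of weight `1` and `s` of weight `-2`, the series `e_p` has weight `1 - p`. The
leading coefficients of `e_0, …, e_(n-1)` form an invertible Vandermonde-type matrix
(`det_basisLead_ne_zero`) and the remaining `e_p` are negligible. Hence `det N` grows like
`|z|^(n(n+1))`, and since `f = Σ e_p` and `g = Σ (-1)^(p+1) e_p` modulo `s^n`, the wave tends to
`c(-1)^n` (`tendsto_det_gramMat`, `tendsto_wave`).

Lowest terms. The numerator `P`, its conjugate and `H` satisfy bilinear equations, together with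
`|P|² = c²H² + H H_xx - H_x²`. If a prime divides `P` and `H`, comparing its multiplicities in the
three polynomials gives a contradiction (`not_dvd_of_bilinear`).

Rise and asymmetry. At the origin `f = 0`, so `W = c`; the trace of the Sylvester equation gives
`∂ₓW = 4nc² > 0` there (`waveFun_origin`). So `|W|` exceeds `c` nearby and is not even in `x`. For
`n = 2, 3` every other centre is excluded by the explicit rational functions on the line `t = 0`.

Determinants. A vector of column coefficients of `Ω₂'` is a triple of polynomials of degree `< n`,
and the rows are interpolation conditions at `λ₀`. The homogeneous problem is trivial away from the
origin, because `A A* + B B*` has `2n` roots counted with multiplicity but degree below `2n`, and is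
nonnegative on the real line (`interpolation_unique`). The inhomogeneous problem with right side
`λⁿf` is solved through `N⁻¹f` (`interpolation_solution`), and Cramer's rule turns the quotients of
determinants into `g†N⁻¹f` (`formula_eq_modulated`). -/

namespace Manakov

/-! ### Derivations of matrices and sesquilinear forms over a commutative star ring. -/

section Gram

open Matrix

variable {R : Type*} [CommRing R] {n : ℕ} {k : Type*} [CommRing k] [Algebra k R]

theorem derivation_dotProduct (D : Derivation k R R) (a b : Fin n → R) :
    D (a ⬝ᵥ b) = (fun i => D (a i)) ⬝ᵥ b + a ⬝ᵥ (fun i => D (b i)) := by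
  simp only [dotProduct, map_sum, Derivation.leibniz, smul_eq_mul, Finset.sum_add_distrib]
  rw [add_comm]; simp only [mul_comm]

theorem derivation_mulVec (D : Derivation k R R) (M : Matrix (Fin n) (Fin n) R) (b : Fin n → R) :
    (fun i => D ((M *ᵥ b) i)) = M.map D *ᵥ b + M *ᵥ (fun i => D (b i)) := by
  ext i
  exact derivation_dotProduct D _ _

theorem derivation_matrix_mul (D : Derivation k R R) (M N : Matrix (Fin n) (Fin n) R) :
    (M * N).map D = M.map D * N + M * N.map D := by
  ext i j
  exact derivation_dotProduct D _ _

theorem derivation_inverse (D : Derivation k R R) {G N : Matrix (Fin n) (Fin n) R}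
    (hGN : G * N = 1) (hNG : N * G = 1) : G.map D = -(G * N.map D * G) := by
  have h := derivation_matrix_mul D G N
  rw [hGN] at h
  have h1 : (1 : Matrix (Fin n) (Fin n) R).map D = 0 := by
    ext i j
    by_cases h : i = j <;> simp [h]
  rw [h1] at h
  have h2 : G.map D * N * G = -(G * N.map D * G) := by
    rw [eq_neg_of_add_eq_zero_left h.symm, neg_mul]
  rwa [mul_assoc, hNG, mul_one] at h2

theorem derivation_prod {ι : Type*} [DecidableEq ι] (D : Derivation k R R) (s : Finset ι)
    (f : ι → R) : D (∏ i ∈ s, f i) = ∑ j ∈ s, D (f j) * ∏ i ∈ s.erase j, f i := by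
  induction s using Finset.induction_on with
  | empty => simp
  | insert a s ha ih =>
    rw [Finset.prod_insert ha, Derivation.leibniz, ih, Finset.sum_insert ha,
      Finset.erase_insert ha, smul_eq_mul, smul_eq_mul, add_comm, mul_comm, Finset.mul_sum]
    congr 1
    refine Finset.sum_congr rfl fun j hj => ?_
    have hja : a ≠ j := fun h => ha (h ▸ hj)
    rw [Finset.erase_insert_of_ne hja, Finset.prod_insert (fun h => ha (Finset.mem_of_mem_erase h))]
    ring

/-- Jacobi's formula. -/
theorem derivation_det (D : Derivation k R R) (M : Matrix (Fin n) (Fin n) R) :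
    D M.det = (M.adjugate * M.map D).trace := by
  -- By Leibniz, the derivative is a sum of determinants with one column differentiated; Cramer's
  -- rule then produces the adjugate.
  have h1 : D M.det = ∑ j, (M.updateCol j fun i => D (M i j)).det := by
    simp only [det_apply, map_sum]
    rw [Finset.sum_comm]
    refine Finset.sum_congr rfl fun σ _ => ?_
    rw [← Finset.smul_sum, Units.smul_def, Units.smul_def, map_zsmul, derivation_prod]
    congr 1
    refine Finset.sum_congr rfl fun j _ => ?_
    rw [← Finset.mul_prod_erase _ _ (Finset.mem_univ j), updateCol_self]
    congr 1
    refine Finset.prod_congr rfl fun i hi => ?_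
    rw [updateCol_ne (Finset.ne_of_mem_erase hi)]
  rw [h1, trace]
  refine Finset.sum_congr rfl fun j _ => ?_
  rw [← cramer_apply, cramer_eq_adjugate_mulVec]
  rfl

variable [StarRing R]

/-- The sesquilinear form `a† G b`. -/
def gramForm (G : Matrix (Fin n) (Fin n) R) (a b : Fin n → R) : R := star a ⬝ᵥ (G *ᵥ b)

variable (G : Matrix (Fin n) (Fin n) R)

theorem gramForm_add_left (a b d : Fin n → R) :
    gramForm G (a + b) d = gramForm G a d + gramForm G b d := by
  simp [gramForm, add_dotProduct]

theorem gramForm_add_right (a b d : Fin n → R) :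
    gramForm G a (b + d) = gramForm G a b + gramForm G a d := by
  simp [gramForm, mulVec_add]

theorem gramForm_smul_left (r : R) (a b : Fin n → R) :
    gramForm G (r • a) b = star r * gramForm G a b := by
  simp [gramForm]

theorem gramForm_smul_right (r : R) (a b : Fin n → R) :
    gramForm G a (r • b) = r * gramForm G a b := by
  simp [gramForm, mulVec_smul]

theorem star_gramForm (hG : Gᴴ = G) (a b : Fin n → R) :
    star (gramForm G a b) = gramForm G b a := by
  rw [gramForm, gramForm, star_dotProduct, star_mulVec, star_star, hG, dotProduct_mulVec,
    dotProduct_comm]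

theorem gramForm_rankOne (a b u v : Fin n → R) :
    star a ⬝ᵥ ((G * vecMulVec u (star v) * G) *ᵥ b) = gramForm G a u * gramForm G v b := by
  simp only [gramForm]
  rw [mul_vecMulVec, ← mulVec_mulVec, vecMulVec_mulVec]
  simp [mul_comm]

/-- If `Λ N - N Λ† = d (f f† + g g†)` then `Λ†` can be moved through the inverse of `N`. -/
theorem gramForm_adjoint {N Λ : Matrix (Fin n) (Fin n) R} (hGN : G * N = 1) (hNG : N * G = 1)
    {d : R} {f g : Fin n → R}
    (hN : Λ * N - N * Λᴴ = d • (vecMulVec f (star f) + vecMulVec g (star g)))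
    (a b : Fin n → R) :
    gramForm G (Λ *ᵥ a) b = gramForm G a (Λ *ᵥ b)
      - d * (gramForm G a f * gramForm G f b + gramForm G a g * gramForm G g b) := by
  have h : Λᴴ * G = G * Λ - d • (G * vecMulVec f (star f) * G + G * vecMulVec g (star g) * G) := by
    have h1 : G * (Λ * N - N * Λᴴ) * G = G * Λ - Λᴴ * G := by
      rw [mul_sub, sub_mul, ← mul_assoc, ← mul_assoc, hGN, one_mul, mul_assoc, hNG, mul_one]
    rw [hN] at h1
    simp only [mul_smul_comm, smul_mul_assoc, mul_add, add_mul] at h1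
    rw [smul_add, ← smul_add] at h1 ⊢
    rw [h1]; abel
  have h2 : gramForm G (Λ *ᵥ a) b = star a ⬝ᵥ ((Λᴴ * G) *ᵥ b) := by
    rw [gramForm, star_mulVec, ← mulVec_mulVec, dotProduct_mulVec (star a)]
  rw [h2, h, sub_mulVec, smul_mulVec, add_mulVec, dotProduct_sub, dotProduct_smul, dotProduct_add,
    gramForm_rankOne, gramForm_rankOne, ← mulVec_mulVec]
  rfl

theorem derivation_gramForm (D : Derivation k R R) (hD : ∀ r, D (star r) = star (D r))
    {N : Matrix (Fin n) (Fin n) R}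
    (hGN : G * N = 1) (hNG : N * G = 1) (a b : Fin n → R) :
    D (gramForm G a b) = gramForm G (fun i => D (a i)) b + gramForm G a (fun i => D (b i))
      - star a ⬝ᵥ ((G * N.map D * G) *ᵥ b) := by
  rw [gramForm, derivation_dotProduct, derivation_mulVec, derivation_inverse D hGN hNG,
    neg_mulVec, dotProduct_add, dotProduct_neg]
  have : (fun i => D (star a i)) = star (fun i => D (a i)) := by
    ext i; simp [hD]
  rw [this]
  simp only [gramForm]
  ring


/-! ### The binary Darboux transformation of a plane wave, in algebraic form. -/

variable {R : Type*} [CommRing R] [StarRing R] [Algebra ℂ R] {n : ℕ}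

/-- The data of a binary Darboux transformation of the plane wave of amplitude `c`: vectors `f`, `g`
that solve the Lax pair with the matrix spectral parameter `Λ`, and the Gram matrix `N` with its
inverse `G`. -/
structure IsDarboux (Dx Dt : Derivation ℂ R R) (c : ℝ) (f g : Fin n → R)
    (Λ N G : Matrix (Fin n) (Fin n) R) : Prop where
  star_Dx : ∀ r, Dx (star r) = star (Dx r)
  star_Dt : ∀ r, Dt (star r) = star (Dt r)
  Dx_Λ : Λ.map Dx = 0
  Dt_Λ : Λ.map Dt = 0
  mul_inv : N * G = 1
  inv_mul : G * N = 1
  herm : Gᴴ = G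
  sylvester : Λ * N - N * Λᴴ =
    (algebraMap ℂ R (I * c)) • (vecMulVec f (star f) + vecMulVec g (star g))
  Dx_f : (fun i => Dx (f i)) = -algebraMap ℂ R I • (Λ *ᵥ f) + algebraMap ℂ R c • g
  Dx_g : (fun i => Dx (g i)) = algebraMap ℂ R I • (Λ *ᵥ g) + -algebraMap ℂ R c • f
  Dt_f : (fun i => Dt (f i)) = (2 : R) • (Λ *ᵥ fun i => Dx (f i))
  Dt_g : (fun i => Dt (g i)) = (2 : R) • (Λ *ᵥ fun i => Dx (g i))
  Dx_N : N.map Dx = algebraMap ℂ R c • (vecMulVec f (star f) - vecMulVec g (star g))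
  Dt_N : N.map Dt = (2 * algebraMap ℂ R c) •
      (vecMulVec (Λ *ᵥ f) (star f) + vecMulVec f (star (Λ *ᵥ f))
        - vecMulVec (Λ *ᵥ g) (star g) - vecMulVec g (star (Λ *ᵥ g)))
      + (2 * algebraMap ℂ R I * algebraMap ℂ R c ^ 2) •
        (vecMulVec g (star f) - vecMulVec f (star g))

namespace IsDarboux

variable {Dx Dt : Derivation ℂ R R} {c : ℝ} {f g : Fin n → R}
    {Λ N G : Matrix (Fin n) (Fin n) R}

/-- Since `∂ₓN` has rank two, derivatives of the forms `a†N⁻¹b` are again polynomials in such forms.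
This closes the calculus in which NLS is verified. -/
theorem Dx_gramForm (h : IsDarboux Dx Dt c f g Λ N G) (a b : Fin n → R) :
    Dx (gramForm G a b) = gramForm G (fun i => Dx (a i)) b + gramForm G a (fun i => Dx (b i))
      - algebraMap ℂ R c * (gramForm G a f * gramForm G f b - gramForm G a g * gramForm G g b) := by
  rw [derivation_gramForm G Dx h.star_Dx h.inv_mul h.mul_inv, h.Dx_N, mul_smul_comm,
    smul_mul_assoc, mul_sub, sub_mul, smul_mulVec, sub_mulVec, dotProduct_smul, dotProduct_sub,
    gramForm_rankOne, gramForm_rankOne, smul_eq_mul]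

theorem Dt_gramForm (h : IsDarboux Dx Dt c f g Λ N G) (a b : Fin n → R) :
    Dt (gramForm G a b) = gramForm G (fun i => Dt (a i)) b + gramForm G a (fun i => Dt (b i))
      - ((2 * algebraMap ℂ R c) * (gramForm G a (Λ *ᵥ f) * gramForm G f b
          + gramForm G a f * gramForm G (Λ *ᵥ f) b - gramForm G a (Λ *ᵥ g) * gramForm G g b
          - gramForm G a g * gramForm G (Λ *ᵥ g) b)
        + (2 * algebraMap ℂ R I * algebraMap ℂ R c ^ 2) *
          (gramForm G a g * gramForm G f b - gramForm G a f * gramForm G g b)) := by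
  rw [derivation_gramForm G Dt h.star_Dt h.inv_mul h.mul_inv, h.Dt_N]
  simp only [mul_add, add_mul, mul_sub, sub_mul, mul_smul_comm, smul_mul_assoc, add_mulVec,
    sub_mulVec, smul_mulVec, dotProduct_add, dotProduct_sub, dotProduct_smul, gramForm_rankOne,
    smul_eq_mul]

theorem adjoint (h : IsDarboux Dx Dt c f g Λ N G) (a b : Fin n → R) :
    gramForm G (Λ *ᵥ a) b = gramForm G a (Λ *ᵥ b) - algebraMap ℂ R (I * c) *
      (gramForm G a f * gramForm G f b + gramForm G a g * gramForm G g b) :=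
  gramForm_adjoint G h.inv_mul h.mul_inv h.sylvester a b

theorem Dx_mulVec (h : IsDarboux Dx Dt c f g Λ N G) (a : Fin n → R) :
    (fun i => Dx ((Λ *ᵥ a) i)) = Λ *ᵥ fun i => Dx (a i) := by
  rw [derivation_mulVec, h.Dx_Λ, zero_mulVec, zero_add]

theorem I_sq' {R : Type*} [CommRing R] [Algebra ℂ R] : algebraMap ℂ R I ^ 2 = -1 := by
  rw [← map_pow, Complex.I_sq, map_neg, map_one]

/-- The trace of the Sylvester equation. -/
theorem gramForm_ff_add_gg (h : IsDarboux Dx Dt c f g Λ N G) :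
    algebraMap ℂ R (I * c) * (gramForm G f f + gramForm G g g) = Λ.trace - Λᴴ.trace := by
  have h1 := congrArg (fun M => (G * M).trace) h.sylvester
  have h2 : (G * (Λ * N)).trace = Λ.trace := by
    rw [trace_mul_comm, mul_assoc, h.mul_inv, mul_one]
  have h3 : (G * (N * Λᴴ)).trace = Λᴴ.trace := by
    rw [← mul_assoc, h.inv_mul, one_mul]
  have h4 : ∀ a : Fin n → R, (G * vecMulVec a (star a)).trace = gramForm G a a := by
    intro a
    rw [mul_vecMulVec, trace_vecMulVec, gramForm, dotProduct_comm]
  simp only [mul_sub, trace_sub, h2, h3, mul_smul_comm, trace_smul, mul_add, trace_add, h4,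
    smul_eq_mul] at h1
  rw [h1]; ring

/-- The logarithmic derivative of the determinant of the Gram matrix. -/
theorem Dx_det (h : IsDarboux Dx Dt c f g Λ N G) :
    Dx N.det = N.det * (algebraMap ℂ R c * (gramForm G f f - gramForm G g g)) := by
  have h4 : ∀ a : Fin n → R, (G * vecMulVec a (star a)).trace = gramForm G a a := by
    intro a
    rw [mul_vecMulVec, trace_vecMulVec, gramForm, dotProduct_comm]
  have h5 : N.adjugate = N.det • G := by
    have := congrArg (· * G) (adjugate_mul N)
    simpa [mul_assoc, h.mul_inv] using this
  rw [derivation_det, h.Dx_N, h5, smul_mul_assoc, trace_smul, mul_smul_comm, trace_smul, mul_sub,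
    trace_sub, h4, h4, smul_eq_mul, smul_eq_mul]

variable [StarModule ℂ R]

theorem star_I : star (algebraMap ℂ R I) = -algebraMap ℂ R I := by
  rw [← algebraMap_star_comm]; simp

theorem star_ofReal (c : ℝ) : star (algebraMap ℂ R c) = algebraMap ℂ R c := by
  rw [← algebraMap_star_comm]; simp

/-- The terms with `Λ` in the two slots have opposite signs and cancel up to the rank-two defect in
`adjoint`, so only forms in `f` and `g` remain. -/
theorem Dx_gramForm_ff (h : IsDarboux Dx Dt c f g Λ N G) :
    Dx (gramForm G f f) = algebraMap ℂ R c * (2 * gramForm G g f * gramForm G f g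
      + gramForm G g f + gramForm G f g) := by
  rw [h.Dx_gramForm, h.Dx_f]
  simp only [gramForm_add_left, gramForm_add_right, gramForm_smul_left, gramForm_smul_right,
    h.adjoint, star_I, star_ofReal, star_neg, map_mul]
  linear_combination (-algebraMap ℂ R c * (gramForm G f f ^ 2 + gramForm G g f * gramForm G f g))
    * I_sq' (R := R)

theorem Dx_gramForm_gg (h : IsDarboux Dx Dt c f g Λ N G) :
    Dx (gramForm G g g) = -algebraMap ℂ R c * (2 * gramForm G g f * gramForm G f g
      + gramForm G g f + gramForm G f g) := by
  rw [h.Dx_gramForm, h.Dx_g]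
  simp only [gramForm_add_left, gramForm_add_right, gramForm_smul_left, gramForm_smul_right,
    h.adjoint, star_I, star_ofReal, star_neg, map_mul]
  linear_combination (algebraMap ℂ R c * (gramForm G g g ^ 2 + gramForm G g f * gramForm G f g))
    * I_sq' (R := R)

/-- Here, in contrast to the diagonal forms, the two `Λ` terms add up, which leaves the new quantity
`g†N⁻¹Λf`. -/
theorem Dx_gramForm_gf (h : IsDarboux Dx Dt c f g Λ N G) :
    Dx (gramForm G g f) = -2 * algebraMap ℂ R I * gramForm G g (Λ *ᵥ f)
      - 2 * algebraMap ℂ R c * gramForm G g f * gramForm G f f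
      - algebraMap ℂ R c * (gramForm G f f - gramForm G g g) := by
  rw [h.Dx_gramForm, h.Dx_f, h.Dx_g]
  simp only [gramForm_add_left, gramForm_add_right, gramForm_smul_left, gramForm_smul_right,
    h.adjoint, star_I, star_ofReal, star_neg, map_mul]
  linear_combination (algebraMap ℂ R c * gramForm G g f * (gramForm G f f + gramForm G g g))
    * I_sq' (R := R)

/-- The last term is the nonlinearity in disguise: for `W = c(1 + 2 g†N⁻¹f)` one has `W W* - c² = 2c
∂ₓ(f†N⁻¹f)`. After all `Λ` are moved to the right slot by `adjoint`, the claim is a polynomial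
identity. -/
theorem nls (h : IsDarboux Dx Dt c f g Λ N G) :
    algebraMap ℂ R I * Dt (gramForm G g f) + Dx (Dx (gramForm G g f))
      + 2 * algebraMap ℂ R c * Dx (gramForm G f f) * (1 + 2 * gramForm G g f) = 0 := by
  have hY : Dx (gramForm G g (Λ *ᵥ f)) = _ := h.Dx_gramForm g (Λ *ᵥ f)
  rw [h.Dx_mulVec, h.Dx_f, h.Dx_g] at hY
  have hT : Dt (gramForm G g f) = _ := h.Dt_gramForm g f
  rw [h.Dt_f, h.Dt_g, h.Dx_f, h.Dx_g] at hT
  have h2 : Dx 2 = 0 := by exact_mod_cast Dx.map_natCast 2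
  have hxx := congrArg Dx h.Dx_gramForm_gf
  rw [hxx]
  simp only [map_sub, map_neg, Derivation.leibniz, smul_eq_mul, Derivation.map_algebraMap, h2,
    mul_zero, add_zero, neg_zero, h.Dx_gramForm_gf, h.Dx_gramForm_ff, h.Dx_gramForm_gg]
  rw [hY, hT]
  simp only [mulVec_add, mulVec_smul, gramForm_add_left, gramForm_add_right, gramForm_smul_left,
    gramForm_smul_right, h.adjoint, star_I, star_ofReal, star_neg, map_mul, star_ofNat]
  -- From here on the forms act as independent variables; only `ι² = -1` is needed.
  generalize gramForm G g (Λ *ᵥ Λ *ᵥ f) = W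
  generalize gramForm G g (Λ *ᵥ f) = Ygf
  generalize gramForm G f (Λ *ᵥ f) = Yff
  generalize gramForm G g (Λ *ᵥ g) = Ygg
  generalize gramForm G f (Λ *ᵥ g) = Yfg
  generalize gramForm G g f = gf
  generalize gramForm G f g = fg
  generalize gramForm G f f = ff
  generalize gramForm G g g = gg
  have hI := I_sq' (R := R)
  generalize algebraMap ℂ R I = ι at *
  generalize algebraMap ℂ R c = κ at *
  ring_nf
  have h3 : ι ^ 3 = -ι := by rw [pow_succ, hI]; ring
  have h4 : ι ^ 4 = 1 := by rw [show ι ^ 4 = (ι ^ 2) ^ 2 by ring, hI]; ring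
  simp only [h3, h4, hI]
  ring

end IsDarboux

end Gram

end Manakov

namespace Manakov

noncomputable section

/-! ### The eigenfunctions as power series in `s = λ - λ₀`. -/

section Series

open PowerSeries

/-- The sum of a sequence of power series `F j` that are divisible by `X ^ j`. -/
def lsum {R : Type*} [CommRing R] (F : ℕ → R⟦X⟧) : R⟦X⟧ :=
  mk fun k => ∑ j ∈ Finset.range (k + 1), coeff k (F j)

theorem eq_of_forall_X_pow_dvd_sub {R : Type*} [CommRing R] {F G : R⟦X⟧}
    (h : ∀ K : ℕ, X ^ K ∣ F - G) : F = G := by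
  ext k
  have := X_pow_dvd_iff.1 (h (k + 1)) k (Nat.lt_succ_self k)
  rwa [map_sub, sub_eq_zero] at this

section lsum

variable {R : Type*} [CommRing R] {F G : ℕ → R⟦X⟧}

theorem coeff_lsum (hF : ∀ j, X ^ j ∣ F j) {k K : ℕ} (hk : k < K) :
    coeff k (lsum F) = ∑ j ∈ Finset.range K, coeff k (F j) := by
  rw [lsum, coeff_mk]
  refine Finset.sum_subset (Finset.range_mono hk) fun j _ hj => ?_
  exact X_pow_dvd_iff.1 (hF j) k (by simpa using hj)

theorem X_pow_dvd_lsum_sub (hF : ∀ j, X ^ j ∣ F j) {k K : ℕ} (hk : k ≤ K) :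
    X ^ k ∣ lsum F - ∑ j ∈ Finset.range K, F j := by
  rw [X_pow_dvd_iff]
  intro i hi
  rw [map_sub, coeff_lsum hF (lt_of_lt_of_le hi hk), map_sum, sub_self]

/-- The truncation `L ≥ K` is left free because shifting an index changes the number of terms in the
partial sums. -/
theorem eq_lsum (hF : ∀ j, X ^ j ∣ F j) {S : R⟦X⟧}
    (hS : ∀ K, ∃ L ≥ K, X ^ K ∣ S - ∑ j ∈ Finset.range L, F j) : S = lsum F := by
  refine eq_of_forall_X_pow_dvd_sub fun K => ?_
  obtain ⟨L, hL, h⟩ := hS K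
  have := dvd_sub h (X_pow_dvd_lsum_sub hF hL)
  rwa [sub_sub_sub_cancel_right] at this

theorem mul_lsum (hF : ∀ j, X ^ j ∣ F j) (A : R⟦X⟧) : A * lsum F = lsum fun j => A * F j := by
  refine eq_lsum (fun j => (hF j).mul_left _) fun K => ⟨K, le_rfl, ?_⟩
  rw [← Finset.mul_sum, ← mul_sub]
  exact (X_pow_dvd_lsum_sub hF le_rfl).mul_left _

theorem mul_lsum_eq_of_succ (hF : ∀ j, X ^ j ∣ F j) {A : R⟦X⟧} (hA : X ∣ A) (h0 : G 0 = 0)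
    (hG : ∀ j, G (j + 1) = A * F j) : A * lsum F = lsum G := by
  have hG' : ∀ j, X ^ j ∣ G j := by
    rintro (_ | j)
    · simp
    · rw [hG, pow_succ, mul_comm]; exact mul_dvd_mul hA (hF j)
  refine eq_lsum hG' fun K => ⟨K + 1, K.le_succ, ?_⟩
  rw [Finset.sum_range_succ', h0, add_zero, Finset.sum_congr rfl fun j _ => hG j,
    ← Finset.mul_sum, ← mul_sub]
  exact (X_pow_dvd_lsum_sub hF le_rfl).mul_left _

theorem map_lsum {S : Type*} [CommRing S] (φ : R →+* S) :
    map φ (lsum F) = lsum fun j => map φ (F j) := by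
  ext k
  simp [lsum, map_sum]

end lsum

/-- A derivation acts on power series coefficientwise. -/
def coeffDerivation {k R : Type*} [CommRing k] [CommRing R] [Algebra k R] (D : Derivation k R R) :
    Derivation k R⟦X⟧ R⟦X⟧ :=
  Derivation.mk'
    { toFun := fun F => mk fun k => D (coeff k F)
      map_add' := fun F G => by ext; simp
      map_smul' := fun r F => by ext; simp }
    fun F G => by
      ext k
      simp only [LinearMap.coe_mk, AddHom.coe_mk, coeff_mk, coeff_mul, map_sum,
        Derivation.leibniz, smul_eq_mul, map_add, Finset.sum_add_distrib]
      congr 1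
      rw [← Finset.Nat.sum_antidiagonal_swap]
      simp

section coeffDerivation

variable {k R : Type*} [CommRing k] [CommRing R] [Algebra k R] (D : Derivation k R R)

@[simp]
theorem coeff_coeffDerivation (F : R⟦X⟧) (j : ℕ) :
    coeff j (coeffDerivation D F) = D (coeff j F) := by
  simp [coeffDerivation]

theorem coeffDerivation_C (r : R) : coeffDerivation D (C r) = C (D r) := by
  ext j
  simp only [coeff_coeffDerivation, coeff_C]
  split_ifs <;> simp

theorem coeffDerivation_X : coeffDerivation D (X : R⟦X⟧) = 0 := by
  ext j
  simp only [coeff_coeffDerivation, coeff_X]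
  split_ifs <;> simp

theorem coeffDerivation_lsum (F : ℕ → R⟦X⟧) :
    coeffDerivation D (lsum F) = lsum fun j => coeffDerivation D (F j) := by
  ext j
  simp [lsum, map_sum]

end coeffDerivation

variable {R : Type*} [CommRing R] [Algebra ℂ R]

/-- Constants as power series. -/
def cst (R : Type*) [CommRing R] [Algebra ℂ R] (z : ℂ) : R⟦X⟧ := C (algebraMap ℂ R z)

theorem cst_mul (z w : ℂ) : cst R (z * w) = cst R z * cst R w := by simp [cst]
theorem cst_add (z w : ℂ) : cst R (z + w) = cst R z + cst R w := by simp [cst]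
theorem cst_neg (z : ℂ) : cst R (-z) = -cst R z := by simp [cst]
theorem cst_one : cst R 1 = 1 := by simp [cst]
theorem cst_natCast (n : ℕ) : cst R n = n := by rw [cst, map_natCast, map_natCast]
theorem cst_two : cst R 2 = 2 := cst_natCast 2

theorem cst_inv_factorial_succ_mul (n : ℕ) :
    cst R ((n + 1).factorial : ℂ)⁻¹ * ((n + 1 : ℕ) : R⟦X⟧) = cst R (n.factorial : ℂ)⁻¹ := by
  rw [← cst_natCast, ← cst_mul, Nat.factorial_succ, Nat.cast_mul]
  congr 1
  have h1 : ((n + 1 : ℕ) : ℂ) ≠ 0 := by exact_mod_cast n.succ_ne_zero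
  have h2 : (n.factorial : ℂ) ≠ 0 := by exact_mod_cast n.factorial_ne_zero
  field_simp

theorem cst_I_sq : cst R I ^ 2 = -1 := by
  rw [sq, ← cst_mul, I_mul_I, cst_neg, cst_one]
theorem cst_inv_mul {z : ℂ} (hz : z ≠ 0) : cst R z⁻¹ * cst R z = 1 := by
  rw [← cst_mul, inv_mul_cancel₀ hz, cst_one]
theorem coeffDerivation_cst (D : Derivation ℂ R R) (z : ℂ) : coeffDerivation D (cst R z) = 0 := by
  rw [cst, coeffDerivation_C, Derivation.map_algebraMap, map_zero]

theorem map_cst {S : Type*} [CommRing S] [Algebra ℂ S] (φ : R →ₐ[ℂ] S) (z : ℂ) :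
    map (φ : R →+* S) (cst R z) = cst S z := by
  simp [cst]

/-- `u ^ 2 = -s (2 i c + s)` as a power series in `s`. -/
def uSq (R : Type*) [CommRing R] [Algebra ℂ R] (c : ℝ) : R⟦X⟧ := -(X * (cst R (2 * I * c) + X))

/-- The phase `z + 2 s τ` as a power series in `s`. -/
def phase (z τ : R) : R⟦X⟧ := C z + C (2 * τ) * X

/-- `sinh (u w) / u`, where `w` is the phase. -/
def sinhSeries (c : ℝ) (z τ : R) : R⟦X⟧ :=
  lsum fun j => cst R ((2 * j + 1).factorial : ℂ)⁻¹ * (uSq R c ^ j * phase z τ ^ (2 * j + 1))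

/-- `cosh (u w)`, where `w` is the phase. -/
def coshSeries (c : ℝ) (z τ : R) : R⟦X⟧ :=
  lsum fun j => cst R ((2 * j).factorial : ℂ)⁻¹ * (uSq R c ^ j * phase z τ ^ (2 * j))

theorem X_dvd_uSq (c : ℝ) : X ∣ uSq R c := (dvd_mul_right _ _).neg_right

theorem X_pow_dvd_term (c : ℝ) (A : R⟦X⟧) (B : R⟦X⟧) (j : ℕ) :
    X ^ j ∣ A * (uSq R c ^ j * B) :=
  ((pow_dvd_pow_of_dvd (X_dvd_uSq c) j).mul_right _).mul_left _

/-- The series `u²` has constant coefficients, so a derivation sees only the powers of the phase,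
and the rule `d/dw (sinh(uw)/u) = cosh(uw)` holds term by term. -/
theorem coeffDerivation_sinhSeries (D : Derivation ℂ R R) (c : ℝ) (z τ : R) :
    coeffDerivation D (sinhSeries c z τ) = coeffDerivation D (phase z τ) * coshSeries c z τ := by
  rw [sinhSeries, coeffDerivation_lsum, coshSeries, mul_lsum fun j => X_pow_dvd_term c _ _ j]
  congr 1
  ext1 j
  have hU : coeffDerivation D (uSq R c) = 0 := by
    simp [uSq, coeffDerivation_cst, coeffDerivation_X]
  have h := cst_inv_factorial_succ_mul (R := R) (2 * j)
  simp only [Derivation.leibniz, Derivation.leibniz_pow, hU, coeffDerivation_cst, smul_eq_mul, nsmul_eq_mul, Nat.add_sub_cancel]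
  rw [← h]
  ring

theorem coeffDerivation_coshSeries (D : Derivation ℂ R R) (c : ℝ) (z τ : R) :
    coeffDerivation D (coshSeries c z τ) =
      coeffDerivation D (phase z τ) * uSq R c * sinhSeries c z τ := by
  have hU : coeffDerivation D (uSq R c) = 0 := by
    simp [uSq, coeffDerivation_cst, coeffDerivation_X]
  rw [coshSeries, coeffDerivation_lsum, sinhSeries]
  refine (mul_lsum_eq_of_succ (fun j => X_pow_dvd_term c _ _ j)
    ((X_dvd_uSq c).mul_left _) ?_ fun j => ?_).symm
  · simp [coeffDerivation_cst]
  have h := cst_inv_factorial_succ_mul (R := R) (2 * j + 1)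
  rw [show 2 * (j + 1) = 2 * j + 1 + 1 by ring]
  simp only [Derivation.leibniz, Derivation.leibniz_pow, hU, coeffDerivation_cst, smul_eq_mul, nsmul_eq_mul]
  rw [← h, Nat.add_sub_cancel]
  ring

/-- The component `f` of the eigenfunction, up to a common factor, as a power series in
`s = λ - λ₀`. -/
abbrev fSeries (c : ℝ) (z τ : R) : R⟦X⟧ := sinhSeries c z τ

/-- The component `g` of the eigenfunction, up to a common factor, as a power series in
`s = λ - λ₀`. -/
def gSeries (c : ℝ) (z τ : R) : R⟦X⟧ :=
  cst R (c : ℂ)⁻¹ * (coshSeries c z τ + cst R I * (cst R (I * c) + X) * sinhSeries c z τ)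

section Lax

variable (D : Derivation ℂ R R) {c : ℝ} (hc : c ≠ 0) (z τ : R)
include hc

/-- A single computation serves for both halves of the Lax pair: the derivation enters only through
its value on the phase, which is `1` for the `x`-part and `2(ic + s)` for the `t`-part. -/
theorem coeffDerivation_fSeries :
    coeffDerivation D (fSeries c z τ) = coeffDerivation D (phase z τ) *
      (-cst R I * (cst R (I * c) + X) * fSeries c z τ + cst R c * gSeries c z τ) := by
  have h := cst_inv_mul (R := R) (z := (c : ℂ)) (by exact_mod_cast hc)
  rw [fSeries, coeffDerivation_sinhSeries, gSeries]
  linear_combination (-coeffDerivation D (phase z τ) * (coshSeries c z τ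
    + cst R I * (cst R (I * c) + X) * sinhSeries c z τ)) * h

theorem coeffDerivation_gSeries :
    coeffDerivation D (gSeries c z τ) = coeffDerivation D (phase z τ) *
      (cst R I * (cst R (I * c) + X) * gSeries c z τ - cst R c * fSeries c z τ) := by
  have h := cst_inv_mul (R := R) (z := (c : ℂ)) (by exact_mod_cast hc)
  have hI := cst_I_sq (R := R)
  rw [gSeries, Derivation.leibniz, coeffDerivation_cst, smul_zero, add_zero, smul_eq_mul, map_add,
    coeffDerivation_coshSeries, Derivation.leibniz, coeffDerivation_sinhSeries,
    Derivation.leibniz (coeffDerivation D) (cst R I), map_add, coeffDerivation_cst,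
    coeffDerivation_cst, coeffDerivation_X]
  simp only [smul_eq_mul, uSq, fSeries, cst_mul]
  rw [cst_two]
  linear_combination (coeffDerivation D (phase z τ) * sinhSeries c z τ) *
    (cst R (c : ℂ)⁻¹ * (cst R c ^ 2 - (cst R I * cst R c + X) ^ 2) * hI - cst R c * h)

end Lax

end Series

end

end Manakov

namespace Manakov

noncomputable section

/-! ### Truncation modulo `sⁿ` and the Sylvester equation. -/

section Gram

open Matrix
open PowerSeries (coeff X C map)

variable {R : Type*} [CommRing R] {n : ℕ}

/-- The first `n` coefficients of a power series. -/
def trunc (n : ℕ) (F : PowerSeries R) : Fin n → R := fun k => coeff (k : ℕ) F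

theorem trunc_add (F H : PowerSeries R) : trunc n (F + H) = trunc n F + trunc n H := by
  ext; simp [trunc]

theorem trunc_sub (F H : PowerSeries R) : trunc n (F - H) = trunc n F - trunc n H := by
  ext; simp [trunc]

theorem trunc_eq_zero_iff {F : PowerSeries R} : trunc n F = 0 ↔ X ^ n ∣ F := by
  rw [PowerSeries.X_pow_dvd_iff, funext_iff]
  exact ⟨fun h m hm => h ⟨m, hm⟩, fun h i => h i i.2⟩

/-- The nilpotent matrix that represents multiplication of truncated power series by `X`. -/
def shift (R : Type*) [CommRing R] (n : ℕ) : Matrix (Fin n) (Fin n) R :=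
  Matrix.of fun i j => if (i : ℕ) = j + 1 then 1 else 0

theorem shift_mul_apply (M : Matrix (Fin n) (Fin n) R) (i j : Fin n) :
    (shift R n * M) i j = if h : 0 < (i : ℕ) then M ⟨i - 1, by omega⟩ j else 0 := by
  simp only [mul_apply, shift, of_apply, ite_mul, one_mul, zero_mul]
  split_ifs with h
  · rw [Finset.sum_eq_single ⟨(i : ℕ) - 1, by omega⟩]
    · simp; omega
    · intro b _ hb
      rw [if_neg]
      intro h'
      exact hb (Fin.ext (by simp; omega))
    · simp
  · exact Finset.sum_eq_zero fun b _ => if_neg (by omega)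

theorem shift_mulVec_trunc (F : PowerSeries R) : shift R n *ᵥ trunc n F = trunc n (X * F) := by
  ext i
  rw [trunc, mulVec, dotProduct]
  simp only [shift, of_apply, ite_mul, one_mul, zero_mul, trunc]
  rcases h : (i : ℕ) with _ | k
  · simp
  · rw [mul_comm, PowerSeries.coeff_succ_mul_X, Finset.sum_eq_single ⟨k, by omega⟩]
    · simp
    · intro b _ hb
      rw [if_neg]
      intro h'
      exact hb (Fin.ext (by simp; omega))
    · simp

variable [Algebra ℂ R]

theorem trunc_cst_mul (a : ℂ) (F : PowerSeries R) :
    trunc n (cst R a * F) = algebraMap ℂ R a • trunc n F := by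
  ext; simp [trunc, cst]

theorem trunc_derivation (D : Derivation ℂ R R) (F : PowerSeries R) :
    (fun i => D (trunc n F i)) = trunc n (coeffDerivation D F) := by
  ext; simp [trunc]

/-- The matrix that represents multiplication of truncated power series by `z + X`. -/
def specMat (R : Type*) [CommRing R] [Algebra ℂ R] (n : ℕ) (z : ℂ) : Matrix (Fin n) (Fin n) R :=
  algebraMap ℂ R z • 1 + shift R n

theorem specMat_mulVec_trunc (z : ℂ) (F : PowerSeries R) :
    specMat R n z *ᵥ trunc n F = trunc n ((cst R z + X) * F) := by
  rw [specMat, add_mulVec, shift_mulVec_trunc, smul_mulVec, one_mulVec, add_mul, trunc_add,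
    trunc_cst_mul]

theorem specMat_map_derivation (D : Derivation ℂ R R) (z : ℂ) : (specMat R n z).map D = 0 := by
  ext i j
  simp only [specMat, shift, map_apply, Matrix.add_apply, Matrix.smul_apply, one_apply, of_apply, smul_eq_mul,
    map_add, mul_ite, mul_one, mul_zero, Matrix.zero_apply]
  split_ifs <;> simp

variable [StarRing R] [StarModule ℂ R]

theorem conjTranspose_specMat (z : ℂ) :
    (specMat R n z)ᴴ = algebraMap ℂ R (conj z) • 1 + (shift R n)ᴴ := by
  rw [specMat, conjTranspose_add, conjTranspose_smul, conjTranspose_one, ← algebraMap_star_comm]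
  rfl

theorem mul_conjTranspose_shift_apply (M : Matrix (Fin n) (Fin n) R) (i j : Fin n) :
    (M * (shift R n)ᴴ) i j = if h : 0 < (j : ℕ) then M i ⟨j - 1, by omega⟩ else 0 := by
  have : M * (shift R n)ᴴ = (shift R n * Mᴴ)ᴴ := by simp
  rw [this, conjTranspose_apply, shift_mul_apply]
  split_ifs <;> simp

/-- The Sylvester operator of `Λ = z + shift` is injective when `z` is not real. -/
theorem sylvester_injective {z : ℂ} (hz : z.im ≠ 0) {Y : Matrix (Fin n) (Fin n) R}
    (hY : specMat R n z * Y - Y * (specMat R n z)ᴴ = 0) : Y = 0 := by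
  rw [conjTranspose_specMat, specMat, add_mul, mul_add] at hY
  have hz' : z - conj z ≠ 0 := by
    rw [sub_conj]; simpa using hz
  -- Induction on `i + j`: each shift lowers one index, so by induction only `(z - z̄) Y i j`
  -- survives in the `(i, j)` entry.
  have key : ∀ N : ℕ, ∀ i j : Fin n, (i : ℕ) + j = N → Y i j = 0 := by
    intro N
    induction N using Nat.strong_induction_on with
    | _ N ih =>
      intro i j hij
      have h := congrFun (congrFun hY i) j
      simp only [Matrix.sub_apply, Matrix.add_apply, smul_mul_assoc, one_mul, mul_smul_comm, mul_one, Matrix.smul_apply,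
        Matrix.zero_apply, shift_mul_apply, mul_conjTranspose_shift_apply, smul_eq_mul] at h
      have h1 : (if h : 0 < (i : ℕ) then Y ⟨i - 1, by omega⟩ j else 0) = 0 := by
        split_ifs with h'
        · exact ih (i - 1 + j) (by omega) _ _ (by simp)
        · rfl
      have h2 : (if h : 0 < (j : ℕ) then Y i ⟨j - 1, by omega⟩ else 0) = 0 := by
        split_ifs with h'
        · exact ih (i + (j - 1)) (by omega) _ _ (by simp)
        · rfl
      rw [h1, h2] at h
      have h3 : algebraMap ℂ R (z - conj z) * Y i j = 0 := by
        rw [map_sub]; linear_combination h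
      have h4 : algebraMap ℂ R (z - conj z)⁻¹ * algebraMap ℂ R (z - conj z) = 1 := by
        rw [← map_mul, inv_mul_cancel₀ hz', map_one]
      rw [← one_mul (Y i j), ← h4, mul_assoc, h3, mul_zero]
  ext i j
  exact key _ i j rfl

/-- The Lax pair and the Sylvester equation determine the derivatives of the Gram matrix. -/
theorem isDarboux_of_sylvester {Dx Dt : Derivation ℂ R R} {c : ℝ} (hc : c ≠ 0) {f g : Fin n → R}
    {N G : Matrix (Fin n) (Fin n) R}
    (star_Dx : ∀ r, Dx (star r) = star (Dx r)) (star_Dt : ∀ r, Dt (star r) = star (Dt r))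
    (mul_inv : N * G = 1) (inv_mul : G * N = 1) (herm : Gᴴ = G)
    (sylvester : specMat R n (I * c) * N - N * (specMat R n (I * c))ᴴ =
      (algebraMap ℂ R (I * c)) • (vecMulVec f (star f) + vecMulVec g (star g)))
    (Dx_f : (fun i => Dx (f i)) =
      -algebraMap ℂ R I • (specMat R n (I * c) *ᵥ f) + algebraMap ℂ R c • g)
    (Dx_g : (fun i => Dx (g i)) =
      algebraMap ℂ R I • (specMat R n (I * c) *ᵥ g) + -algebraMap ℂ R c • f)
    (Dt_f : (fun i => Dt (f i)) = (2 : R) • (specMat R n (I * c) *ᵥ fun i => Dx (f i)))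
    (Dt_g : (fun i => Dt (g i)) = (2 : R) • (specMat R n (I * c) *ᵥ fun i => Dx (g i))) :
    IsDarboux Dx Dt c f g (specMat R n (I * c)) N G := by
  have hz : (I * (c : ℂ)).im ≠ 0 := by simpa using hc
  have hΛ : ∀ D : Derivation ℂ R R, (specMat R n (I * c)).map D = 0 :=
    fun D => specMat_map_derivation D _
  have hΛ' : ∀ D : Derivation ℂ R R, (∀ r, D (star r) = star (D r)) →
      (specMat R n (I * c))ᴴ.map D = 0 := by
    intro D hD
    ext i j
    have := congrFun (congrFun (hΛ D) j) i
    simp only [map_apply, Matrix.zero_apply] at this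
    simp [conjTranspose_apply, hD, this]
  have hv : ∀ D : Derivation ℂ R R, (∀ r, D (star r) = star (D r)) → ∀ a : Fin n → R,
      (vecMulVec a (star a)).map D =
        vecMulVec (fun i => D (a i)) (star a) + vecMulVec a (star fun i => D (a i)) := by
    intro D hD a
    ext i j
    simp only [map_apply, vecMulVec_apply, Pi.star_apply, Derivation.leibniz, hD, smul_eq_mul,
      Matrix.add_apply]
    ring
  -- The differentiated Sylvester equation: `Λ` is constant, so `D N` solves a Sylvester equation
  -- with the same operator.
  have hS : ∀ D : Derivation ℂ R R, (∀ r, D (star r) = star (D r)) →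
      specMat R n (I * c) * N.map D - N.map D * (specMat R n (I * c))ᴴ =
      (algebraMap ℂ R (I * c)) •
        (vecMulVec (fun i => D (f i)) (star f) + vecMulVec f (star fun i => D (f i))
        + (vecMulVec (fun i => D (g i)) (star g) + vecMulVec g (star fun i => D (g i)))) := by
    intro D hD
    have h := congrArg (fun M : Matrix (Fin n) (Fin n) R => M.map D) sylvester
    rw [← hv D hD, ← hv D hD]
    have e1 : ∀ A B : Matrix (Fin n) (Fin n) R, (A - B).map D = A.map D - B.map D := by
      intro A B; ext; simp
    have e2 : ∀ A B : Matrix (Fin n) (Fin n) R, (A + B).map D = A.map D + B.map D := by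
      intro A B; ext; simp
    have e3 : ∀ (z : ℂ) (A : Matrix (Fin n) (Fin n) R),
        (algebraMap ℂ R z • A).map D = algebraMap ℂ R z • A.map D := by
      intro z A; ext; simp; exact Algebra.smul_def _ _
    rw [e1, derivation_matrix_mul, derivation_matrix_mul, hΛ, hΛ' D hD, zero_mul, mul_zero,
      zero_add, add_zero, e3, e2] at h
    exact h
  have hvl : ∀ a b : Fin n → R, specMat R n (I * c) * vecMulVec a b
      = vecMulVec (specMat R n (I * c) *ᵥ a) b := fun a b => by rw [mul_vecMulVec]
  have hvr : ∀ a b : Fin n → R, vecMulVec a (star b) * (specMat R n (I * c))ᴴ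
      = vecMulVec a (star (specMat R n (I * c) *ᵥ b)) := fun a b => by
    rw [vecMulVec_mul, star_mulVec]
  have hI := IsDarboux.I_sq' (R := R)
  constructor <;> try assumption
  · exact hΛ _
  · exact hΛ _
  -- The claimed derivative satisfies the same Sylvester equation as `Dx N`, and the operator is
  -- injective. The `t`-derivative is handled in the same way.
  · rw [← sub_eq_zero]
    refine sylvester_injective hz ?_
    rw [mul_sub, sub_mul, sub_sub_sub_comm, hS Dx star_Dx, Dx_f, Dx_g]
    simp only [mul_smul_comm, smul_mul_assoc, mul_sub, sub_mul, hvl, hvr]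
    ext i j
    simp only [Matrix.sub_apply, Matrix.add_apply, Matrix.smul_apply, vecMulVec_apply, Pi.add_apply, Pi.smul_apply,
      Pi.star_apply, star_add, star_smul, smul_eq_mul, IsDarboux.star_I,
      IsDarboux.star_ofReal, star_neg, Matrix.zero_apply, map_mul]
    linear_combination (-algebraMap ℂ R c * ((specMat R n (I * c) *ᵥ f) i * star (f j)
      - f i * star ((specMat R n (I * c) *ᵥ f) j) - (specMat R n (I * c) *ᵥ g) i * star (g j)
      + g i * star ((specMat R n (I * c) *ᵥ g) j))) * hI
  · rw [← sub_eq_zero]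
    refine sylvester_injective hz ?_
    rw [mul_sub, sub_mul, sub_sub_sub_comm, hS Dt star_Dt, Dt_f, Dt_g, Dx_f, Dx_g]
    simp only [mul_smul_comm, smul_mul_assoc, mul_sub, sub_mul, mul_add, add_mul, hvl, hvr,
      mulVec_add, mulVec_smul]
    ext i j
    simp only [Matrix.sub_apply, Matrix.add_apply, Matrix.smul_apply, vecMulVec_apply, Pi.add_apply, Pi.smul_apply,
      Pi.star_apply, star_add, star_smul, smul_eq_mul, IsDarboux.star_I,
      IsDarboux.star_ofReal, star_neg, Matrix.zero_apply, map_mul, star_ofNat]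
    generalize algebraMap ℂ R I = ι at *
    ring_nf
    simp only [hI]
    ring

end Gram

end

end Manakov

namespace Manakov

noncomputable section

/-! ### The explicit Gram matrix and its positivity. -/

section Gram

open Matrix
open PowerSeries (coeff X C)

section Basis

variable {R : Type*} [CommRing R] [Algebra ℂ R]

/-- `(2 i c + s)⁻¹` as a power series in `s`. -/
def denInv (R : Type*) [CommRing R] [Algebra ℂ R] (c : ℝ) : PowerSeries R :=
  PowerSeries.map (algebraMap ℂ R) (PowerSeries.C (2 * I * c) + X)⁻¹

theorem den_mul_denInv {c : ℝ} (hc : c ≠ 0) : (cst R (2 * I * c) + X) * denInv R c = 1 := by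
  have h : (cst R (2 * I * c) + X) = PowerSeries.map (algebraMap ℂ R) (PowerSeries.C (2 * I * c) + X) := by
    simp [cst]
  rw [h, denInv, ← map_mul, PowerSeries.mul_inv_cancel, map_one]
  simpa using hc

theorem constantCoeff_denInv (c : ℝ) : coeff 0 (denInv R c) = algebraMap ℂ R (2 * I * c)⁻¹ := by
  rw [denInv, PowerSeries.coeff_map, PowerSeries.coeff_zero_eq_constantCoeff,
    PowerSeries.constantCoeff_inv]
  simp

/-- Power series whose Gram matrix is the Gram matrix of the eigenfunction. -/
def basisSeries (c : ℝ) (z τ : R) : ℕ → PowerSeries R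
  | 0 => sinhSeries c z τ - cst R I * denInv R c * coshSeries c z τ
  | 1 => cst R I * denInv R c * (coshSeries c z τ + cst R I * X * sinhSeries c z τ)
  | p + 2 => X * denInv R c * basisSeries c z τ p

/-- Together with the next two lemmas this gives the recursion for `e_p` its starting values: `e₀`
and `e₁` carry `f - g` and `f + g`, whose Gram matrices add up to twice that of `f` and `g`. -/
theorem den_mul_basisSeries_zero {c : ℝ} (hc : c ≠ 0) (z τ : R) :
    (cst R (2 * I * c) + X) * basisSeries c z τ 0 =
      cst R (I * c) * (fSeries c z τ - gSeries c z τ) := by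
  have h := cst_inv_mul (R := R) (z := (c : ℂ)) (by exact_mod_cast hc)
  have hI := cst_I_sq (R := R)
  have hd := den_mul_denInv (R := R) hc
  rw [basisSeries, fSeries, gSeries]
  rw [cst_mul, cst_mul, cst_two] at hd ⊢
  rw [cst_mul]
  linear_combination (-cst R I * coshSeries c z τ) * hd
    + (cst R I * (coshSeries c z τ + cst R I * (cst R I * cst R c + X) * sinhSeries c z τ)) * h
    + (cst R I * cst R c + X) * sinhSeries c z τ * hI

theorem den_mul_basisSeries_one {c : ℝ} (hc : c ≠ 0) (z τ : R) :
    (cst R (2 * I * c) + X) * basisSeries c z τ 1 =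
      cst R (I * c) * (fSeries c z τ + gSeries c z τ) := by
  have h := cst_inv_mul (R := R) (z := (c : ℂ)) (by exact_mod_cast hc)
  have hI := cst_I_sq (R := R)
  have hd := den_mul_denInv (R := R) hc
  rw [basisSeries, fSeries, gSeries]
  rw [cst_mul, cst_mul, cst_two] at hd ⊢
  rw [cst_mul]
  linear_combination (cst R I * (coshSeries c z τ + cst R I * X * sinhSeries c z τ)) * hd
    - (cst R I * (coshSeries c z τ + cst R I * (cst R I * cst R c + X) * sinhSeries c z τ)) * h
    - (cst R I * cst R c) * sinhSeries c z τ * hI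

theorem den_mul_basisSeries_add_two {c : ℝ} (hc : c ≠ 0) (z τ : R) (p : ℕ) :
    (cst R (2 * I * c) + X) * basisSeries c z τ (p + 2) = X * basisSeries c z τ p := by
  rw [basisSeries]
  linear_combination (X * basisSeries c z τ p) * den_mul_denInv (R := R) hc

theorem basisSeries_two_mul_add (c : ℝ) (z τ : R) (j i : ℕ) :
    basisSeries c z τ (2 * j + i) = (X * denInv R c) ^ j * basisSeries c z τ i := by
  induction j with
  | zero => simp
  | succ j ih =>
    rw [show 2 * (j + 1) + i = 2 * j + i + 2 by ring, basisSeries, ih, pow_succ]; ring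

theorem X_pow_dvd_basisSeries (c : ℝ) (z τ : R) {j p : ℕ} (h : 2 * j ≤ p) :
    X ^ j ∣ basisSeries c z τ p := by
  obtain ⟨i, rfl⟩ := Nat.exists_eq_add_of_le h
  rw [basisSeries_two_mul_add, mul_pow, mul_assoc]
  exact dvd_mul_right _ _

theorem coeff_zero_coshSeries (c : ℝ) (z τ : R) : coeff 0 (coshSeries c z τ) = 1 := by
  simp [coshSeries, lsum, cst]

theorem coeff_zero_sinhSeries (c : ℝ) (z τ : R) : coeff 0 (sinhSeries c z τ) = z := by
  simp [sinhSeries, lsum, cst, phase]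

/-- This is the lowest coefficient that can be nonzero in `e_(2j+1)`, and it is independent of `x`
and `t`. The odd-indexed series are therefore triangular uniformly on the plane, which is what makes
the Gram matrix nondegenerate everywhere. -/
theorem coeff_basisSeries_odd {c : ℝ} (hc : c ≠ 0) (z τ : R) (j : ℕ) :
    coeff j (basisSeries c z τ (2 * j + 1)) = algebraMap ℂ R ((2 * I * c)⁻¹ ^ j * (2 * (c : ℂ))⁻¹) := by
  rw [basisSeries_two_mul_add, mul_pow, mul_assoc, PowerSeries.coeff_X_pow_mul', if_pos le_rfl,
    Nat.sub_self, basisSeries]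
  simp only [map_pow, PowerSeries.coeff_zero_eq_constantCoeff, map_mul, map_add]
  simp only [← PowerSeries.coeff_zero_eq_constantCoeff_apply, constantCoeff_denInv,
    coeff_zero_coshSeries, PowerSeries.coeff_zero_X, cst, PowerSeries.coeff_zero_C, mul_zero,
    zero_mul, add_zero, mul_one, ← map_mul, ← map_pow]
  congr 2
  have : (c : ℂ) ≠ 0 := by exact_mod_cast hc
  field_simp

end Basis

variable {R : Type*} [CommRing R] [Algebra ℂ R] [StarRing R]

/-- The Gram matrix of the eigenfunction. -/
def gramMat (n : ℕ) (c : ℝ) (z τ : R) : Matrix (Fin n) (Fin n) R :=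
  ∑ p ∈ Finset.range (2 * n), vecMulVec (trunc n (basisSeries c z τ p))
    (star (trunc n (basisSeries c z τ p)))

theorem conjTranspose_gramMat (n : ℕ) (c : ℝ) (z τ : R) :
    (gramMat n c z τ)ᴴ = gramMat n c z τ := by
  rw [gramMat, conjTranspose_sum]
  refine Finset.sum_congr rfl fun p _ => ?_
  rw [conjTranspose_vecMulVec, star_star]

variable [StarModule ℂ R]

/-- With `Z` the shift and `B = 2ic + Z`, the difference `B N B† - Z N Z†` equals `-2ic` times the
Sylvester expression. The recursion `B e_(p+2) = Z e_p` makes the same difference telescope to the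
contributions of `e₀` and `e₁`. -/
theorem sylvester_gramMat (n : ℕ) {c : ℝ} (hc : c ≠ 0) (z τ : R) :
    specMat R n (I * c) * gramMat n c z τ - gramMat n c z τ * (specMat R n (I * c))ᴴ =
      (algebraMap ℂ R (I * c)) •
        (vecMulVec (trunc n (fSeries c z τ)) (star (trunc n (fSeries c z τ)))
        + vecMulVec (trunc n (gSeries c z τ)) (star (trunc n (gSeries c z τ)))) := by
  set N := gramMat n c z τ with hN
  set B := specMat R n (2 * I * c) with hB
  set Z := shift R n with hZ
  set e : ℕ → Fin n → R := fun p => trunc n (basisSeries c z τ p) with he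
  have hBv : ∀ a : Fin n → R, B * vecMulVec a (star a) * Bᴴ = vecMulVec (B *ᵥ a) (star (B *ᵥ a)) :=
    fun a => by rw [mul_vecMulVec, vecMulVec_mul, star_mulVec]
  have hZv : ∀ a : Fin n → R, Z * vecMulVec a (star a) * Zᴴ = vecMulVec (Z *ᵥ a) (star (Z *ᵥ a)) :=
    fun a => by rw [mul_vecMulVec, vecMulVec_mul, star_mulVec]
  have hBe : ∀ p, B *ᵥ e (p + 2) = Z *ᵥ e p := fun p => by
    rw [specMat_mulVec_trunc, shift_mulVec_trunc, den_mul_basisSeries_add_two hc]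
  -- The sum over `p < 2n` is in fact the full sum, so telescoping leaves no upper boundary term.
  have hzero : ∀ p, 2 * n ≤ p → e p = 0 := fun p hp =>
    trunc_eq_zero_iff.2 (X_pow_dvd_basisSeries c z τ hp)
  have h1 : B * N * Bᴴ - Z * N * Zᴴ =
      vecMulVec (B *ᵥ e 0) (star (B *ᵥ e 0)) + vecMulVec (B *ᵥ e 1) (star (B *ᵥ e 1)) := by
    have hs : ∀ F : ℕ → Matrix (Fin n) (Fin n) R, F (2 * n) = 0 → F (2 * n + 1) = 0 →
        ∑ p ∈ Finset.range (2 * n), F p - ∑ p ∈ Finset.range (2 * n), F (p + 2) = F 0 + F 1 := by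
      intro F h0 h1
      have e1 := Finset.sum_range_succ F (2 * n)
      have e2 := Finset.sum_range_succ F (2 * n + 1)
      have e3 := Finset.sum_range_succ' F (2 * n + 1)
      have e4 := Finset.sum_range_succ' (fun p => F (p + 1)) (2 * n)
      rw [h0] at e1
      rw [h1] at e2
      rw [e3, e4] at e2
      rw [e1] at e2
      simp only [add_zero, zero_add, add_assoc, Nat.reduceAdd] at e2
      rw [← e2]; abel
    rw [← hs (fun p => vecMulVec (B *ᵥ e p) (star (B *ᵥ e p)))]
    · rw [hN, gramMat, Matrix.mul_sum, Matrix.sum_mul, Matrix.mul_sum,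
        Matrix.sum_mul]
      congr 1
      · exact Finset.sum_congr rfl fun p _ => hBv _
      · exact Finset.sum_congr rfl fun p _ => by rw [hBe]; exact hZv _
    · simp [hzero (2 * n) le_rfl]
    · simp [hzero (2 * n + 1) (Nat.le_succ _)]
  have h2 : B *ᵥ e 0 = algebraMap ℂ R (I * c) • (trunc n (fSeries c z τ) - trunc n (gSeries c z τ)) := by
    rw [specMat_mulVec_trunc, den_mul_basisSeries_zero hc, trunc_cst_mul, trunc_sub]
  have h3 : B *ᵥ e 1 = algebraMap ℂ R (I * c) • (trunc n (fSeries c z τ) + trunc n (gSeries c z τ)) := by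
    rw [specMat_mulVec_trunc, den_mul_basisSeries_one hc, trunc_cst_mul, trunc_add]
  rw [h2, h3] at h1
  have hI := IsDarboux.I_sq' (R := R)
  have h4 : B * N * Bᴴ - Z * N * Zᴴ = (-2 * algebraMap ℂ R (I * c)) •
      (specMat R n (I * c) * N - N * (specMat R n (I * c))ᴴ) := by
    rw [hB, conjTranspose_specMat, conjTranspose_specMat, specMat, specMat, ← hZ]
    simp only [add_mul, mul_add, smul_mul_assoc, mul_smul_comm, one_mul, mul_one]
    ext i j
    simp only [Matrix.sub_apply, Matrix.add_apply, Matrix.smul_apply, smul_eq_mul, map_mul, conj_I,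
      conj_ofReal, map_neg, map_ofNat]
    ring
  have hi : algebraMap ℂ R (-2 * (I * c))⁻¹ * (-2 * algebraMap ℂ R (I * c)) = 1 := by
    have h5 : (-2 * algebraMap ℂ R (I * c)) = algebraMap ℂ R (-2 * (I * c)) := by
      simp only [map_mul, map_neg, map_ofNat]
    rw [h5, ← map_mul, inv_mul_cancel₀, map_one]
    simpa using hc
  rw [h4] at h1
  have h6 := congrArg (fun M => algebraMap ℂ R (-2 * (I * c))⁻¹ • M) h1
  simp only [smul_smul, hi, one_smul] at h6
  rw [h6]
  ext i j
  simp only [Matrix.add_apply, Matrix.smul_apply, smul_eq_mul, vecMulVec_apply, Pi.smul_apply,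
    Pi.star_apply, Pi.add_apply, Pi.sub_apply, star_mul', star_add, star_sub, map_mul,
    IsDarboux.star_I, IsDarboux.star_ofReal] at hi ⊢
  generalize algebraMap ℂ R (-2 * (I * c))⁻¹ = y at *
  linear_combination (algebraMap ℂ R I * algebraMap ℂ R c *
    (trunc n (fSeries c z τ) i * star (trunc n (fSeries c z τ) j)
        + trunc n (gSeries c z τ) i * star (trunc n (gSeries c z τ) j))) * hi

open scoped ComplexOrder in
/-- The Gram matrix is positive definite. -/
theorem posDef_gramMat (n : ℕ) {c : ℝ} (hc : c ≠ 0) (z τ : ℂ) : (gramMat n c z τ).PosDef := by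
  rw [posDef_iff_dotProduct_mulVec]
  refine ⟨conjTranspose_gramMat n c z τ, fun x hx => ?_⟩
  have hform : star x ⬝ᵥ (gramMat n c z τ *ᵥ x) = ∑ p ∈ Finset.range (2 * n),
      (star x ⬝ᵥ trunc n (basisSeries c z τ p)) *
        star (star x ⬝ᵥ trunc n (basisSeries c z τ p)) := by
    rw [gramMat, sum_mulVec, dotProduct_sum]
    refine Finset.sum_congr rfl fun p _ => ?_
    rw [vecMulVec_mulVec, dotProduct_smul, star_dotProduct (trunc n _) x]
    rfl
  rw [hform]
  -- For the last nonzero entry `x k`, the term `p = 2k + 1` is nonzero: below `k` the series has no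
  -- coefficients and above `k` the vector has no entries.
  obtain ⟨k, hk, hmax⟩ := Finset.exists_max_image (Finset.univ.filter fun i => x i ≠ 0)
    (fun i => i) (by
      obtain ⟨i, hi⟩ := Function.ne_iff.1 hx
      exact ⟨i, by simpa using hi⟩)
  have hk' : x k ≠ 0 := by simpa using hk
  refine Finset.sum_pos' (fun p _ => mul_star_self_nonneg _)
    ⟨2 * k + 1, Finset.mem_range.2 (by omega), ?_⟩
  have hdot : star x ⬝ᵥ trunc n (basisSeries c z τ (2 * k + 1)) =
      star (x k) * ((2 * I * c)⁻¹ ^ (k : ℕ) * (2 * (c : ℂ))⁻¹) := by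
    rw [dotProduct, Finset.sum_eq_single k]
    · rw [trunc, coeff_basisSeries_odd hc]; rfl
    · intro i _ hik
      rcases lt_or_gt_of_ne hik with h | h
      · rw [trunc, PowerSeries.X_pow_dvd_iff.1
          (X_pow_dvd_basisSeries c z τ (j := k) (p := 2 * k + 1) (by omega)) i h, mul_zero]
      · have : x i = 0 := by
          by_contra h0
          exact absurd (hmax i (by simpa using h0)) (not_le.2 h)
        simp [this]
    · simp
  have hne : star x ⬝ᵥ trunc n (basisSeries c z τ (2 * k + 1)) ≠ 0 := by
    rw [hdot]
    have : (c : ℂ) ≠ 0 := by exact_mod_cast hc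
    simp [hk', hc]
  have := mul_star_self_nonneg (star x ⬝ᵥ trunc n (basisSeries c z τ (2 * k + 1)))
  refine lt_of_le_of_ne this (Ne.symm (mul_ne_zero hne (star_ne_zero.2 hne)))

end Gram

end

end Manakov

namespace Manakov

noncomputable section

open Matrix
open PowerSeries (coeff X C)

/-! ### The NLS equation and the bilinear equations of the Darboux transform. -/

namespace IsDarboux

variable {R : Type*} [CommRing R] [StarRing R] [Algebra ℂ R] [StarModule ℂ R] {n : ℕ}
  {Dx Dt : Derivation ℂ R R} {c : ℝ} {f g : Fin n → R} {Λ N G : Matrix (Fin n) (Fin n) R} {q : R}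

theorem star_wave (h : IsDarboux Dx Dt c f g Λ N G)
    (hq : q = algebraMap ℂ R c * (1 + 2 * gramForm G g f)) :
    star q = algebraMap ℂ R c * (1 + 2 * gramForm G f g) := by
  rw [hq, star_mul', star_add, star_one, star_mul', star_ofNat, star_gramForm G h.herm,
    star_ofReal]

theorem wave_mul_star (h : IsDarboux Dx Dt c f g Λ N G)
    (hq : q = algebraMap ℂ R c * (1 + 2 * gramForm G g f)) :
    q * star q - algebraMap ℂ R c ^ 2 = 2 * algebraMap ℂ R c * Dx (gramForm G f f) := by
  rw [h.star_wave hq, hq, h.Dx_gramForm_ff]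
  ring

theorem derivation_two {k R : Type*} [CommRing k] [CommRing R] [Algebra k R]
    (D : Derivation k R R) : D 2 = 0 := by exact_mod_cast D.map_natCast 2

theorem wave_nls (h : IsDarboux Dx Dt c f g Λ N G)
    (hq : q = algebraMap ℂ R c * (1 + 2 * gramForm G g f)) :
    algebraMap ℂ R I * Dt q + Dx (Dx q) + 2 * (q * star q - algebraMap ℂ R c ^ 2) * q = 0 := by
  rw [h.wave_mul_star hq, hq]
  simp only [Derivation.leibniz, map_add, Derivation.map_algebraMap, derivation_two, smul_eq_mul,
    Derivation.map_one_eq_zero, mul_zero, add_zero, zero_add]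
  linear_combination (2 * algebraMap ℂ R c) * h.nls

/-- Equivalent to `(log H)_xx = |q|² - c²`: the logarithmic derivative of `H` is `c(f†N⁻¹f -
g†N⁻¹g)`, and the two diagonal forms have opposite `x`-derivatives. -/
theorem det_log_deriv (h : IsDarboux Dx Dt c f g Λ N G)
    (hq : q = algebraMap ℂ R c * (1 + 2 * gramForm G g f)) :
    N.det * Dx (Dx N.det) - Dx N.det ^ 2 = N.det ^ 2 * (q * star q - algebraMap ℂ R c ^ 2) := by
  rw [h.wave_mul_star hq, h.Dx_det]
  simp only [Derivation.leibniz, map_sub, Derivation.map_algebraMap, smul_eq_mul, h.Dx_gramForm_gg,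
    h.Dx_gramForm_ff, h.Dx_det]
  ring

/-- The NLS equation for `q = P/H` multiplied by `H²`, with the cubic term eliminated by
`det_log_deriv`. It is linear in `P`, which suits the comparison of multiplicities. -/
theorem bilinear (h : IsDarboux Dx Dt c f g Λ N G)
    (hq : q = algebraMap ℂ R c * (1 + 2 * gramForm G g f)) {P H : R} (hH : H = N.det)
    (hP : P = q * H) :
    algebraMap ℂ R I * (Dt P * H - P * Dt H) + Dx (Dx P) * H - 2 * (Dx P * Dx H)
      + P * Dx (Dx H) = 0 := by
  have h1 := h.wave_nls hq
  have h2 := h.det_log_deriv hq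
  rw [← hH] at h2
  rw [hP]
  simp only [Derivation.leibniz, map_add, smul_eq_mul]
  linear_combination H ^ 2 * h1 + 2 * q * h2

end IsDarboux

theorem isDarboux_gramMat {R : Type*} [CommRing R] [StarRing R] [Algebra ℂ R] [StarModule ℂ R]
    {n : ℕ} {c : ℝ} (hc : c ≠ 0) {Dx Dt : Derivation ℂ R R}
    (hDx : ∀ r, Dx (star r) = star (Dx r)) (hDt : ∀ r, Dt (star r) = star (Dt r)) {z τ : R}
    (hx : coeffDerivation Dx (phase z τ) = 1)
    (ht : coeffDerivation Dt (phase z τ) = 2 * (cst R (I * c) + X))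
    (hu : IsUnit (gramMat n c z τ).det) :
    IsDarboux Dx Dt c (trunc n (fSeries c z τ)) (trunc n (gSeries c z τ))
      (specMat R n (I * c)) (gramMat n c z τ) (gramMat n c z τ)⁻¹ := by
  have h2 : ∀ F : PowerSeries R, trunc n (2 * F) = (2 : R) • trunc n F := by
    intro F
    rw [← cst_two, trunc_cst_mul, map_ofNat]
  refine isDarboux_of_sylvester hc hDx hDt (mul_nonsing_inv _ hu)
    (nonsing_inv_mul _ hu) ?_ (sylvester_gramMat n hc _ _) ?_ ?_ ?_ ?_
  · rw [conjTranspose_nonsing_inv, conjTranspose_gramMat]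
  · rw [trunc_derivation, coeffDerivation_fSeries _ hc, hx, one_mul, trunc_add, mul_assoc,
      ← cst_neg, trunc_cst_mul, trunc_cst_mul, specMat_mulVec_trunc, map_neg]
  · rw [trunc_derivation, coeffDerivation_gSeries _ hc, hx, one_mul, trunc_sub, mul_assoc,
      trunc_cst_mul, trunc_cst_mul, specMat_mulVec_trunc, sub_eq_add_neg]
    rw [neg_smul]
  · rw [trunc_derivation, trunc_derivation, coeffDerivation_fSeries _ hc,
      coeffDerivation_fSeries _ hc, hx, ht, one_mul, mul_assoc, h2, specMat_mulVec_trunc]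
  · rw [trunc_derivation, trunc_derivation, coeffDerivation_gSeries _ hc,
      coeffDerivation_gSeries _ hc, hx, ht, one_mul, mul_assoc, h2, specMat_mulVec_trunc]

/-! ## Functoriality -/

section Functoriality

variable {R S : Type*} [CommRing R] [Algebra ℂ R] [CommRing S] [Algebra ℂ S] (φ : R →ₐ[ℂ] S)

theorem map_uSq (c : ℝ) : PowerSeries.map (φ : R →+* S) (uSq R c) = uSq S c := by
  simp [uSq, map_cst]

theorem map_phase (z τ : R) :
    PowerSeries.map (φ : R →+* S) (phase z τ) = phase (φ z) (φ τ) := by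
  simp only [phase, map_add, map_mul, PowerSeries.map_C, PowerSeries.map_X, RingHom.coe_coe,
    map_ofNat]

theorem map_sinhSeries (c : ℝ) (z τ : R) :
    PowerSeries.map (φ : R →+* S) (sinhSeries c z τ) = sinhSeries c (φ z) (φ τ) := by
  simp only [sinhSeries, map_lsum, map_mul, map_pow, map_cst, map_uSq, map_phase]

theorem map_coshSeries (c : ℝ) (z τ : R) :
    PowerSeries.map (φ : R →+* S) (coshSeries c z τ) = coshSeries c (φ z) (φ τ) := by
  simp only [coshSeries, map_lsum, map_mul, map_pow, map_cst, map_uSq, map_phase]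

theorem map_gSeries (c : ℝ) (z τ : R) :
    PowerSeries.map (φ : R →+* S) (gSeries c z τ) = gSeries c (φ z) (φ τ) := by
  simp only [gSeries, map_mul, map_add, map_cst, map_sinhSeries, map_coshSeries, PowerSeries.map_X]

theorem map_denInv (c : ℝ) : PowerSeries.map (φ : R →+* S) (denInv R c) = denInv S c := by
  rw [denInv, denInv, ← RingHom.comp_apply, ← PowerSeries.map_comp, AlgHom.comp_algebraMap]

theorem map_basisSeries (c : ℝ) (z τ : R) (p : ℕ) :
    PowerSeries.map (φ : R →+* S) (basisSeries c z τ p) = basisSeries c (φ z) (φ τ) p := by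
  induction p using Nat.twoStepInduction with
  | zero => simp only [basisSeries, map_sub, map_mul, map_cst, map_denInv, map_sinhSeries,
      map_coshSeries]
  | one => simp only [basisSeries, map_add, map_mul, map_cst, map_denInv, map_sinhSeries,
      map_coshSeries, PowerSeries.map_X]
  | more p ih _ => simp only [basisSeries, map_mul, map_denInv, PowerSeries.map_X, ih]

theorem comp_trunc {n : ℕ} (F : PowerSeries R) :
    (fun i => φ (trunc n F i)) = trunc n (PowerSeries.map (φ : R →+* S) F) := by
  ext; simp [trunc]

theorem map_gramMat [StarRing R] [StarRing S] (hφ : ∀ r, φ (star r) = star (φ r)) (n : ℕ) (c : ℝ)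
    (z τ : R) : (gramMat n c z τ).map φ = gramMat n c (φ z) (φ τ) := by
  ext i j
  simp only [gramMat, map_apply, Matrix.sum_apply, vecMulVec_apply, map_sum, map_mul, Pi.star_apply, hφ]
  refine Finset.sum_congr rfl fun p _ => ?_
  have h : ∀ k, φ (trunc n (basisSeries c z τ p) k) = trunc n (basisSeries c (φ z) (φ τ) p) k := by
    intro k
    rw [← map_basisSeries, ← comp_trunc]
  rw [h, h]

end Functoriality

/-! ## Smooth functions on the plane -/

/-- The star algebra of smooth complex functions on the `(x, t)`-plane. -/
def smoothFun : StarSubalgebra ℂ (ℝ × ℝ → ℂ) where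
  carrier := {f | ContDiff ℝ ∞ f}
  mul_mem' hf hg := by
    rw [Set.mem_ofPred_eq] at *
    exact hf.mul hg
  add_mem' hf hg := by
    rw [Set.mem_ofPred_eq] at *
    exact hf.add hg
  algebraMap_mem' r := by
    rw [Set.mem_ofPred_eq]
    exact contDiff_const (c := r)
  star_mem' {f} hf := by
    rw [Set.mem_ofPred_eq] at *
    exact (conjCLE : ℂ →L[ℝ] ℂ).contDiff.comp hf

theorem smoothFun.contDiff (f : smoothFun) : ContDiff ℝ ∞ (f : ℝ × ℝ → ℂ) := f.2

theorem smoothFun.differentiable (f : smoothFun) : Differentiable ℝ (f : ℝ × ℝ → ℂ) :=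
  (smoothFun.contDiff f).differentiable (by simp)

/-- The derivative in direction `v`. -/
def dirDeriv (v : ℝ × ℝ) : Derivation ℂ smoothFun smoothFun :=
  Derivation.mk'
    { toFun := fun f => ⟨fun p => fderiv ℝ (f : ℝ × ℝ → ℂ) p v,
        ((smoothFun.contDiff f).fderiv_right (m := ∞) (by simp)).clm_apply contDiff_const⟩
      map_add' := fun f g => by
        ext p
        simp only [AddMemClass.coe_add, Pi.add_apply]
        rw [fderiv_add (smoothFun.differentiable f p) (smoothFun.differentiable g p)]
        rfl
      map_smul' := fun r f => by
        ext p
        have := fderiv_const_smul (𝕜 := ℝ) (smoothFun.differentiable f p) r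
        exact congrArg (fun L => L v) this }
    fun f g => by
      ext p
      have := fderiv_mul (𝕜 := ℝ) (smoothFun.differentiable f p) (smoothFun.differentiable g p)
      exact congrArg (fun L => L v) this

theorem dirDeriv_apply (v : ℝ × ℝ) (f : smoothFun) (p : ℝ × ℝ) :
    (dirDeriv v f : ℝ × ℝ → ℂ) p = fderiv ℝ (f : ℝ × ℝ → ℂ) p v := rfl

theorem dirDeriv_star (v : ℝ × ℝ) (f : smoothFun) : dirDeriv v (star f) = star (dirDeriv v f) := by
  ext p
  have h := ((conjCLE : ℂ →L[ℝ] ℂ).hasFDerivAt.comp p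
    (smoothFun.differentiable f p).hasFDerivAt).fderiv
  exact congrArg (fun L => L v) h

/-- Evaluation at a point. -/
def evalAt (p : ℝ × ℝ) : smoothFun →ₐ[ℂ] ℂ :=
  (Pi.evalAlgHom ℂ (fun _ : ℝ × ℝ => ℂ) p).comp smoothFun.subtype.toAlgHom

theorem evalAt_apply (p : ℝ × ℝ) (f : smoothFun) : evalAt p f = (f : ℝ × ℝ → ℂ) p := rfl

theorem evalAt_star (p : ℝ × ℝ) (f : smoothFun) : evalAt p (star f) = star (evalAt p f) := rfl

theorem smoothFun.isUnit {f : smoothFun} (hf : ∀ p, (f : ℝ × ℝ → ℂ) p ≠ 0) : IsUnit f :=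
  IsUnit.of_mul_eq_one ⟨fun p => ((f : ℝ × ℝ → ℂ) p)⁻¹, (smoothFun.contDiff f).inv hf⟩ (by
    ext p
    exact mul_inv_cancel₀ (hf p))

/-- The complex coordinate `x - 2 a t + 2 i c t`. -/
def zFun (a c : ℝ) : smoothFun :=
  ⟨fun p => p.1 - 2 * a * p.2 + 2 * I * c * p.2, by
    have h1 : ContDiff ℝ ∞ fun p : ℝ × ℝ => (p.1 : ℂ) := ofRealCLM.contDiff.comp contDiff_fst
    have h2 : ContDiff ℝ ∞ fun p : ℝ × ℝ => (p.2 : ℂ) := ofRealCLM.contDiff.comp contDiff_snd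
    exact (h1.sub (contDiff_const.mul h2)).add (contDiff_const.mul h2)⟩

/-- The coordinate `t`. -/
def tFun : smoothFun :=
  ⟨fun p => (p.2 : ℂ), by
    have h : ContDiff ℝ ∞ fun p : ℝ × ℝ => (p.2 : ℂ) := ofRealCLM.contDiff.comp contDiff_snd
    exact h⟩

theorem dirDeriv_tFun (v : ℝ × ℝ) : dirDeriv v tFun = algebraMap ℂ smoothFun v.2 := by
  ext p
  have h : HasFDerivAt (fun p : ℝ × ℝ => (p.2 : ℂ)) (ofRealCLM.comp (ContinuousLinearMap.snd ℝ ℝ ℝ)) p :=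
    (ofRealCLM.comp (ContinuousLinearMap.snd ℝ ℝ ℝ)).hasFDerivAt
  exact congrArg (fun L => L v) h.fderiv

theorem dirDeriv_zFun (a c : ℝ) (v : ℝ × ℝ) :
    dirDeriv v (zFun a c) = algebraMap ℂ smoothFun (v.1 - 2 * a * v.2 + 2 * I * c * v.2) := by
  ext p
  have h1 : HasFDerivAt (fun p : ℝ × ℝ => (p.1 : ℂ)) (ofRealCLM.comp (ContinuousLinearMap.fst ℝ ℝ ℝ)) p :=
    (ofRealCLM.comp (ContinuousLinearMap.fst ℝ ℝ ℝ)).hasFDerivAt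
  have h2 : HasFDerivAt (fun p : ℝ × ℝ => (p.2 : ℂ)) (ofRealCLM.comp (ContinuousLinearMap.snd ℝ ℝ ℝ)) p :=
    (ofRealCLM.comp (ContinuousLinearMap.snd ℝ ℝ ℝ)).hasFDerivAt
  have h := (h1.sub (h2.const_mul (2 * (a : ℂ)))).add (h2.const_mul (2 * I * c))
  exact congrArg (fun L => L v) h.fderiv

open scoped ComplexOrder in
theorem det_gramMat_ne_zero (n : ℕ) {c : ℝ} (hc : c ≠ 0) (z τ : ℂ) :
    (gramMat n c z τ).det ≠ 0 :=
  ((isUnit_iff_isUnit_det _).1 (posDef_gramMat n hc z τ).isUnit).ne_zero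

/-- The numerical wave: `c (1 + 2 g† N⁻¹ f)`. -/
def wave (n : ℕ) (c : ℝ) (z τ : ℂ) : ℂ :=
  c * (1 + 2 * gramForm (gramMat n c z τ)⁻¹ (trunc n (gSeries c z τ)) (trunc n (fSeries c z τ)))

section smooth

variable (n : ℕ) (a : ℝ) {c : ℝ} (hc : c ≠ 0)
include hc

/-- A smooth function without zeros is invertible, and the determinant is nonzero at each point by
positive definiteness. -/
theorem isUnit_gramMat_det : IsUnit (gramMat n c (zFun a c) tFun).det := by
  refine smoothFun.isUnit fun p => ?_
  rw [← evalAt_apply, AlgHom.map_det, AlgHom.mapMatrix_apply, map_gramMat _ (evalAt_star p)]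
  exact det_gramMat_ne_zero n hc _ _

/-- The time derivation is `∂ₜ + 2a∂ₓ`, the derivative in the frame moving with the carrier; it
annihilates `x - 2at`, so that the phase has derivative `2(ic + s)`. -/
theorem isDarboux_smoothFun :
    IsDarboux (dirDeriv (1, 0)) (dirDeriv (2 * a, 1)) c
      (trunc n (fSeries c (zFun a c) tFun)) (trunc n (gSeries c (zFun a c) tFun))
      (specMat smoothFun n (I * c)) (gramMat n c (zFun a c) tFun)
      (gramMat n c (zFun a c) tFun)⁻¹ := by
  have hu := isUnit_gramMat_det n a hc
  have hx : coeffDerivation (dirDeriv (1, 0)) (phase (zFun a c) tFun) = 1 := by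
    rw [phase, map_add, Derivation.leibniz, coeffDerivation_X, coeffDerivation_C,
      coeffDerivation_C, Derivation.leibniz, IsDarboux.derivation_two, dirDeriv_zFun, dirDeriv_tFun]
    simp
  have ht : coeffDerivation (dirDeriv (2 * a, 1)) (phase (zFun a c) tFun) =
      2 * (cst smoothFun (I * c) + X) := by
    rw [phase, map_add, Derivation.leibniz, coeffDerivation_X, coeffDerivation_C,
      coeffDerivation_C, Derivation.leibniz, IsDarboux.derivation_two, dirDeriv_zFun, dirDeriv_tFun,
      ← cst_two]
    simp only [add_zero, smul_eq_mul, mul_zero, mul_one, map_mul, cst,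
      map_one, ofReal_mul, ofReal_ofNat, ofReal_one, sub_self, zero_add,
      map_ofNat]
    ring
  exact isDarboux_gramMat hc (dirDeriv_star _) (dirDeriv_star _) hx ht hu

end smooth

/-- The wave as a smooth function. -/
def waveFun (n : ℕ) (a c : ℝ) : smoothFun :=
  algebraMap ℂ smoothFun c * (1 + 2 * gramForm (gramMat n c (zFun a c) tFun)⁻¹
    (trunc n (gSeries c (zFun a c) tFun)) (trunc n (fSeries c (zFun a c) tFun)))

/-- Evaluation at a point is a star homomorphism of algebras, so all constructions over smooth
functions specialise to their numerical versions. -/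
theorem waveFun_apply (n : ℕ) (a : ℝ) {c : ℝ} (hc : c ≠ 0) (p : ℝ × ℝ) :
    (waveFun n a c : ℝ × ℝ → ℂ) p =
      wave n c (p.1 - 2 * a * p.2 + 2 * I * c * p.2) p.2 := by
  have hu := isUnit_gramMat_det n a hc
  have hN : (gramMat n c (zFun a c) tFun)⁻¹.map (evalAt p) =
      (gramMat n c (evalAt p (zFun a c)) (evalAt p tFun))⁻¹ := by
    refine (inv_eq_left_inv ?_).symm
    rw [← map_gramMat _ (evalAt_star p), ← Matrix.map_mul, nonsing_inv_mul _ hu]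
    simp
  have hv : ∀ F : PowerSeries smoothFun, ∀ i, evalAt p (trunc n F i) =
      trunc n (PowerSeries.map (evalAt p : smoothFun →+* ℂ) F) i :=
    fun F i => congrFun (comp_trunc (evalAt p) F) i
  rw [← evalAt_apply, waveFun, wave, map_mul, map_add, map_mul, map_one, map_ofNat,
    AlgHom.commutes]
  congr 3
  rw [gramForm, gramForm, dotProduct, dotProduct, map_sum]
  refine Finset.sum_congr rfl fun i _ => ?_
  rw [map_mul, Pi.star_apply, evalAt_star, hv, map_gSeries, mulVec, mulVec, dotProduct, dotProduct,
    map_sum]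
  congr 1
  refine Finset.sum_congr rfl fun j _ => ?_
  have hij : evalAt p ((gramMat n c (zFun a c) tFun)⁻¹ i j) = _ := congrFun (congrFun hN i) j
  rw [map_mul, hv, map_sinhSeries, hij]
  rfl

end

end Manakov

/-! ### From the scalar wave to the Manakov system and the NLS equation. -/

namespace Manakov

noncomputable section

theorem dirDeriv_smul_add (r s : ℝ) (v w : ℝ × ℝ) (f : smoothFun) :
    dirDeriv (r • v + s • w) f =
      algebraMap ℂ smoothFun r * dirDeriv v f + algebraMap ℂ smoothFun s * dirDeriv w f := by
  ext p
  rw [dirDeriv_apply, map_add, map_smul, map_smul]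
  rfl

theorem hasDerivAt_fst (f : smoothFun) (x t : ℝ) :
    HasDerivAt (fun y => (f : ℝ × ℝ → ℂ) (y, t)) ((dirDeriv (1, 0) f : ℝ × ℝ → ℂ) (x, t)) x := by
  have h := (smoothFun.differentiable f (x, t)).hasFDerivAt
  exact h.comp_hasDerivAt x ((hasDerivAt_id x).prodMk (hasDerivAt_const x t))

theorem hasDerivAt_snd (f : smoothFun) (x t : ℝ) :
    HasDerivAt (fun s => (f : ℝ × ℝ → ℂ) (x, s)) ((dirDeriv (0, 1) f : ℝ × ℝ → ℂ) (x, t)) t := by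
  have h := (smoothFun.differentiable f (x, t)).hasFDerivAt
  exact h.comp_hasDerivAt t ((hasDerivAt_const t x).prodMk (hasDerivAt_id t))

theorem iteratedDeriv_two_fst (f : smoothFun) (x t : ℝ) :
    iteratedDeriv 2 (fun y => (f : ℝ × ℝ → ℂ) (y, t)) x =
      (dirDeriv (1, 0) (dirDeriv (1, 0) f) : ℝ × ℝ → ℂ) (x, t) := by
  rw [iteratedDeriv_succ, iteratedDeriv_one]
  have : deriv (fun y => (f : ℝ × ℝ → ℂ) (y, t)) =
      fun y => (dirDeriv (1, 0) f : ℝ × ℝ → ℂ) (y, t) :=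
    funext fun y => (hasDerivAt_fst f y t).deriv
  rw [this]
  exact (hasDerivAt_fst _ x t).deriv

/-- The carrier as a smooth function. -/
def carrierFun (a b : ℝ) : smoothFun :=
  ⟨fun p => carrier a b p.1 p.2, by
    have h1 : ContDiff ℝ ∞ fun p : ℝ × ℝ => (p.1 : ℂ) := ofRealCLM.contDiff.comp contDiff_fst
    have h2 : ContDiff ℝ ∞ fun p : ℝ × ℝ => (p.2 : ℂ) := ofRealCLM.contDiff.comp contDiff_snd
    exact (contDiff_const.mul ((contDiff_const.mul h1).add (contDiff_const.mul h2))).cexp⟩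

theorem dirDeriv_carrierFun (a b : ℝ) (v : ℝ × ℝ) : dirDeriv v (carrierFun a b) =
    algebraMap ℂ smoothFun (I * (a * v.1 + b * v.2)) * carrierFun a b := by
  ext p
  have h1 : HasFDerivAt (fun p : ℝ × ℝ => (p.1 : ℂ)) (ofRealCLM.comp (ContinuousLinearMap.fst ℝ ℝ ℝ)) p :=
    (ofRealCLM.comp (ContinuousLinearMap.fst ℝ ℝ ℝ)).hasFDerivAt
  have h2 : HasFDerivAt (fun p : ℝ × ℝ => (p.2 : ℂ)) (ofRealCLM.comp (ContinuousLinearMap.snd ℝ ℝ ℝ)) p :=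
    (ofRealCLM.comp (ContinuousLinearMap.snd ℝ ℝ ℝ)).hasFDerivAt
  have h := (((h1.const_mul (a : ℂ)).add (h2.const_mul (b : ℂ))).const_mul I).cexp
  rw [dirDeriv_apply]
  refine (congrArg (fun L => L v) h.fderiv).trans ?_
  exact mul_comm _ _

theorem norm_carrier (a b x t : ℝ) : ‖carrier a b x t‖ = 1 := by
  have : I * ((a : ℂ) * x + b * t) = ((a * x + b * t : ℝ) : ℂ) * I := by push_cast; ring
  rw [carrier, this, norm_exp_ofReal_mul_I]

/-- A multiple of the wave, with its carrier. -/
def modulated (n : ℕ) (a c k : ℝ) : smoothFun :=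
  algebraMap ℂ smoothFun k * waveFun n a c * carrierFun a (2 * c ^ 2 - a ^ 2)

theorem modulated_apply (n : ℕ) (a c k : ℝ) (p : ℝ × ℝ) :
    (modulated n a c k : ℝ × ℝ → ℂ) p =
      k * (waveFun n a c : ℝ × ℝ → ℂ) p * carrier a (2 * c ^ 2 - a ^ 2) p.1 p.2 := rfl

theorem norm_modulated (n : ℕ) (a c k : ℝ) (p : ℝ × ℝ) :
    ‖(modulated n a c k : ℝ × ℝ → ℂ) p‖ = |k| * ‖(waveFun n a c : ℝ × ℝ → ℂ) p‖ := by
  rw [modulated_apply, norm_mul, norm_mul, norm_carrier, mul_one, norm_real, Real.norm_eq_abs]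

theorem waveFun_nls (n : ℕ) (a : ℝ) {c : ℝ} (hc : c ≠ 0) :
    algebraMap ℂ smoothFun I * dirDeriv (2 * a, 1) (waveFun n a c)
      + dirDeriv (1, 0) (dirDeriv (1, 0) (waveFun n a c))
      + 2 * (waveFun n a c * star (waveFun n a c) - algebraMap ℂ smoothFun c ^ 2) * waveFun n a c
      = 0 :=
  (isDarboux_smoothFun n a hc).wave_nls rfl

/-- The second derivative of the carrier produces `2ia ∂ₓW`, which cancels the drift in `∂ₜ = (∂ₜ +
2a∂ₓ) - 2a∂ₓ`; the frequency `2c² - a²` accounts for the remaining multiples of `W`. -/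
theorem modulated_equation (n : ℕ) (a : ℝ) {c : ℝ} (hc : c ≠ 0) (k : ℝ) :
    algebraMap ℂ smoothFun I * dirDeriv (0, 1) (modulated n a c k)
      + dirDeriv (1, 0) (dirDeriv (1, 0) (modulated n a c k))
      + 2 * (waveFun n a c * star (waveFun n a c)) * modulated n a c k = 0 := by
  have h := waveFun_nls n a hc
  have ht : dirDeriv (0, 1) (waveFun n a c) = dirDeriv (2 * a, 1) (waveFun n a c)
      - 2 * algebraMap ℂ smoothFun a * dirDeriv (1, 0) (waveFun n a c) := by
    have := dirDeriv_smul_add 1 (-2 * a) (2 * a, 1) (1, 0) (waveFun n a c)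
    simp only [Prod.smul_mk, Prod.mk_add_mk, smul_eq_mul] at this
    rw [show (1 * (2 * a) + -2 * a * 1, (1 : ℝ) * 1 + -2 * a * 0) = ((0, 1) : ℝ × ℝ) by
      ext <;> simp] at this
    rw [this]
    simp only [ofReal_one, map_one, ofReal_mul, ofReal_neg, ofReal_ofNat, map_mul, map_neg,
      map_ofNat]
    ring
  have hI := IsDarboux.I_sq' (R := smoothFun)
  simp only [modulated, Derivation.leibniz, dirDeriv_carrierFun, Derivation.map_algebraMap,
    smul_eq_mul, map_add, mul_zero, add_zero, ht]
  simp only [ofReal_one, ofReal_zero, mul_one, mul_zero, add_zero, zero_add, map_mul, ofReal_sub,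
    ofReal_mul, ofReal_pow, ofReal_ofNat, map_sub, map_pow, map_ofNat]
  generalize waveFun n a c = W at *
  generalize dirDeriv (1, 0) (dirDeriv (1, 0) W) = Wxx at *
  generalize dirDeriv (1, 0) W = Wx at *
  generalize dirDeriv (2 * a, 1) W = Wt at *
  generalize carrierFun a (2 * c ^ 2 - a ^ 2) = E at *
  generalize algebraMap ℂ smoothFun I = ι at *
  generalize algebraMap ℂ smoothFun c = κ at *
  generalize algebraMap ℂ smoothFun a = α at *
  generalize algebraMap ℂ smoothFun k = K at *
  linear_combination K * E * h + 2 * K * E * W * κ ^ 2 * hI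

/-- As `k₁² + k₂² = 1`, the total intensity is `|W|²`, so both components obey the same linear
equation with potential `2|W|²`. -/
theorem isManakovSolution_modulated (n : ℕ) (a : ℝ) {c k₁ k₂ : ℝ} (hc : c ≠ 0)
    (hk : k₁ ^ 2 + k₂ ^ 2 = 1) :
    IsManakovSolution (fun x t => (modulated n a c k₁ : ℝ × ℝ → ℂ) (x, t))
      (fun x t => (modulated n a c k₂ : ℝ × ℝ → ℂ) (x, t)) := by
  have hsum : ∀ x t : ℝ, ((‖(modulated n a c k₁ : ℝ × ℝ → ℂ) (x, t)‖ ^ 2 +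
      ‖(modulated n a c k₂ : ℝ × ℝ → ℂ) (x, t)‖ ^ 2 : ℝ) : ℂ) =
      (waveFun n a c : ℝ × ℝ → ℂ) (x, t) * conj ((waveFun n a c : ℝ × ℝ → ℂ) (x, t)) := by
    intro x t
    rw [norm_modulated, norm_modulated, mul_pow, mul_pow, sq_abs, sq_abs, ← add_mul, hk, one_mul,
      mul_conj, normSq_eq_norm_sq]
  have heq : ∀ k x t : ℝ, I * deriv (fun s => (modulated n a c k : ℝ × ℝ → ℂ) (x, s)) t
      + iteratedDeriv 2 (fun y => (modulated n a c k : ℝ × ℝ → ℂ) (y, t)) x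
      + 2 * ((waveFun n a c : ℝ × ℝ → ℂ) (x, t) * conj ((waveFun n a c : ℝ × ℝ → ℂ) (x, t))) *
        (modulated n a c k : ℝ × ℝ → ℂ) (x, t) = 0 := by
    intro k x t
    rw [(hasDerivAt_snd _ x t).deriv, iteratedDeriv_two_fst]
    exact congrArg (fun f : smoothFun => (f : ℝ × ℝ → ℂ) (x, t)) (modulated_equation n a hc k)
  exact ⟨smoothFun.contDiff _, smoothFun.contDiff _,
    fun x t => by rw [hsum]; exact heq _ _ _, fun x t => by rw [hsum]; exact heq _ _ _⟩

theorem isNLSSolution_modulated (n : ℕ) (a : ℝ) {c : ℝ} (hc : c ≠ 0) :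
    IsNLSSolution (fun x t => (modulated n a c 1 : ℝ × ℝ → ℂ) (x, t)) := by
  have h := isManakovSolution_modulated n a hc (k₁ := 1) (k₂ := 0) (by norm_num)
  refine ⟨h.smooth₁, fun x t => ?_⟩
  have h1 := h.eq₁ x t
  rw [norm_modulated n a c 0, abs_zero, zero_mul, zero_pow two_ne_zero, add_zero] at h1
  exact h1

/-! ## The origin -/

open Matrix in
theorem trace_specMat {R : Type*} [CommRing R] [Algebra ℂ R] (n : ℕ) (z : ℂ) :
    (specMat R n z).trace = algebraMap ℂ R z * n := by
  have : (shift R n).trace = 0 :=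
    Finset.sum_eq_zero fun i _ => by simp [shift]
  rw [specMat, trace_add, this, trace_smul, trace_one, add_zero, Fintype.card_fin, smul_eq_mul]

theorem sinhSeries_zero {R : Type*} [CommRing R] [Algebra ℂ R] (c : ℝ) :
    sinhSeries c (0 : R) 0 = 0 := by
  ext k
  simp [sinhSeries, lsum, phase]

open Matrix in
theorem evalAt_gramForm_of_right {n : ℕ} (G : Matrix (Fin n) (Fin n) smoothFun)
    (u v : Fin n → smoothFun) {p : ℝ × ℝ} (hv : ∀ i, evalAt p (v i) = 0) :
    evalAt p (gramForm G u v) = 0 := by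
  rw [gramForm, dotProduct, map_sum]
  refine Finset.sum_eq_zero fun i _ => ?_
  rw [map_mul, mulVec, dotProduct, map_sum]
  simp [hv]

open Matrix in
-- At the origin `f = 0`, so every form with `f` or `Λf` on the right vanishes and only `g†N⁻¹g`
-- contributes to the derivative.
theorem waveFun_origin (n : ℕ) (a : ℝ) {c : ℝ} (hc : c ≠ 0) :
    (waveFun n a c : ℝ × ℝ → ℂ) (0, 0) = c ∧
    (dirDeriv (1, 0) (waveFun n a c) : ℝ × ℝ → ℂ) (0, 0) = 4 * n * c ^ 2 := by
  have h := isDarboux_smoothFun n a hc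
  set f := trunc n (fSeries c (zFun a c) tFun)
  set g := trunc n (gSeries c (zFun a c) tFun)
  set G := (gramMat n c (zFun a c) tFun)⁻¹
  have hz : evalAt (0, 0) (zFun a c) = 0 := by simp [evalAt_apply, zFun]
  have ht : evalAt (0, 0) tFun = 0 := by simp [evalAt_apply, tFun]
  have hf : ∀ i, evalAt (0, 0) (f i) = 0 := by
    intro i
    have := congrFun (comp_trunc (n := n) (evalAt (0, 0)) (fSeries c (zFun a c) tFun)) i
    rw [map_sinhSeries, hz, ht, sinhSeries_zero] at this
    exact this.trans (by simp [trunc])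
  have hΛf : ∀ i, evalAt (0, 0) ((specMat smoothFun n (I * c) *ᵥ f) i) = 0 := by
    intro i
    rw [mulVec, dotProduct, map_sum]
    simp [hf]
  have hgf : evalAt (0, 0) (gramForm G g f) = 0 := evalAt_gramForm_of_right _ _ _ hf
  have hff : evalAt (0, 0) (gramForm G f f) = 0 := evalAt_gramForm_of_right _ _ _ hf
  have hgΛf : evalAt (0, 0) (gramForm G g (specMat smoothFun n (I * c) *ᵥ f)) = 0 :=
    evalAt_gramForm_of_right _ _ _ hΛf
  -- The trace of the Sylvester equation gives `ic · g†N⁻¹g = tr Λ - tr Λ† = 2inc` here.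
  have hgg : evalAt (0, 0) (gramForm G g g) = 2 * n := by
    have h1 := congrArg (evalAt (0, 0)) h.gramForm_ff_add_gg
    rw [trace_conjTranspose, trace_specMat, star_mul', ← algebraMap_star_comm, star_natCast,
      map_mul (evalAt (0, 0)), map_add, hff, map_sub, map_mul (evalAt (0, 0)),
      map_mul (evalAt (0, 0)), map_natCast, AlgHom.commutes, AlgHom.commutes] at h1
    have hIc : I * (c : ℂ) ≠ 0 := by simpa using hc
    refine mul_left_cancel₀ hIc ?_
    simp only [Algebra.algebraMap_self, RingHom.id_apply, zero_add] at h1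
    rw [h1]
    simp
    ring
  have hW : waveFun n a c = algebraMap ℂ smoothFun c * (1 + 2 * gramForm G g f) := rfl
  have hDW : dirDeriv (1, 0) (waveFun n a c) =
      2 * algebraMap ℂ smoothFun c * dirDeriv (1, 0) (gramForm G g f) := by
    rw [hW]
    simp only [Derivation.leibniz, map_add, Derivation.map_algebraMap, IsDarboux.derivation_two,
      smul_eq_mul, Derivation.map_one_eq_zero, mul_zero, add_zero, zero_add]
    ring
  constructor
  · rw [← evalAt_apply, hW, map_mul, map_add, map_mul, hgf, AlgHom.commutes]
    simp
  · rw [← evalAt_apply, hDW, h.Dx_gramForm_gf]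
    simp only [map_mul, map_sub, hgf, hff, hgg, hgΛf, AlgHom.commutes, map_ofNat, mul_zero,
      zero_sub, sub_zero, Algebra.algebraMap_self, RingHom.id_apply]
    ring

/-- At the origin the height of the wave is increasing in `x`. -/
theorem hasDerivAt_norm_sq_origin (n : ℕ) (a : ℝ) {c : ℝ} (hc : c ≠ 0) :
    HasDerivAt (fun x : ℝ => ‖(waveFun n a c : ℝ × ℝ → ℂ) (x, 0)‖ ^ 2) (8 * n * c ^ 3) 0 := by
  obtain ⟨h0, h1⟩ := waveFun_origin n a hc
  have h := hasDerivAt_fst (waveFun n a c) 0 0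
  rw [h1] at h
  have h2 := h.norm_sq
  rw [h0] at h2
  convert h2 using 1
  rw [real_inner_eq_re_inner ℂ]
  simp
  norm_cast
  push_cast
  ring

/-- Otherwise the origin, where the height is exactly `c`, would be a maximum along the `x`-axis,
against the positive derivative there. -/
theorem exists_lt_norm_waveFun {n : ℕ} (hn : 1 ≤ n) (a : ℝ) {c : ℝ} (hc : 0 < c) :
    ∃ x : ℝ, c ^ 2 < ‖(waveFun n a c : ℝ × ℝ → ℂ) (x, 0)‖ ^ 2 := by
  by_contra! hle
  have hd := hasDerivAt_norm_sq_origin n a hc.ne'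
  have hmax : IsLocalMax (fun x : ℝ => ‖(waveFun n a c : ℝ × ℝ → ℂ) (x, 0)‖ ^ 2) 0 := by
    refine Eventually.of_forall fun x => ?_
    simp only
    rw [(waveFun_origin n a hc.ne').1, norm_real, Real.norm_eq_abs, sq_abs]
    exact hle x
  have := hmax.hasDerivAt_eq_zero hd
  have hn' : (0 : ℝ) < n := by exact_mod_cast hn
  have : 0 < 8 * n * c ^ 3 := by positivity
  linarith

/-- An even function has derivative zero at the origin, but here the derivative of the squared
height is `8nc³`. -/
theorem exists_norm_waveFun_neg_ne {n : ℕ} (hn : 1 ≤ n) (a : ℝ) {c : ℝ} (hc : 0 < c) :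
    ∃ x : ℝ, ‖(waveFun n a c : ℝ × ℝ → ℂ) (-x, 0)‖ ≠ ‖(waveFun n a c : ℝ × ℝ → ℂ) (x, 0)‖ := by
  by_contra! heq
  have hd := hasDerivAt_norm_sq_origin n a hc.ne'
  have hd' := HasDerivAt.scomp (h := fun x : ℝ => -x) (0 : ℝ)
    (by simpa using hd : HasDerivAt _ _ (-0 : ℝ)) (hasDerivAt_neg 0)
  have h : ((fun x : ℝ => ‖(waveFun n a c : ℝ × ℝ → ℂ) (x, 0)‖ ^ 2) ∘ fun x : ℝ => -x) =
      fun x : ℝ => ‖(waveFun n a c : ℝ × ℝ → ℂ) (x, 0)‖ ^ 2 := by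
    ext x
    simp only [Function.comp_apply, heq]
  rw [h] at hd'
  have := hd'.unique hd
  have hn' : (0 : ℝ) < n := by exact_mod_cast hn
  have : 0 < 8 * n * c ^ 3 := by positivity
  simp only [smul_eq_mul] at *
  linarith

end

end Manakov

namespace Manakov

noncomputable section

open PowerSeries (coeff X C)

/-! ### Growth of the series as `z → ∞`, by weights. -/

section Weight

variable {α : Type*} {l : Filter α} {z τ : α → ℂ}

/-- `F` has weight `d` with leading part `L`, if `s` has weight `-2` and `z → ∞` has weight `1`. -/
def HasWeight (l : Filter α) (z : α → ℂ) (F : α → PowerSeries ℂ) (d : ℤ) (L : PowerSeries ℂ) :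
    Prop :=
  ∀ k : ℕ, Tendsto (fun a => coeff k (F a) * z a ^ (-(2 * k + d))) l (𝓝 (coeff k L))

theorem eventually_ne_zero_of_cobounded (hz : Tendsto z l (Bornology.cobounded ℂ)) :
    ∀ᶠ a in l, z a ≠ 0 :=
  hz.eventually (Bornology.eventually_ne_cobounded 0)

theorem tendsto_zpow_of_neg (hz : Tendsto z l (Bornology.cobounded ℂ)) {m : ℤ} (hm : m < 0) :
    Tendsto (fun a => z a ^ m) l (𝓝 0) := by
  obtain ⟨k, rfl⟩ : ∃ k : ℕ, m = -((k + 1 : ℕ) : ℤ) := ⟨(-m - 1).toNat, by omega⟩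
  have h := (tendsto_inv₀_cobounded.comp hz).pow (k + 1)
  simp only [Function.comp_apply, ne_eq, Nat.add_eq_zero_iff, one_ne_zero, and_false,
    not_false_eq_true, zero_pow] at h
  refine h.congr fun a => ?_
  rw [zpow_neg, zpow_natCast, inv_pow]

namespace HasWeight

variable {F G : α → PowerSeries ℂ} {d e : ℤ} {L M : PowerSeries ℂ}

theorem add (hF : HasWeight l z F d L) (hG : HasWeight l z G d M) :
    HasWeight l z (fun a => F a + G a) d (L + M) := by
  intro k
  simpa only [map_add, add_mul] using (hF k).add (hG k)

theorem neg (hF : HasWeight l z F d L) : HasWeight l z (fun a => -F a) d (-L) := by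
  intro k
  simpa only [map_neg, neg_mul] using (hF k).neg

theorem sub (hF : HasWeight l z F d L) (hG : HasWeight l z G d M) :
    HasWeight l z (fun a => F a - G a) d (L - M) := by
  simpa only [sub_eq_add_neg] using hF.add hG.neg

theorem mul (hz : Tendsto z l (Bornology.cobounded ℂ)) (hF : HasWeight l z F d L)
    (hG : HasWeight l z G e M) : HasWeight l z (fun a => F a * G a) (d + e) (L * M) := by
  intro k
  rw [PowerSeries.coeff_mul]
  have h := tendsto_finsetSum (Finset.HasAntidiagonal.antidiagonal k) fun p _ => (hF p.1).mul (hG p.2)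
  refine h.congr' ?_
  filter_upwards [eventually_ne_zero_of_cobounded hz] with a ha
  rw [PowerSeries.coeff_mul, Finset.sum_mul]
  refine Finset.sum_congr rfl fun p hp => ?_
  have hk : (p.1 : ℤ) + p.2 = k := by exact_mod_cast Finset.HasAntidiagonal.mem_antidiagonal.1 hp
  rw [mul_mul_mul_comm, ← zpow_add₀ ha]
  congr 2
  linear_combination (-2) * hk

theorem of_lt (hz : Tendsto z l (Bornology.cobounded ℂ)) (hF : HasWeight l z F d L) (hde : d < e) :
    HasWeight l z F e 0 := by
  intro k
  have h := (hF k).mul (tendsto_zpow_of_neg hz (m := d - e) (by omega))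
  rw [mul_zero] at h
  rw [map_zero]
  refine h.congr' ?_
  filter_upwards [eventually_ne_zero_of_cobounded hz] with a ha
  rw [mul_assoc, ← zpow_add₀ ha]
  congr 2
  ring

theorem const (hz : Tendsto z l (Bornology.cobounded ℂ)) (A : PowerSeries ℂ) :
    HasWeight l z (fun _ => A) 0 (C (coeff 0 A)) := by
  rintro (_ | k)
  · simpa using tendsto_const_nhds
  · have h := (tendsto_zpow_of_neg hz (m := -(2 * ((k + 1 : ℕ) : ℤ) + 0)) (by omega)).const_mul
      (coeff (k + 1) A)
    rw [mul_zero] at h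
    rwa [PowerSeries.coeff_C, if_neg k.succ_ne_zero]

theorem X : HasWeight l z (fun _ => X) (-2) X := by
  intro k
  rw [PowerSeries.coeff_X]
  split_ifs with h
  · subst h; simpa using tendsto_const_nhds
  · simpa [PowerSeries.coeff_X, if_neg h] using tendsto_const_nhds

theorem pow (hz : Tendsto z l (Bornology.cobounded ℂ)) (hF : HasWeight l z F d L) (j : ℕ) :
    HasWeight l z (fun a => F a ^ j) (j * d) (L ^ j) := by
  induction j with
  | zero => simpa using const hz 1
  | succ j ih =>
    have := ih.mul hz hF
    simp only [pow_succ]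
    convert this using 1
    push_cast; ring

theorem lsum {F : ℕ → α → PowerSeries ℂ} {L : ℕ → PowerSeries ℂ}
    (hF : ∀ j, HasWeight l z (F j) d (L j)) :
    HasWeight l z (fun a => Manakov.lsum fun j => F j a) d (Manakov.lsum L) := by
  intro k
  simp only [Manakov.lsum, PowerSeries.coeff_mk, Finset.sum_mul]
  exact tendsto_finsetSum _ fun j _ => hF j k

theorem uSq (hz : Tendsto z l (Bornology.cobounded ℂ)) (c : ℝ) :
    HasWeight l z (fun _ => uSq ℂ c) (-2) (-(PowerSeries.X * C (2 * I * c))) := by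
  have h := (X (l := l) (z := z)).mul hz (const hz (cst ℂ (2 * I * c) + PowerSeries.X))
  simpa [Manakov.uSq, cst] using h.neg

/-- The summand `2sτ` is of lower order: its only coefficient is compared with `z³`, and `τ z⁻³ →
0`. -/
theorem phase (hz : Tendsto z l (Bornology.cobounded ℂ))
    (hτ : Tendsto (fun a => τ a * z a ^ (-3 : ℤ)) l (𝓝 0)) :
    HasWeight l z (fun a => phase (z a) (τ a)) 1 1 := by
  intro k
  rcases k with _ | _ | k
  · have : ∀ᶠ a in l, (1 : ℂ) =
        coeff 0 (Manakov.phase (z a) (τ a)) * z a ^ (-(2 * ((0 : ℕ) : ℤ) + 1)) := by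
      filter_upwards [eventually_ne_zero_of_cobounded hz] with a ha
      simp [Manakov.phase, ha]
    simpa using tendsto_const_nhds.congr' this
  · have h := hτ.const_mul 2
    rw [mul_zero] at h
    simp only [zero_add, PowerSeries.coeff_one, one_ne_zero, if_false]
    refine h.congr fun a => ?_
    simp only [Manakov.phase, map_add, PowerSeries.coeff_C, one_ne_zero, if_false,
      PowerSeries.coeff_C_mul, PowerSeries.coeff_one_X]
    norm_num
    ring
  · simp [Manakov.phase, PowerSeries.coeff_one,
      tendsto_const_nhds]

end HasWeight

/-- The leading part of `sinhSeries`. -/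
def sinhLead (c : ℝ) : PowerSeries ℂ :=
  lsum fun j => cst ℂ ((2 * j + 1).factorial : ℂ)⁻¹ * (-(X * C (2 * I * c))) ^ j

/-- The leading part of `coshSeries`. -/
def coshLead (c : ℝ) : PowerSeries ℂ :=
  lsum fun j => cst ℂ ((2 * j).factorial : ℂ)⁻¹ * (-(X * C (2 * I * c))) ^ j

theorem coeff_lead (c : ℝ) (y : ℕ → ℂ) (k : ℕ) :
    coeff k (lsum fun j => cst ℂ (y j) * (-(X * C (2 * I * c))) ^ j) = y k * (-(2 * I * c)) ^ k := by
  have h : ∀ j, cst ℂ (y j) * (-(X * C (2 * I * c))) ^ j = C (y j * (-(2 * I * c)) ^ j) * X ^ j := by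
    intro j
    rw [show -(X * C (2 * I * (c : ℂ))) = C (-(2 * I * (c : ℂ))) * X by rw [map_neg]; ring, mul_pow,
      map_mul, map_pow]
    simp [cst, mul_assoc]
  simp only [lsum, h, PowerSeries.coeff_mk, PowerSeries.coeff_C_mul_X_pow]
  rw [Finset.sum_eq_single k]
  · simp
  · intro j _ hj
    rw [if_neg (Ne.symm hj)]
  · simp

/-- The leading part of `basisSeries`. -/
def basisLead (c : ℝ) : ℕ → PowerSeries ℂ
  | 0 => sinhLead c
  | 1 => C (I * (2 * I * c)⁻¹) * coshLead c
  | p + 2 => X * C (2 * I * c)⁻¹ * basisLead c p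

section

variable (hz : Tendsto z l (Bornology.cobounded ℂ))
  (hτ : Tendsto (fun a => τ a * z a ^ (-3 : ℤ)) l (𝓝 0))
include hz hτ

theorem hasWeight_sinhSeries (c : ℝ) :
    HasWeight l z (fun a => sinhSeries c (z a) (τ a)) 1 (sinhLead c) := by
  refine HasWeight.lsum fun j => ?_
  have h := (HasWeight.const hz (cst ℂ ((2 * j + 1).factorial : ℂ)⁻¹)).mul hz
    (((HasWeight.uSq hz c).pow hz j).mul hz ((HasWeight.phase hz hτ).pow hz (2 * j + 1)))
  convert h using 1
  · push_cast; ring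
  · simp [cst]

theorem hasWeight_coshSeries (c : ℝ) :
    HasWeight l z (fun a => coshSeries c (z a) (τ a)) 0 (coshLead c) := by
  refine HasWeight.lsum fun j => ?_
  have h := (HasWeight.const hz (cst ℂ ((2 * j).factorial : ℂ)⁻¹)).mul hz
    (((HasWeight.uSq hz c).pow hz j).mul hz ((HasWeight.phase hz hτ).pow hz (2 * j)))
  convert h using 1
  · push_cast; ring
  · simp [cst]

/-- Each step `p → p + 2` multiplies by `s/(2ic + s)`, of weight `-2`. In `e₀` the hyperbolic sine
dominates and in `e₁` the hyperbolic cosine, hence the uniform weight `1 - p`. -/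
theorem hasWeight_basisSeries (c : ℝ) (p : ℕ) :
    HasWeight l z (fun a => basisSeries c (z a) (τ a) p) (1 - p) (basisLead c p) := by
  have hd : HasWeight l z (fun _ => denInv ℂ c) 0 (C (2 * I * c)⁻¹) := by
    have := HasWeight.const hz (denInv ℂ c)
    rwa [constantCoeff_denInv] at this
  have hI : HasWeight l z (fun _ => cst ℂ I) 0 (C I) := by
    simpa [cst] using HasWeight.const hz (cst ℂ I)
  induction p using Nat.twoStepInduction with
  | zero =>
    have h := (hasWeight_sinhSeries hz hτ c).sub
      (((hI.mul hz hd).mul hz (hasWeight_coshSeries hz hτ c)).of_lt hz (e := 1) (by norm_num))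
    simpa [basisSeries, basisLead] using h
  | one =>
    have h := (hI.mul hz hd).mul hz ((hasWeight_coshSeries hz hτ c).add
      (((hI.mul hz HasWeight.X).mul hz (hasWeight_sinhSeries hz hτ c)).of_lt hz (e := 0)
        (by norm_num)))
    simpa [basisSeries, basisLead] using h
  | more p ih _ =>
    have h := ((HasWeight.X (l := l) (z := z)).mul hz hd).mul hz ih
    simp only [basisSeries, basisLead]
    convert h using 1
    push_cast; ring

end

/-- The factors of the columns of the leading part of the coefficients of `basisSeries`. -/
def leadCol (c : ℝ) : ℕ → ℂ
  | 0 => 1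
  | 1 => I * (2 * I * c)⁻¹
  | p + 2 => -(2 * I * c)⁻¹ ^ 2 * leadCol c p

theorem leadCol_ne_zero {c : ℝ} (hc : c ≠ 0) (p : ℕ) : leadCol c p ≠ 0 := by
  have : (c : ℂ) ≠ 0 := by exact_mod_cast hc
  induction p using Nat.twoStepInduction with
  | zero => simp [leadCol]
  | one => simp [leadCol, hc]
  | more p ih _ => simp [leadCol, hc, ih]

/-- Up to factors depending on `k` alone and on `p` alone, the coefficient is the falling factorial
of `2k + 1` of length `p`; the case `p + 2` is the recursion for falling factorials. -/
theorem coeff_basisLead {c : ℝ} (hc : c ≠ 0) (p k : ℕ) :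
    coeff k (basisLead c p) = (-(2 * I * c)) ^ k * ((2 * k + 1).factorial : ℂ)⁻¹ *
      ((2 * k + 1).descFactorial p * leadCol c p) := by
  have hc' : (2 * I * (c : ℂ)) ≠ 0 := by simp [hc]
  induction p using Nat.twoStepInduction generalizing k with
  | zero =>
    rw [basisLead, sinhLead, coeff_lead c (fun j => ((2 * j + 1).factorial : ℂ)⁻¹), leadCol,
      Nat.descFactorial_zero]
    push_cast; ring
  | one =>
    rw [basisLead, coshLead, PowerSeries.coeff_C_mul,
      coeff_lead c (fun j => ((2 * j).factorial : ℂ)⁻¹), leadCol, Nat.descFactorial_one,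
      Nat.factorial_succ]
    have h1 : ((2 * k + 1 : ℕ) : ℂ) ≠ 0 := by exact_mod_cast (2 * k).succ_ne_zero
    have h2 : ((2 * k).factorial : ℂ) ≠ 0 := by exact_mod_cast (2 * k).factorial_ne_zero
    rw [Nat.cast_mul]
    field_simp
  | more p ih _ =>
    rw [basisLead, mul_assoc]
    rcases k with _ | k
    · rw [PowerSeries.coeff_zero_X_mul]
      simp [Nat.descFactorial]
    · rw [PowerSeries.coeff_succ_X_mul, PowerSeries.coeff_C_mul, ih, leadCol,
        show 2 * (k + 1) + 1 = 2 * k + 1 + 1 + 1 by ring, Nat.succ_descFactorial_succ,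
        Nat.succ_descFactorial_succ, Nat.factorial_succ (2 * k + 1 + 1),
        Nat.factorial_succ (2 * k + 1)]
      have h1 : ((2 * k + 1 + 1 : ℕ) : ℂ) ≠ 0 := by exact_mod_cast (2 * k + 1).succ_ne_zero
      have h2 : ((2 * k + 1 + 1 + 1 : ℕ) : ℂ) ≠ 0 := by exact_mod_cast (2 * k + 1 + 1).succ_ne_zero
      have h3 : ((2 * k + 1).factorial : ℂ) ≠ 0 := by exact_mod_cast (2 * k + 1).factorial_ne_zero
      simp only [Nat.cast_mul]
      rw [pow_succ]
      field_simp

open Matrix in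
-- After row and column factors are removed, column `p` is a monic polynomial of degree `p` in `2k +
-- 1`. The determinant is thus a Vandermonde determinant with the distinct nodes `2k + 1`.
theorem det_basisLead_ne_zero {c : ℝ} (hc : c ≠ 0) (n : ℕ) :
    (Matrix.of fun k p : Fin n => coeff (k : ℕ) (basisLead c p)).det ≠ 0 := by
  have hc' : (2 * I * (c : ℂ)) ≠ 0 := by simp [hc]
  have h : (Matrix.of fun k p : Fin n => coeff (k : ℕ) (basisLead c p)) =
      diagonal (fun k : Fin n => (-(2 * I * c)) ^ (k : ℕ) * ((2 * (k : ℕ) + 1).factorial : ℂ)⁻¹) *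
      (Matrix.of fun k p : Fin n =>
        (descPochhammer ℂ p).eval (((2 * (k : ℕ) + 1 : ℕ) : ℂ))) *
      diagonal (fun p : Fin n => leadCol c p) := by
    ext k p
    rw [mul_diagonal, diagonal_mul]
    simp only [of_apply]
    rw [coeff_basisLead hc, descPochhammer_eval_eq_descFactorial]
    ring
  rw [h, det_mul, det_mul, det_diagonal, det_diagonal,
    ← det_eval_matrixOfPolynomials_eq_det_vandermonde _ (fun p : Fin n => descPochhammer ℂ p)
      (fun p => descPochhammer_natDegree ℂ p) (fun p => monic_descPochhammer ℂ p)]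
  refine mul_ne_zero (mul_ne_zero (Finset.prod_ne_zero_iff.2 fun k _ => ?_) ?_)
    (Finset.prod_ne_zero_iff.2 fun p _ => leadCol_ne_zero hc p)
  · exact mul_ne_zero (pow_ne_zero _ (neg_ne_zero.2 hc'))
      (inv_ne_zero (by exact_mod_cast Nat.factorial_ne_zero _))
  · rw [det_vandermonde_ne_zero_iff]
    intro i j hij
    have : 2 * (i : ℕ) + 1 = 2 * (j : ℕ) + 1 := Nat.cast_injective (R := ℂ) hij
    exact Fin.ext (by omega)

end Weight

end

end Manakov

namespace Manakov

noncomputable section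

/-! ### The wave far from the origin. -/

section Localization

open Matrix
open PowerSeries (coeff X C)

/-- A geometric sum: with `r = s/(2ic + s)` one has `e₀ + e₁ = (1 - r) f` and `e_(p+2) = r e_p`. The
remainder `r^m f` vanishes modulo `s^m`, so `f` is the sum of all basis vectors. -/
theorem sum_basisSeries {R : Type*} [CommRing R] [Algebra ℂ R] {c : ℝ} (hc : c ≠ 0) (z τ : R)
    (m : ℕ) : ∑ p ∈ Finset.range (2 * m), basisSeries c z τ p =
      fSeries c z τ - (X * denInv R c) ^ m * fSeries c z τ := by
  have hd := den_mul_denInv (R := R) hc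
  have h0 := den_mul_basisSeries_zero hc z τ
  have h1 := den_mul_basisSeries_one hc z τ
  have h01 : basisSeries c z τ 0 + basisSeries c z τ 1 =
      fSeries c z τ - X * denInv R c * fSeries c z τ := by
    rw [cst_mul, cst_mul, cst_two] at hd h0 h1
    rw [cst_mul] at h0 h1
    linear_combination denInv R c * h0 + denInv R c * h1
      + (fSeries c z τ - basisSeries c z τ 0 - basisSeries c z τ 1) * hd
  induction m with
  | zero => simp
  | succ m ih =>
    rw [show 2 * (m + 1) = 2 * m + 1 + 1 by ring, Finset.sum_range_succ, Finset.sum_range_succ, ih,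
      basisSeries_two_mul_add c z τ m 1, show 2 * m = 2 * m + 0 by rfl,
      basisSeries_two_mul_add c z τ m 0, pow_succ]
    linear_combination (X * denInv R c) ^ m * h01

/-- The same geometric sum, started from `e₁ - e₀ = (1 - r) g` with `r = s/(2ic + s)`. -/
theorem sum_neg_one_pow_basisSeries {R : Type*} [CommRing R] [Algebra ℂ R] {c : ℝ} (hc : c ≠ 0)
    (z τ : R) (m : ℕ) : ∑ p ∈ Finset.range (2 * m), (-1) ^ (p + 1) * basisSeries c z τ p =
      gSeries c z τ - (X * denInv R c) ^ m * gSeries c z τ := by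
  have hd := den_mul_denInv (R := R) hc
  have h0 := den_mul_basisSeries_zero hc z τ
  have h1 := den_mul_basisSeries_one hc z τ
  have h01 : -basisSeries c z τ 0 + basisSeries c z τ 1 =
      gSeries c z τ - X * denInv R c * gSeries c z τ := by
    rw [cst_mul, cst_mul, cst_two] at hd h0 h1
    rw [cst_mul] at h0 h1
    linear_combination -denInv R c * h0 + denInv R c * h1
      + (gSeries c z τ + basisSeries c z τ 0 - basisSeries c z τ 1) * hd
  induction m with
  | zero => simp
  | succ m ih =>
    rw [show 2 * (m + 1) = 2 * m + 1 + 1 by ring, Finset.sum_range_succ, Finset.sum_range_succ, ih,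
      basisSeries_two_mul_add c z τ m 1, show 2 * m = 2 * m + 0 by rfl,
      basisSeries_two_mul_add c z τ m 0, pow_succ]
    have e1 : ((-1) ^ (2 * m) : PowerSeries R) = 1 := by simp [pow_mul]
    simp only [add_zero, pow_succ, e1]
    linear_combination (X * denInv R c) ^ m * h01

/-- The coefficients of `basisSeries c z τ (p + i)`, for `p < n`. -/
def basisMat (n : ℕ) (c : ℝ) (z τ : ℂ) (i : ℕ) : Matrix (Fin n) (Fin n) ℂ :=
  Matrix.of fun k p => coeff (k : ℕ) (basisSeries c z τ (p + i))

theorem sum_range_two_mul {M : Type*} [AddCommMonoid M] (n : ℕ) (F : ℕ → M) :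
    ∑ p ∈ Finset.range (2 * n), F p = ∑ p : Fin n, F p + ∑ p : Fin n, F (p + n) := by
  rw [two_mul, Finset.sum_range_add, ← Fin.sum_univ_eq_sum_range F n,
    ← Fin.sum_univ_eq_sum_range (fun p => F (n + p)) n]
  simp only [add_comm]

theorem gramMat_eq (n : ℕ) (c : ℝ) (z τ : ℂ) :
    gramMat n c z τ = basisMat n c z τ 0 * (basisMat n c z τ 0)ᴴ +
      basisMat n c z τ n * (basisMat n c z τ n)ᴴ := by
  rw [gramMat, sum_range_two_mul]
  ext i j
  simp only [Matrix.add_apply, Matrix.sum_apply, vecMulVec_apply, mul_apply, conjTranspose_apply,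
    basisMat, of_apply, Pi.star_apply, trunc, add_zero]

theorem trunc_fSeries (n : ℕ) {c : ℝ} (hc : c ≠ 0) (z τ : ℂ) :
    trunc n (fSeries c z τ) = basisMat n c z τ 0 *ᵥ 1 + basisMat n c z τ n *ᵥ 1 := by
  have h := congrArg (trunc n) (sum_basisSeries hc z τ n)
  rw [trunc_sub, trunc_eq_zero_iff.2 (dvd_mul_of_dvd_left (by
    rw [mul_pow]; exact dvd_mul_right _ _) _), sub_zero] at h
  rw [← h, sum_range_two_mul]
  ext k
  simp [trunc, basisMat, mulVec, dotProduct]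

theorem trunc_gSeries (n : ℕ) {c : ℝ} (hc : c ≠ 0) (z τ : ℂ) :
    trunc n (gSeries c z τ) = basisMat n c z τ 0 *ᵥ (fun p => (-1) ^ ((p : ℕ) + 1)) +
      basisMat n c z τ n *ᵥ (fun p => (-1) ^ ((p : ℕ) + n + 1)) := by
  have h := congrArg (trunc n) (sum_neg_one_pow_basisSeries hc z τ n)
  rw [trunc_sub, trunc_eq_zero_iff.2 (dvd_mul_of_dvd_left (by
    rw [mul_pow]; exact dvd_mul_right _ _) _), sub_zero] at h
  rw [← h, sum_range_two_mul]
  have h1 : ∀ (i : ℕ) (F : PowerSeries ℂ) (k : ℕ), coeff k ((-1) ^ i * F) = (-1) ^ i * coeff k F := by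
    intro i F k
    rw [← PowerSeries.coeff_C_mul]
    simp
  ext k
  simp [trunc, basisMat, mulVec, dotProduct, h1, mul_comm (coeff _ _)]

variable {α : Type*} {l : Filter α} {z τ : α → ℂ}

section

variable (hz : Tendsto z l (Bornology.cobounded ℂ))
  (hτ : Tendsto (fun a => τ a * z a ^ (-3 : ℤ)) l (𝓝 0)) (n : ℕ) {c : ℝ}
include hz

/-- The rescaled `basisMat`. -/
def scaledMat (n : ℕ) (c : ℝ) (z τ : ℂ) (i : ℕ) : Matrix (Fin n) (Fin n) ℂ :=
  Matrix.of fun k p => coeff (k : ℕ) (basisSeries c z τ (p + i)) *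
    z ^ (-(2 * ((k : ℕ) : ℤ) + (1 - ((p : ℕ) + i : ℕ))))

omit hz in
-- The weights split into a row part `2k + 1` and a column part `-(p + i)`, so rescaling is
-- multiplication by diagonal matrices on both sides.
theorem basisMat_eq {z τ : ℂ} (h : z ≠ 0) (i : ℕ) :
    basisMat n c z τ i = diagonal (fun k : Fin n => z ^ (2 * (k : ℕ) + 1 : ℤ)) *
      scaledMat n c z τ i * diagonal (fun p : Fin n => z ^ (-((p : ℕ) + i : ℕ) : ℤ)) := by
  ext k p
  rw [mul_diagonal, diagonal_mul]
  simp only [basisMat, scaledMat, of_apply]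
  rw [mul_left_comm, mul_assoc, mul_assoc, ← zpow_add₀ h, ← zpow_add₀ h]
  convert (mul_one _).symm
  rw [← zpow_zero z]
  congr 1
  ring

include hτ

theorem tendsto_scaledMat (c : ℝ) (i : ℕ) : Tendsto (fun a => scaledMat n c (z a) (τ a) i) l
    (𝓝 (Matrix.of fun k p : Fin n => coeff (k : ℕ) (basisLead c (p + i)))) :=
  tendsto_pi_nhds.2 fun k => tendsto_pi_nhds.2 fun p =>
    hasWeight_basisSeries hz hτ c (p + i) k

variable (hc : c ≠ 0)
include hc

theorem tendsto_det_scaledMat : Tendsto (fun a => (scaledMat n c (z a) (τ a) 0).det) l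
    (𝓝 (Matrix.of fun k p : Fin n => coeff (k : ℕ) (basisLead c p)).det) :=
  ((continuous_id.matrix_det).tendsto _).comp (tendsto_scaledMat hz hτ n c 0)

theorem eventually_det_scaledMat_ne_zero : ∀ᶠ a in l, (scaledMat n c (z a) (τ a) 0).det ≠ 0 :=
  (tendsto_det_scaledMat hz hτ n hc).eventually_ne (det_basisLead_ne_zero hc n)

omit hz hτ hc in
-- The diagonal factors contribute `Σ (2k + 1 - k) = n(n + 1)/2` to the exponent. Squaring avoids
-- the division by two and yields the quantity needed for `det N`.
theorem det_basisMat {z τ : ℂ} (h : z ≠ 0) :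
    (basisMat n c z τ 0).det * (basisMat n c z τ 0).det =
      z ^ (n * (n + 1)) * ((scaledMat n c z τ 0).det * (scaledMat n c z τ 0).det) := by
  rw [basisMat_eq n h, det_mul, det_mul, det_diagonal, det_diagonal]
  have key : ((∏ k : Fin n, z ^ (2 * (k : ℕ) + 1 : ℤ)) * ∏ p : Fin n, z ^ (-((p : ℕ) + 0 : ℕ) : ℤ)) *
      ((∏ k : Fin n, z ^ (2 * (k : ℕ) + 1 : ℤ)) * ∏ p : Fin n, z ^ (-((p : ℕ) + 0 : ℕ) : ℤ)) =
      z ^ (n * (n + 1)) := by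
    rw [← Finset.prod_mul_distrib, ← Finset.prod_mul_distrib]
    have : ∀ k : Fin n, z ^ (2 * (k : ℕ) + 1 : ℤ) * z ^ (-((k : ℕ) + 0 : ℕ) : ℤ) *
        (z ^ (2 * (k : ℕ) + 1 : ℤ) * z ^ (-((k : ℕ) + 0 : ℕ) : ℤ)) = z ^ (2 * ((k : ℕ) + 1)) := by
      intro k
      rw [← zpow_add₀ h, ← zpow_add₀ h, ← zpow_natCast]
      congr 1
      push_cast
      ring
    simp only [this]
    rw [Finset.prod_pow_eq_pow_sum, Fin.sum_univ_eq_sum_range (fun k => 2 * (k + 1)) n]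
    congr 1
    clear this
    induction n with
    | zero => rfl
    | succ n ih => rw [Finset.sum_range_succ, ih]; ring
  rw [← key]
  ring

theorem eventually_det_basisMat_ne_zero : ∀ᶠ a in l, (basisMat n c (z a) (τ a) 0).det ≠ 0 := by
  filter_upwards [eventually_ne_zero_of_cobounded hz,
    eventually_det_scaledMat_ne_zero hz hτ n hc] with a h1 h2 h3
  have := det_basisMat (c := c) (τ := τ a) n h1
  rw [h3, mul_zero] at this
  exact mul_ne_zero (pow_ne_zero _ h1) (mul_ne_zero h2 h2) this.symm

/-- The tail of the basis becomes negligible. -/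
theorem tendsto_inv_basisMat_mul : Tendsto
    (fun a => (basisMat n c (z a) (τ a) 0)⁻¹ * basisMat n c (z a) (τ a) n) l (𝓝 0) := by
  have hdet := det_basisLead_ne_zero hc n
  have h0 : Tendsto (fun a => (scaledMat n c (z a) (τ a) 0)⁻¹ * scaledMat n c (z a) (τ a) n) l
      (𝓝 ((Matrix.of fun k p : Fin n => coeff (k : ℕ) (basisLead c p))⁻¹ *
        (Matrix.of fun k p : Fin n => coeff (k : ℕ) (basisLead c (p + n))))) := by
    refine Tendsto.mul ((continuousAt_matrix_inv _ ?_).tendsto.comp (tendsto_scaledMat hz hτ n c 0))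
      (tendsto_scaledMat hz hτ n c n)
    exact NormedRing.inverse_continuousAt (Units.mk0 _ hdet)
  refine tendsto_pi_nhds.2 fun p => tendsto_pi_nhds.2 fun q => ?_
  -- Undoing the scaling multiplies the `(p, q)` entry by `z^(p - q - n)`, and this exponent is
  -- negative since `p < n`.
  have h1 := (tendsto_pi_nhds.1 (tendsto_pi_nhds.1 h0 p) q).mul
    (tendsto_zpow_of_neg hz (m := (p : ℕ) - ((q : ℕ) + n : ℕ)) (by have := p.2; omega))
  rw [mul_zero] at h1
  refine h1.congr' ?_
  filter_upwards [eventually_ne_zero_of_cobounded hz,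
    eventually_det_scaledMat_ne_zero hz hτ n hc, eventually_det_basisMat_ne_zero hz hτ n hc]
    with a ha h2 h3
  have h4 : (basisMat n c (z a) (τ a) 0)⁻¹ * basisMat n c (z a) (τ a) n =
      diagonal (fun p : Fin n => z a ^ ((p : ℕ) : ℤ)) *
        ((scaledMat n c (z a) (τ a) 0)⁻¹ * scaledMat n c (z a) (τ a) n) *
        diagonal (fun p : Fin n => z a ^ (-((p : ℕ) + n : ℕ) : ℤ)) := by
    have hu : IsUnit (scaledMat n c (z a) (τ a) 0).det := h2.isUnit
    have hb : IsUnit (basisMat n c (z a) (τ a) 0).det := h3.isUnit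
    have hd : diagonal (fun p : Fin n => z a ^ (-((p : ℕ) + 0 : ℕ) : ℤ)) *
        diagonal (fun p : Fin n => z a ^ ((p : ℕ) : ℤ)) = 1 := by
      rw [diagonal_mul_diagonal, ← diagonal_one]
      congr 1
      ext p
      rw [← zpow_add₀ ha]
      simp
    refine ((isUnit_iff_isUnit_det _).2 hb).mul_left_cancel ?_
    rw [← mul_assoc, mul_nonsing_inv _ hb, one_mul, basisMat_eq n ha 0, basisMat_eq n ha n]
    simp only [mul_assoc]
    rw [← mul_assoc (diagonal fun p : Fin n => z a ^ (-((p : ℕ) + 0 : ℕ) : ℤ)), hd, one_mul,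
      ← mul_assoc (scaledMat n c (z a) (τ a) 0), mul_nonsing_inv _ hu, one_mul]
  rw [h4, mul_diagonal, diagonal_mul, mul_comm (z a ^ _), mul_assoc, ← zpow_add₀ ha]
  rfl

omit hz hτ hc in
-- For `N = EE† + TT†` and `C = E⁻¹T` this is `N = E(1 + CC†)E†`. As `C → 0`, the Gram matrix
-- behaves like `EE†`.
theorem gramMat_factor {z τ : ℂ} (h : (basisMat n c z τ 0).det ≠ 0) :
    gramMat n c z τ = basisMat n c z τ 0 *
      (1 + (basisMat n c z τ 0)⁻¹ * basisMat n c z τ n *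
        ((basisMat n c z τ 0)⁻¹ * basisMat n c z τ n)ᴴ) * (basisMat n c z τ 0)ᴴ := by
  have hb : IsUnit (basisMat n c z τ 0).det := h.isUnit
  have h1 : basisMat n c z τ n = basisMat n c z τ 0 *
      ((basisMat n c z τ 0)⁻¹ * basisMat n c z τ n) := by
    rw [← mul_assoc, mul_nonsing_inv _ hb, one_mul]
  rw [gramMat_eq]
  conv_lhs => rw [h1]
  rw [conjTranspose_mul (basisMat n c z τ 0)]
  noncomm_ring

/-- The determinant of the Gram matrix grows like `|z| ^ (n (n + 1))`. -/
theorem tendsto_det_gramMat : Tendsto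
    (fun a => ‖(gramMat n c (z a) (τ a)).det‖ / ‖z a‖ ^ (n * (n + 1))) l
    (𝓝 (‖(Matrix.of fun k p : Fin n => coeff (k : ℕ) (basisLead c p)).det‖ ^ 2)) := by
  have hC := tendsto_inv_basisMat_mul hz hτ n hc
  have hcont : Continuous fun C : Matrix (Fin n) (Fin n) ℂ => ‖(1 + C * Cᴴ).det‖ := by fun_prop
  have h1 := (hcont.tendsto 0).comp hC
  have h2 := h1.mul ((tendsto_det_scaledMat hz hτ n hc).norm.pow 2)
  simp only [zero_mul, add_zero, det_one, norm_one, one_mul] at h2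
  refine h2.congr' ?_
  filter_upwards [eventually_ne_zero_of_cobounded hz, eventually_det_basisMat_ne_zero hz hτ n hc]
    with a ha h3
  rw [gramMat_factor n h3, det_mul, det_mul, det_conjTranspose, norm_mul, norm_mul, norm_star,
    mul_right_comm, ← norm_mul, det_basisMat n ha, norm_mul, norm_mul, norm_pow]
  have : ‖z a‖ ≠ 0 := norm_ne_zero_iff.2 ha
  simp only [Function.comp_apply]
  field_simp

/-- Far away the wave has the height of the background. -/
theorem tendsto_wave : Tendsto (fun a => wave n c (z a) (τ a)) l (𝓝 (c * (-1) ^ n)) := by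
  have hC := tendsto_inv_basisMat_mul hz hτ n hc
  set σ : ℕ → Fin n → ℂ := fun i p => (-1) ^ ((p : ℕ) + i + 1)
  -- In terms of `C = E⁻¹T` the factor `E` cancels from `g†N⁻¹f`, so the wave is a function of `C`
  -- alone, continuous at `C = 0`.
  have hcont : ContinuousAt (fun C : Matrix (Fin n) (Fin n) ℂ =>
      (c : ℂ) * (1 + 2 * gramForm (1 + C * Cᴴ)⁻¹ (σ 0 + C *ᵥ σ n) (1 + C *ᵥ 1))) 0 := by
    have h1 : ContinuousAt (fun C : Matrix (Fin n) (Fin n) ℂ => (1 + C * Cᴴ)⁻¹) 0 := by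
      refine ContinuousAt.comp (f := fun C : Matrix (Fin n) (Fin n) ℂ => 1 + C * Cᴴ) (g := Inv.inv)
        (continuousAt_matrix_inv _ ?_) (by fun_prop)
      have : (1 + (0 : Matrix (Fin n) (Fin n) ℂ) * 0ᴴ).det = ((1 : ℂˣ) : ℂ) := by simp
      rw [this]
      exact NormedRing.inverse_continuousAt 1
    have h2 : ContinuousAt (fun C : Matrix (Fin n) (Fin n) ℂ => σ 0 + C *ᵥ σ n) 0 :=
      (continuous_const.add (Continuous.matrix_mulVec continuous_id continuous_const)).continuousAt
    have h3 : ContinuousAt (fun C : Matrix (Fin n) (Fin n) ℂ => 1 + C *ᵥ (1 : Fin n → ℂ)) 0 :=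
      (continuous_const.add (Continuous.matrix_mulVec continuous_id continuous_const)).continuousAt
    have h4 : Continuous fun q : (Fin n → ℂ) × Matrix (Fin n) (Fin n) ℂ × (Fin n → ℂ) =>
        (c : ℂ) * (1 + 2 * gramForm q.2.1 q.1 q.2.2) := by
      unfold gramForm
      refine continuous_const.mul (continuous_const.add (continuous_const.mul ?_))
      exact Continuous.dotProduct (continuous_star.comp continuous_fst)
        (Continuous.matrix_mulVec (continuous_fst.comp continuous_snd)
          (continuous_snd.comp continuous_snd))
    exact ContinuousAt.comp (f := fun C : Matrix (Fin n) (Fin n) ℂ =>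
      (σ 0 + C *ᵥ σ n, (1 + C * Cᴴ)⁻¹, 1 + C *ᵥ (1 : Fin n → ℂ))) h4.continuousAt
      (h2.prodMk (h1.prodMk h3))
  have h1 := hcont.tendsto.comp hC
  have hlim : (c : ℂ) * (1 + 2 * gramForm (1 + (0 : Matrix (Fin n) (Fin n) ℂ) * 0ᴴ)⁻¹
      (σ 0 + (0 : Matrix (Fin n) (Fin n) ℂ) *ᵥ σ n) (1 + (0 : Matrix (Fin n) (Fin n) ℂ) *ᵥ 1)) =
      c * (-1) ^ n := by
    have hs : star (σ 0) ⬝ᵥ (1 : Fin n → ℂ) = ∑ p ∈ Finset.range n, (-1) ^ (p + 1) := by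
      rw [← Fin.sum_univ_eq_sum_range (fun p => (-1 : ℂ) ^ (p + 1)), dotProduct]
      simp [σ]
    -- At `C = 0` only the alternating sum of the signs of `g` against those of `f` is left.
    have hsum : ∀ n : ℕ, 1 + 2 * ∑ p ∈ Finset.range n, (-1 : ℂ) ^ (p + 1) = (-1) ^ n := by
      intro n
      induction n with
      | zero => simp
      | succ n ih => rw [Finset.sum_range_succ, mul_add, ← add_assoc, ih, pow_succ]; ring
    simp only [zero_mul, add_zero, inv_one, zero_mulVec, gramForm, one_mulVec, hs, hsum]
  rw [hlim] at h1
  refine h1.congr' ?_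
  filter_upwards [eventually_det_basisMat_ne_zero hz hτ n hc] with a h3
  have hb : IsUnit (basisMat n c (z a) (τ a) 0).det := h3.isUnit
  have hb' : IsUnit ((basisMat n c (z a) (τ a) 0)ᴴ).det := by
    rw [det_conjTranspose]; exact (star_ne_zero.2 h3).isUnit
  have hN := gramMat_factor n h3
  have hf := trunc_fSeries n hc (z a) (τ a)
  have hg := trunc_gSeries n hc (z a) (τ a)
  simp only [Function.comp_apply]
  generalize basisMat n c (z a) (τ a) 0 = E at *
  generalize basisMat n c (z a) (τ a) n = T at *
  have hT : ∀ v, T *ᵥ v = E *ᵥ ((E⁻¹ * T) *ᵥ v) := fun v => by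
    rw [mulVec_mulVec, ← mul_assoc, mul_nonsing_inv _ hb, one_mul]
  rw [wave, hN, hf, hg, hT, hT, ← mulVec_add, ← mulVec_add, gramForm, gramForm, Matrix.mul_inv_rev,
    Matrix.mul_inv_rev, star_mulVec, dotProduct_mulVec _ _ (E *ᵥ _), vecMul_vecMul,
    ← mul_assoc, mul_nonsing_inv _ hb', one_mul, ← dotProduct_mulVec, mulVec_mulVec,
    Matrix.mul_assoc _ E⁻¹ E, nonsing_inv_mul _ hb, mul_one]

end

/-! ## Infinity in the plane -/

section Infinity

variable (a : ℝ) {c : ℝ} (hc : c ≠ 0)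
include hc

/-- Since `c ≠ 0`, the imaginary part `2ct` of `z` controls `t`, and the real part `x - 2at` then
controls `x`. Hence `z → ∞` and `t = O(|z|)` at infinity in the plane. -/
theorem norm_le_coordinate (p : ℝ × ℝ) : |p.2| ≤ (2 * |c|)⁻¹ *
    ‖(p.1 - 2 * a * p.2 + 2 * I * c * p.2 : ℂ)‖ ∧
    |p.1| ≤ (1 + |a| * |c|⁻¹) * ‖(p.1 - 2 * a * p.2 + 2 * I * c * p.2 : ℂ)‖ := by
  have hc' : 0 < |c| := abs_pos.2 hc
  have him := abs_im_le_norm (p.1 - 2 * a * p.2 + 2 * I * c * p.2 : ℂ)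
  have hre := abs_re_le_norm (p.1 - 2 * a * p.2 + 2 * I * c * p.2 : ℂ)
  have e1 : (p.1 - 2 * a * p.2 + 2 * I * c * p.2 : ℂ).im = 2 * c * p.2 := by simp
  have e2 : (p.1 - 2 * a * p.2 + 2 * I * c * p.2 : ℂ).re = p.1 - 2 * a * p.2 := by simp
  rw [e1] at him
  rw [e2] at hre
  set r := ‖(p.1 - 2 * a * p.2 + 2 * I * c * p.2 : ℂ)‖
  rw [abs_mul, abs_mul, abs_two] at him
  have h1 : |p.2| ≤ (2 * |c|)⁻¹ * r := by
    rw [inv_mul_eq_div, le_div_iff₀ (by positivity)]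
    linarith
  refine ⟨h1, ?_⟩
  have h2 : |p.1| ≤ |p.1 - 2 * a * p.2| + 2 * |a| * |p.2| := by
    calc |p.1| = |(p.1 - 2 * a * p.2) + 2 * a * p.2| := by ring_nf
      _ ≤ |p.1 - 2 * a * p.2| + |2 * a * p.2| := abs_add_le _ _
      _ = _ := by rw [abs_mul, abs_mul, abs_two]
  calc |p.1| ≤ r + 2 * |a| * ((2 * |c|)⁻¹ * r) := h2.trans (by gcongr)
    _ = (1 + |a| * |c|⁻¹) * r := by field_simp

theorem tendsto_coordinate : Tendsto (fun p : ℝ × ℝ => (p.1 - 2 * a * p.2 + 2 * I * c * p.2 : ℂ))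
    (cocompact (ℝ × ℝ)) (Bornology.cobounded ℂ) := by
  rw [← tendsto_norm_atTop_iff_cobounded]
  have h : Tendsto (fun p : ℝ × ℝ => ‖p‖) (cocompact (ℝ × ℝ)) atTop := tendsto_norm_cocompact_atTop
  set M := max (2 * |c|)⁻¹ (1 + |a| * |c|⁻¹)
  have hM : 0 < M := lt_max_of_lt_right (by positivity)
  refine tendsto_atTop_mono (fun p => ?_) (h.const_mul_atTop (inv_pos.2 hM))
  rw [inv_mul_le_iff₀ hM]
  have hp := norm_le_coordinate a hc p
  refine max_le (hp.2.trans ?_) (hp.1.trans ?_)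
  · gcongr; exact le_max_right _ _
  · gcongr; exact le_max_left _ _

theorem tendsto_time : Tendsto (fun p : ℝ × ℝ => (p.2 : ℂ) *
    (p.1 - 2 * a * p.2 + 2 * I * c * p.2 : ℂ) ^ (-3 : ℤ)) (cocompact (ℝ × ℝ)) (𝓝 0) := by
  have hz := tendsto_coordinate a hc
  have h := ((tendsto_zpow_of_neg hz (m := -2) (by norm_num)).norm).const_mul (2 * |c|)⁻¹
  rw [norm_zero, mul_zero] at h
  refine squeeze_zero_norm' ?_ h
  filter_upwards [eventually_ne_zero_of_cobounded hz] with p hp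
  have h1 := (norm_le_coordinate a hc p).1
  rw [norm_mul, norm_real, Real.norm_eq_abs, norm_zpow, norm_zpow]
  set r := ‖(p.1 - 2 * a * p.2 + 2 * I * c * p.2 : ℂ)‖
  have hr : r ≠ 0 := norm_ne_zero_iff.2 hp
  calc |p.2| * r ^ (-3 : ℤ) ≤ (2 * |c|)⁻¹ * r * r ^ (-3 : ℤ) := by gcongr
    _ = (2 * |c|)⁻¹ * r ^ (-2 : ℤ) := by
      rw [mul_assoc, ← zpow_one_add₀ hr]; norm_num

theorem tendsto_norm_waveFun (n : ℕ) :
    Tendsto (fun p => ‖(waveFun n a c : ℝ × ℝ → ℂ) p‖) (cocompact (ℝ × ℝ)) (𝓝 |c|) := by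
  have h := (tendsto_wave (tendsto_coordinate a hc) (tendsto_time a hc) n hc).norm
  simp only [norm_mul, norm_pow, norm_neg, norm_one, one_pow, mul_one, norm_real,
    Real.norm_eq_abs] at h
  exact h.congr fun p => by rw [waveFun_apply n a hc]

end Infinity

end Localization

end

end Manakov

namespace Manakov

noncomputable section

/-! ### Degrees of polynomials from their growth along rays. -/

section Degree

open MvPolynomial

theorem natDegree_eq_of_tendsto {p : Polynomial ℝ} {N : ℕ} {L : ℝ} (hL : L ≠ 0)
    (h : Tendsto (fun s => p.eval s / s ^ N) atTop (𝓝 L)) : p.natDegree = N := by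
  have hX : ∀ s : ℝ, (Polynomial.X ^ N : Polynomial ℝ).eval s = s ^ N := by simp
  have hd : (Polynomial.X ^ N : Polynomial ℝ).degree = N := by simp
  refine Polynomial.natDegree_eq_of_degree_eq_some ?_
  rcases lt_trichotomy p.degree N with h1 | h1 | h1
  · have h2 := p.div_tendsto_atTop_zero_of_degree_lt (Polynomial.X ^ N) (by rwa [hd])
    simp only [hX] at h2
    exact absurd (tendsto_nhds_unique h h2) hL
  · exact h1
  · have h2 := p.abs_div_tendsto_atTop_atTop_of_degree_gt (Polynomial.X ^ N) (by rwa [hd]) (by simp)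
    simp only [hX] at h2
    exact absurd h.abs (not_tendsto_nhds_of_tendsto_atTop h2 _)

theorem eval_smul_of_isHomogeneous {φ : MvPolynomial (Fin 2) ℝ} {d : ℕ} (hφ : φ.IsHomogeneous d)
    (s x t : ℝ) : eval ![s * x, s * t] φ = eval ![x, t] φ * s ^ d := by
  rw [eval_eq', eval_eq', Finset.sum_mul]
  refine Finset.sum_congr rfl fun m hm => ?_
  have h : m 0 + m 1 = d := by
    have := hφ (mem_support_iff.1 hm)
    rw [Finsupp.weight_apply, Finsupp.sum_fintype _ _ (by simp)] at this
    simpa [Fin.sum_univ_two] using this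
  rw [← h]
  simp only [Fin.prod_univ_two, Matrix.cons_val_zero, Matrix.cons_val_one, mul_pow, pow_add]
  ring

theorem homogeneousComponent_totalDegree_ne_zero {φ : MvPolynomial (Fin 2) ℝ} (hφ : φ ≠ 0) :
    homogeneousComponent φ.totalDegree φ ≠ 0 := by
  obtain ⟨m, hm, hd⟩ := Finset.exists_mem_eq_sup φ.support (support_nonempty.2 hφ)
    (fun s => s.sum fun _ e => e)
  intro h
  have h1 := congrArg (coeff m) h
  rw [coeff_homogeneousComponent, if_pos, coeff_zero] at h1
  · exact mem_support_iff.1 hm h1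
  · rw [totalDegree, hd]; rfl

/-- The degree of a polynomial in two variables can be read off from its growth along rays. -/
theorem totalDegree_eq_of_tendsto {H : MvPolynomial (Fin 2) ℝ} {N : ℕ}
    (h : ∀ x t : ℝ, x ≠ 0 → ∃ L ≠ 0,
      Tendsto (fun s : ℝ => eval ![s * x, s * t] H / s ^ N) atTop (𝓝 L)) :
    H.totalDegree = N ∧ (aeval ![Polynomial.X, 0] H : Polynomial ℝ).natDegree = N := by
  have h0 : (aeval ![Polynomial.X, 0] H : Polynomial ℝ).natDegree = N := by
    obtain ⟨L, hL, h1⟩ := h 1 0 one_ne_zero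
    refine natDegree_eq_of_tendsto hL (h1.congr fun s => ?_)
    congr 1
    have h2 : (Polynomial.evalRingHom s).comp
        (aeval ![Polynomial.X, 0] : MvPolynomial (Fin 2) ℝ →ₐ[ℝ] Polynomial ℝ).toRingHom =
        eval ![s * 1, s * 0] := by
      refine ringHom_ext (by simp) fun i => ?_
      fin_cases i <;> simp
    exact (congrArg (fun r => r H) h2).symm
  refine ⟨le_antisymm ?_ ?_, h0⟩
  · have hH : H ≠ 0 := by
      rintro rfl
      obtain ⟨L, hL, h1⟩ := h 1 0 one_ne_zero
      simp only [map_zero, zero_div] at h1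
      exact hL (tendsto_nhds_unique h1 tendsto_const_nhds)
    -- The growth is known only along rays with `x ≠ 0`; such directions are still Zariski dense, so
    -- one of them detects the top homogeneous component.
    obtain ⟨v, hv, hev⟩ : ∃ v : Fin 2 → ℝ, v 0 ≠ 0 ∧
        eval v (homogeneousComponent H.totalDegree H) ≠ 0 := by
      by_contra! hcon
      refine homogeneousComponent_totalDegree_ne_zero hH
        (funext_set (fun _ => {0}ᶜ) (fun _ => (Set.finite_singleton (0 : ℝ)).infinite_compl)
          fun v hv => ?_)
      rw [map_zero]
      exact hcon v (hv 0 (Set.mem_univ _))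
    have hv' : v = ![v 0, v 1] := by ext i; fin_cases i <;> rfl
    rw [hv'] at hev
    obtain ⟨L, hL, h1⟩ := h (v 0) (v 1) hv
    set ψ : Polynomial ℝ := ∑ i ∈ Finset.range (H.totalDegree + 1),
      Polynomial.C (eval ![v 0, v 1] (homogeneousComponent i H)) * Polynomial.X ^ i
    have hψ : ∀ s : ℝ, ψ.eval s = eval ![s * v 0, s * v 1] H := by
      intro s
      conv_rhs => rw [← sum_homogeneousComponent H]
      simp only [ψ, map_sum, Polynomial.eval_finsetSum, Polynomial.eval_mul, Polynomial.eval_C,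
        Polynomial.eval_pow, Polynomial.eval_X,
        eval_smul_of_isHomogeneous (homogeneousComponent_isHomogeneous _ H)]
    have h2 : ψ.natDegree = N := natDegree_eq_of_tendsto hL (by simpa only [hψ] using h1)
    rw [← h2]
    refine Polynomial.le_natDegree_of_ne_zero ?_
    simp only [ψ, Polynomial.finsetSum_coeff, Polynomial.coeff_C_mul_X_pow]
    rw [Finset.sum_ite_eq, if_pos (by simp)]
    exact hev
  · rw [← h0]
    have := MvPolynomial.aeval_natDegree_le H le_rfl ![Polynomial.X, 0] (n := 1)
      (fun i => by fin_cases i <;> simp)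
    simpa using this

end Degree

/-! ## Multiplicities -/

section Multiplicity

variable {S : Type*} [CommRing S] [Algebra ℂ S] (δ : Derivation ℂ S S)

/-- The extra factor `D` on the left avoids the exponent `k - 1`, so that `k = 0` needs no separate
treatment later; the second-order version uses `D²` likewise. -/
theorem mul_derivation_pow_mul (D h : S) (k : ℕ) :
    D * δ (D ^ k * h) = D ^ k * (k * δ D * h + D * δ h) := by
  rw [Derivation.leibniz, Derivation.leibniz_pow]
  rcases k with _ | k
  · simp
  · simp only [smul_eq_mul, nsmul_eq_mul, Nat.add_sub_cancel, pow_succ]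
    ring

theorem sq_mul_derivation_derivation_pow_mul (D h : S) (k : ℕ) :
    D ^ 2 * δ (δ (D ^ k * h)) = D ^ k * ((k * (k - 1) : ℂ) • (δ D ^ 2 * h)
      + D * (k * δ (δ D) * h + 2 * k * δ D * δ h + D * δ (δ h))) := by
  have h1 := mul_derivation_pow_mul δ D h k
  have h2 := congrArg δ h1
  have h3 := mul_derivation_pow_mul δ D (k * δ D * h + D * δ h) k
  rw [← h2] at h3
  have hk : δ (k : S) = 0 := δ.map_natCast k
  simp only [Derivation.leibniz, map_add, smul_eq_mul, hk, Algebra.smul_def, map_mul, map_sub,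
    map_natCast, map_one] at h1 h2 h3 ⊢
  linear_combination h3 - δ D * h1

variable [IsDomain S]

/-- Extracts integer relations between multiplicities: a lowest-order coefficient prime to `D` can
be cancelled only if its numerical factor is zero. -/
theorem natCast_eq_of_dvd {D x y : S} {r : ℂ} (hD : Prime D) (hx : ¬D ∣ x)
    (h : D ∣ r • x + D * y) : r = 0 := by
  by_contra hr
  rw [dvd_add_left (dvd_mul_right _ _)] at h
  refine hx ?_
  have := h.mul_left (algebraMap ℂ S r⁻¹)
  rwa [← Algebra.smul_def, smul_smul, inv_mul_cancel₀ hr, one_smul] at this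

/-- The multiplicities of a prime in a pair of polynomials that satisfy a bilinear Schrödinger
equation. -/
theorem multiplicity_bilinear {Dx Dt : Derivation ℂ S S} {D p h : S} {j k : ℕ} (hD : Prime D)
    (hDx : ¬D ∣ Dx D) (hp : ¬D ∣ p) (hh : ¬D ∣ h) {i : ℂ}
    (hb : algebraMap ℂ S i * (Dt (D ^ j * p) * (D ^ k * h) - D ^ j * p * Dt (D ^ k * h))
      + Dx (Dx (D ^ j * p)) * (D ^ k * h) - 2 * (Dx (D ^ j * p) * Dx (D ^ k * h))
      + D ^ j * p * Dx (Dx (D ^ k * h)) = 0) :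
    ((j : ℤ) - k) ^ 2 = j + k := by
  have ht1 := mul_derivation_pow_mul Dt D p j
  have ht2 := mul_derivation_pow_mul Dt D h k
  have hx1 := mul_derivation_pow_mul Dx D p j
  have hx2 := mul_derivation_pow_mul Dx D h k
  have hxx1 := sq_mul_derivation_derivation_pow_mul Dx D p j
  have hxx2 := sq_mul_derivation_derivation_pow_mul Dx D h k
  generalize Dt (D ^ j * p) = a1 at *
  generalize Dt (D ^ k * h) = a2 at *
  generalize Dx (Dx (D ^ j * p)) = a3 at *
  generalize Dx (Dx (D ^ k * h)) = a4 at *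
  generalize Dx (D ^ j * p) = a5 at *
  generalize Dx (D ^ k * h) = a6 at *
  have hne : D ^ (j + k) ≠ 0 := pow_ne_zero _ hD.ne_zero
  -- The lowest-order part in `D` of the second-order terms has coefficient `j(j - 1) + k(k - 1) -
  -- 2jk = (j - k)² - (j + k)`; the time derivatives contribute only to `y`.
  obtain ⟨y, hy⟩ : ∃ y, (((j : ℂ) - k) ^ 2 - (j + k)) • (Dx D ^ 2 * (h * p)) + D * y = 0 := by
    refine ⟨algebraMap ℂ S i * ((j * Dt D * p + D * Dt p) * h - p * (k * Dt D * h + D * Dt h))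
        + (j * Dx (Dx D) * p + 2 * j * Dx D * Dx p + D * Dx (Dx p)) * h
        + (k * Dx (Dx D) * h + 2 * k * Dx D * Dx h + D * Dx (Dx h)) * p
        - 2 * (j * Dx D * p * Dx h + Dx p * k * Dx D * h + D * Dx p * Dx h),
      mul_left_cancel₀ hne ?_⟩
    rw [mul_zero, pow_add]
    simp only [Algebra.smul_def, map_mul, map_sub, map_add, map_pow, map_natCast, map_one] at *
    linear_combination D ^ 2 * hb - algebraMap ℂ S i * D * (ht1 * D ^ k * h - ht2 * D ^ j * p)
      - hxx1 * D ^ k * h - hxx2 * D ^ j * p + 2 * hx1 * (D * a6)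
      + 2 * hx2 * (D ^ j * (j * Dx D * p + D * Dx p))
  have h0 := natCast_eq_of_dvd hD (x := Dx D ^ 2 * (h * p)) (y := y)
    (fun hdvd => (hD.dvd_or_dvd hdvd).elim (fun h1 => hDx (hD.dvd_of_dvd_pow h1))
      fun h1 => (hD.dvd_or_dvd h1).elim hh hp) (hy ▸ dvd_zero _)
  have : ((((j : ℤ) - k) ^ 2 : ℤ) : ℂ) = ((j + k : ℤ) : ℂ) := by
    push_cast
    linear_combination h0
  exact_mod_cast this

/-- On the right side the order is exactly `2k - 2`: the lowest-order coefficient is `k(k - 1) - k²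
= -k`, which is nonzero. -/
theorem multiplicity_logDeriv {Dx : Derivation ℂ S S} {D p q h : S} {j k l : ℕ} (hD : Prime D)
    (hDx : ¬D ∣ Dx D) (hp : ¬D ∣ p) (hq : ¬D ∣ q) (hh : ¬D ∣ h) (hk : k ≠ 0) {r : S}
    (hb : D ^ j * p * (D ^ l * q) = r * (D ^ k * h) ^ 2 + D ^ k * h * Dx (Dx (D ^ k * h))
      - Dx (D ^ k * h) ^ 2) : j + l + 2 = 2 * k := by
  have hx2 := mul_derivation_pow_mul Dx D h k
  have hxx2 := sq_mul_derivation_derivation_pow_mul Dx D h k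
  generalize Dx (Dx (D ^ k * h)) = a4 at *
  generalize Dx (D ^ k * h) = a6 at *
  obtain ⟨y, hy⟩ : ∃ y, D ^ (j + l + 2) * (p * q) =
      D ^ (2 * k) * ((-(k : ℂ)) • (Dx D ^ 2 * (h * h)) + D * y) := by
    refine ⟨r * D * h ^ 2 + h * (k * Dx (Dx D) * h + 2 * k * Dx D * Dx h + D * Dx (Dx h))
        - 2 * k * Dx D * h * Dx h - D * Dx h ^ 2, ?_⟩
    rw [two_mul, pow_add, pow_add, pow_add]
    simp only [Algebra.smul_def, map_mul, map_sub, map_neg, map_natCast, map_one] at *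
    linear_combination D ^ 2 * hb + D ^ k * h * hxx2
      - (D * a6 + D ^ k * (k * Dx D * h + D * Dx h)) * hx2
  have hm : ¬D ∣ (-(k : ℂ)) • (Dx D ^ 2 * (h * h)) + D * y := fun hdvd => by
    have h0 := natCast_eq_of_dvd hD (x := Dx D ^ 2 * (h * h)) (y := y)
      (fun hdvd => (hD.dvd_or_dvd hdvd).elim (fun h1 => hDx (hD.dvd_of_dvd_pow h1))
        fun h1 => (hD.dvd_or_dvd h1).elim hh hh) hdvd
    simp [hk] at h0
  have hpq : ¬D ∣ p * q := fun hdvd => (hD.dvd_or_dvd hdvd).elim hp hq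
  have h1 : D ^ (j + l + 2) ∣ D ^ (2 * k) :=
    hD.pow_dvd_of_dvd_mul_right _ hm (hy ▸ dvd_mul_right _ _)
  have h2 : D ^ (2 * k) ∣ D ^ (j + l + 2) :=
    hD.pow_dvd_of_dvd_mul_right _ hpq (hy ▸ dvd_mul_right _ _)
  exact le_antisymm ((pow_dvd_pow_iff hD.ne_zero hD.not_isUnit).1 h1)
    ((pow_dvd_pow_iff hD.ne_zero hD.not_isUnit).1 h2)

/-- Solutions of the bilinear equations have no common factor. -/
theorem not_dvd_of_bilinear [WfDvdMonoid S] {Dx Dt : Derivation ℂ S S} {D P Q H : S} (hD : Prime D)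
    (hDx : ¬D ∣ Dx D) (hP0 : P ≠ 0) (hQ0 : Q ≠ 0) (hH0 : H ≠ 0) {i i' : ℂ} {r : S}
    (hP : algebraMap ℂ S i * (Dt P * H - P * Dt H) + Dx (Dx P) * H - 2 * (Dx P * Dx H)
      + P * Dx (Dx H) = 0)
    (hQ : algebraMap ℂ S i' * (Dt Q * H - Q * Dt H) + Dx (Dx Q) * H - 2 * (Dx Q * Dx H)
      + Q * Dx (Dx H) = 0)
    (hPQ : P * Q = r * H ^ 2 + H * Dx (Dx H) - Dx H ^ 2) (hDP : D ∣ P) : ¬D ∣ H := by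
  intro hDH
  obtain ⟨j, p, hp, rfl⟩ := WfDvdMonoid.max_power_factor hP0 hD.irreducible
  obtain ⟨l, q, hq, rfl⟩ := WfDvdMonoid.max_power_factor hQ0 hD.irreducible
  obtain ⟨k, h, hh, rfl⟩ := WfDvdMonoid.max_power_factor hH0 hD.irreducible
  have hk : k ≠ 0 := by
    rintro rfl
    exact hh (by simpa using hDH)
  have hj : j ≠ 0 := by
    rintro rfl
    exact hp (by simpa using hDP)
  have h1 := multiplicity_bilinear hD hDx hp hh hP
  have h2 := multiplicity_bilinear hD hDx hq hh hQ
  have h3 := multiplicity_logDeriv hD hDx hp hq hh hk hPQ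
  have h3' : (j : ℤ) + l + 2 = 2 * k := by exact_mod_cast h3
  have hl : (l : ℤ) = 2 * k - 2 - j := by linarith
  -- Substituting `l = 2k - 2 - j` and subtracting the two quadratic relations gives `j = k - 1`;
  -- then `k = 1` and `j = 0`, which is excluded.
  rw [hl] at h2
  have h4 : (j : ℤ) = k - 1 := by nlinarith
  rw [h4] at h1
  have h5 : (k : ℤ) = 1 := by nlinarith
  omega

end Multiplicity

end

end Manakov

namespace Manakov

noncomputable section

/-! ### Numerator and denominator of the wave as polynomials in `x`, `t`. -/

section Polynomial

open MvPolynomial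

/-- The coordinate `x`. -/
def xFun : smoothFun :=
  ⟨fun p => (p.1 : ℂ), by
    have h : ContDiff ℝ ∞ fun p : ℝ × ℝ => (p.1 : ℂ) := ofRealCLM.contDiff.comp contDiff_fst
    exact h⟩

theorem dirDeriv_xFun (v : ℝ × ℝ) : dirDeriv v xFun = algebraMap ℂ smoothFun v.1 := by
  ext p
  have h : HasFDerivAt (fun p : ℝ × ℝ => (p.1 : ℂ)) (ofRealCLM.comp (ContinuousLinearMap.fst ℝ ℝ ℝ)) p :=
    (ofRealCLM.comp (ContinuousLinearMap.fst ℝ ℝ ℝ)).hasFDerivAt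
  exact congrArg (fun L => L v) h.fderiv

/-- Polynomials as smooth functions. -/
def polyHom : MvPolynomial (Fin 2) ℂ →ₐ[ℂ] smoothFun := aeval ![xFun, tFun]

theorem polyHom_apply (p : MvPolynomial (Fin 2) ℂ) (x t : ℝ) :
    (polyHom p : ℝ × ℝ → ℂ) (x, t) = eval ![(x : ℂ), (t : ℂ)] p := by
  rw [← evalAt_apply]
  have h : ((evalAt (x, t)).comp polyHom) = aeval ![(x : ℂ), (t : ℂ)] := by
    refine algHom_ext fun i => ?_
    fin_cases i <;> simp [polyHom, evalAt_apply, xFun, tFun]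
  rw [← coe_aeval_eq_eval]
  exact congrArg (fun r => r p) h

/-- A complex polynomial that vanishes at all real points is zero. Identities between smooth
functions can therefore be pulled back to polynomials. -/
theorem polyHom_injective : Function.Injective polyHom := by
  intro p q h
  refine funext_set (fun _ => Set.range ofReal) (fun _ => Set.infinite_range_of_injective
    ofReal_injective) fun v hv => ?_
  obtain ⟨x, hx⟩ := hv 0 (Set.mem_univ _)
  obtain ⟨t, ht⟩ := hv 1 (Set.mem_univ _)
  have hv' : v = ![(x : ℂ), (t : ℂ)] := by
    ext i; fin_cases i
    · exact hx.symm
    · exact ht.symm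
  rw [hv', ← polyHom_apply, ← polyHom_apply, h]

theorem star_polyHom (p : MvPolynomial (Fin 2) ℂ) :
    star (polyHom p) = polyHom (map (starRingEnd ℂ) p) := by
  have hX : ∀ i, star (![xFun, tFun] i) = ![xFun, tFun] i := by
    intro i
    fin_cases i <;> ext p <;> exact conj_ofReal _
  induction p using MvPolynomial.induction_on with
  | C r =>
    rw [map_C]
    simp only [polyHom, aeval_C]
    exact (algebraMap_star_comm r).symm
  | add p q hp hq => rw [map_add, star_add, hp, hq, map_add, map_add]
  | mul_X p i hp =>
    rw [map_mul, star_mul', hp, map_mul, map_mul, map_X]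
    congr 1
    rw [polyHom, aeval_X, hX]

/-- The derivative of polynomials in direction `v`. -/
def polyDeriv (v : ℝ × ℝ) : Derivation ℂ (MvPolynomial (Fin 2) ℂ) (MvPolynomial (Fin 2) ℂ) :=
  (v.1 : ℂ) • pderiv 0 + (v.2 : ℂ) • pderiv 1

theorem dirDeriv_polyHom (v : ℝ × ℝ) (p : MvPolynomial (Fin 2) ℂ) :
    dirDeriv v (polyHom p) = polyHom (polyDeriv v p) := by
  induction p using MvPolynomial.induction_on with
  | C r =>
    have h : polyDeriv v (C r) = 0 := (polyDeriv v).map_algebraMap r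
    rw [h, map_zero]
    simp only [polyHom, aeval_C]
    exact Derivation.map_algebraMap _ _
  | add p q hp hq => rw [map_add, map_add, hp, hq, map_add, map_add]
  | mul_X p i hp =>
    have hX : dirDeriv v (polyHom (X i)) = polyHom (polyDeriv v (X i)) := by
      fin_cases i <;>
      simp [polyHom, polyDeriv, dirDeriv_xFun, dirDeriv_tFun, Algebra.smul_def]
    rw [map_mul, Derivation.leibniz, Derivation.leibniz, hp, hX, map_add, smul_eq_mul, smul_eq_mul,
      smul_eq_mul, smul_eq_mul, map_mul, map_mul]

theorem star_mem_range_polyHom {F : smoothFun} (hF : F ∈ polyHom.range) :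
    star F ∈ polyHom.range := by
  obtain ⟨p, rfl⟩ := hF
  exact ⟨_, (star_polyHom p).symm⟩

theorem zFun_mem (a c : ℝ) : zFun a c ∈ polyHom.range := by
  refine ⟨X 0 + C (-2 * a + 2 * I * c) * X 1, ?_⟩
  ext ⟨x, t⟩
  have := polyHom_apply (X 0 + C (-2 * a + 2 * I * c) * X 1) x t
  refine this.trans ?_
  simp only [map_add, map_mul, eval_X, eval_C, Matrix.cons_val_zero, Matrix.cons_val_one, zFun]
  ring

theorem tFun_mem : tFun ∈ polyHom.range := ⟨X 1, by simp [polyHom]⟩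

section

variable (n : ℕ) (a c : ℝ)

section Subalgebra

variable {R : Type*} [CommRing R] [Algebra ℂ R] {S : Subalgebra ℂ R} {z τ : R} (hz : z ∈ S)
  (hτ : τ ∈ S)
include hz hτ

/-- By functoriality along the inclusion, the series can be formed over the subalgebra from the
start. -/
theorem coeff_sinhSeries_mem (k : ℕ) : PowerSeries.coeff k (sinhSeries c z τ) ∈ S := by
  have h := map_sinhSeries S.val c ⟨z, hz⟩ ⟨τ, hτ⟩
  rw [Subalgebra.val_apply, Subalgebra.val_apply] at h
  rw [← h, PowerSeries.coeff_map]
  exact Subtype.property _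

theorem coeff_gSeries_mem (k : ℕ) : PowerSeries.coeff k (gSeries c z τ) ∈ S := by
  have h := map_gSeries S.val c ⟨z, hz⟩ ⟨τ, hτ⟩
  rw [Subalgebra.val_apply, Subalgebra.val_apply] at h
  rw [← h, PowerSeries.coeff_map]
  exact Subtype.property _

theorem coeff_basisSeries_mem (p k : ℕ) : PowerSeries.coeff k (basisSeries c z τ p) ∈ S := by
  have h := map_basisSeries S.val c ⟨z, hz⟩ ⟨τ, hτ⟩ p
  rw [Subalgebra.val_apply, Subalgebra.val_apply] at h
  rw [← h, PowerSeries.coeff_map]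
  exact Subtype.property _

end Subalgebra

theorem trunc_fSeries_mem (k : Fin n) : trunc n (fSeries c (zFun a c) tFun) k ∈ polyHom.range :=
  coeff_sinhSeries_mem c (zFun_mem a c) tFun_mem k

theorem trunc_gSeries_mem (k : Fin n) : trunc n (gSeries c (zFun a c) tFun) k ∈ polyHom.range :=
  coeff_gSeries_mem c (zFun_mem a c) tFun_mem k

theorem trunc_basisSeries_mem (p : ℕ) (k : Fin n) :
    trunc n (basisSeries c (zFun a c) tFun p) k ∈ polyHom.range :=
  coeff_basisSeries_mem c (zFun_mem a c) tFun_mem p k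

theorem gramMat_mem (i j : Fin n) : gramMat n c (zFun a c) tFun i j ∈ polyHom.range := by
  simp only [gramMat, Matrix.sum_apply, Matrix.vecMulVec_apply, Pi.star_apply]
  exact sum_mem fun p _ => mul_mem (trunc_basisSeries_mem n a c p i)
    (star_mem_range_polyHom (trunc_basisSeries_mem n a c p j))

theorem det_mem {R : Type*} [CommRing R] [Algebra ℂ R] {S : Subalgebra ℂ R}
    {M : Matrix (Fin n) (Fin n) R} (h : ∀ i j, M i j ∈ S) :
    M.det ∈ S ∧ ∀ i j, M.adjugate i j ∈ S := by
  set M' : Matrix (Fin n) (Fin n) S := Matrix.of fun i j => ⟨M i j, h i j⟩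
  have hM : M = M'.map S.val := rfl
  constructor
  · have := AlgHom.map_det S.val M'
    rw [AlgHom.mapMatrix_apply, ← hM] at this
    rw [← this]
    exact Subtype.property _
  · intro i j
    have := AlgHom.map_adjugate S.val M'
    rw [AlgHom.mapMatrix_apply, AlgHom.mapMatrix_apply, ← hM] at this
    rw [← this]
    exact Subtype.property _

open Matrix in
-- Multiplication by the determinant turns `N⁻¹` into the adjugate, whose entries are polynomials.
theorem waveFun_mul_det_mem (hc : c ≠ 0) :
    waveFun n a c * (gramMat n c (zFun a c) tFun).det ∈ polyHom.range := by
  have hu := isUnit_gramMat_det n a hc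
  obtain ⟨h1, h2⟩ := det_mem n (gramMat_mem n a c)
  have h3 : waveFun n a c * (gramMat n c (zFun a c) tFun).det =
      algebraMap ℂ smoothFun c * ((gramMat n c (zFun a c) tFun).det +
        2 * gramForm (gramMat n c (zFun a c) tFun).adjugate
          (trunc n (gSeries c (zFun a c) tFun)) (trunc n (fSeries c (zFun a c) tFun))) := by
    have h4 : (gramMat n c (zFun a c) tFun).adjugate =
        (gramMat n c (zFun a c) tFun).det • (gramMat n c (zFun a c) tFun)⁻¹ := by
      rw [Matrix.inv_def, smul_smul, Ring.mul_inverse_cancel _ hu, one_smul]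
    have h5 : ∀ (r : smoothFun) (G : Matrix (Fin n) (Fin n) smoothFun) (u v : Fin n → smoothFun),
        gramForm (r • G) u v = r * gramForm G u v := by
      intro r G u v
      rw [gramForm, gramForm, smul_mulVec, dotProduct_smul, smul_eq_mul]
    rw [h4, h5, waveFun]
    ring
  rw [h3]
  refine mul_mem (algebraMap_mem _ _) (add_mem h1 (mul_mem ?_ ?_))
  · exact ofNat_mem polyHom.range 2
  · rw [gramForm, dotProduct]
    refine sum_mem fun i _ => mul_mem (star_mem_range_polyHom (trunc_gSeries_mem n a c i)) ?_
    rw [mulVec, dotProduct]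
    exact sum_mem fun j _ => mul_mem (h2 i j) (trunc_fSeries_mem n a c j)

end

theorem mem_range_map_ofReal {p : MvPolynomial (Fin 2) ℂ} (hp : map (starRingEnd ℂ) p = p) :
    ∃ q : MvPolynomial (Fin 2) ℝ, map ofRealHom q = p := by
  rw [← Set.mem_range, mem_range_map_iff_coeffs_subset]
  intro r hr
  obtain ⟨m, _, rfl⟩ := mem_coeffs_iff.1 hr
  have := congrArg (coeff m) hp
  rw [coeff_map] at this
  exact ⟨_, conj_eq_iff_re.1 this⟩

theorem eval_map_ofReal (q : MvPolynomial (Fin 2) ℝ) (x t : ℝ) :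
    eval ![(x : ℂ), (t : ℂ)] (map ofRealHom q) = ((eval ![x, t] q : ℝ) : ℂ) := by
  have : ![(x : ℂ), (t : ℂ)] = ofRealHom ∘ ![x, t] := by ext i; fin_cases i <;> rfl
  rw [this, eval_map]
  exact eval₂_comp_left ofRealHom (RingHom.id ℝ) ![x, t] q |>.symm

open scoped ComplexOrder in
/-- The determinant of the Gram matrix, as a real polynomial. -/
theorem exists_denominator (n : ℕ) (a : ℝ) {c : ℝ} (hc : c ≠ 0) :
    ∃ H : MvPolynomial (Fin 2) ℝ,
      polyHom (map ofRealHom H) = (gramMat n c (zFun a c) tFun).det ∧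
      (∀ x t : ℝ, 0 < eval ![x, t] H) ∧
      ∀ x t : ℝ, ((eval ![x, t] H : ℝ) : ℂ) =
        (gramMat n c (x - 2 * a * t + 2 * I * c * t) t).det := by
  obtain ⟨p, hp⟩ := (det_mem n (gramMat_mem n a c)).1
  have hp' : polyHom p = (gramMat n c (zFun a c) tFun).det := hp
  obtain ⟨H, rfl⟩ := mem_range_map_ofReal (p := p) (polyHom_injective (by
    rw [← star_polyHom, hp', ← Matrix.det_conjTranspose, conjTranspose_gramMat]))
  have hev : ∀ x t : ℝ, ((eval ![x, t] H : ℝ) : ℂ) =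
      (gramMat n c (x - 2 * a * t + 2 * I * c * t) t).det := by
    intro x t
    rw [← eval_map_ofReal, ← polyHom_apply, hp', ← evalAt_apply, AlgHom.map_det,
      AlgHom.mapMatrix_apply, map_gramMat _ (evalAt_star _)]
    rfl
  refine ⟨H, hp', fun x t => ?_, hev⟩
  have := (posDef_gramMat n hc (x - 2 * a * t + 2 * I * c * t) t).det_pos
  rw [← hev] at this
  exact_mod_cast this

theorem tendsto_ray {x : ℝ} (hx : x ≠ 0) (t : ℝ) :
    Tendsto (fun s : ℝ => (s * x, s * t)) atTop (cocompact (ℝ × ℝ)) := by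
  rw [← Metric.cobounded_eq_cocompact, ← tendsto_norm_atTop_iff_cobounded]
  refine tendsto_atTop_mono (fun s => (?_ : |x| * s ≤ _))
    (tendsto_id.const_mul_atTop (abs_pos.2 hx))
  refine le_trans ?_ (le_max_left _ _)
  simp only [norm_mul, Real.norm_eq_abs]
  rw [mul_comm]
  gcongr
  exact le_abs_self s

/-- Along the ray `s ↦ (sx, st)` the coordinate `z` is multiplied by `s`, so `H / s^(n(n+1))` has a
nonzero limit by `tendsto_det_gramMat`. The restriction to the `x`-axis has the same degree, which
is needed in `not_dvd_pderiv`. -/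
theorem degree_denominator (n : ℕ) (a : ℝ) {c : ℝ} (hc : c ≠ 0) {H : MvPolynomial (Fin 2) ℝ}
    (hpos : ∀ x t : ℝ, 0 < eval ![x, t] H)
    (hH : ∀ x t : ℝ, ((eval ![x, t] H : ℝ) : ℂ) =
      (gramMat n c (x - 2 * a * t + 2 * I * c * t) t).det) :
    H.totalDegree = n * (n + 1) ∧
      (aeval ![Polynomial.X, 0] H : Polynomial ℝ).natDegree = n * (n + 1) := by
  refine totalDegree_eq_of_tendsto fun x t hx => ?_
  have h := (tendsto_det_gramMat (tendsto_coordinate a hc) (tendsto_time a hc) n hc).comp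
    (tendsto_ray hx t)
  set z : ℂ := x - 2 * a * t + 2 * I * c * t
  have hz : z ≠ 0 := by
    intro hz
    have hc' : (2 * c) * t = 0 := by simpa [z] using congrArg im hz
    have ht : t = 0 := by simpa [hc] using hc'
    have hr : x - 2 * a * t = 0 := by simpa [z] using congrArg re hz
    rw [ht] at hr
    exact hx (by linarith)
  have h2 := h.mul_const (‖z‖ ^ (n * (n + 1)))
  refine ⟨_, mul_ne_zero (pow_ne_zero 2 (norm_ne_zero_iff.2 (det_basisLead_ne_zero hc n)))
    (pow_ne_zero _ (norm_ne_zero_iff.2 hz)), h2.congr' ?_⟩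
  filter_upwards [eventually_gt_atTop 0] with s hs
  have h3 : ((s * x : ℝ) : ℂ) - 2 * a * (s * t : ℝ) + 2 * I * c * (s * t : ℝ) = s * z := by
    simp only [z]
    push_cast
    ring
  simp only [Function.comp_apply]
  rw [← hH, norm_real, Real.norm_eq_abs, abs_of_pos (hpos _ _), h3, norm_mul, mul_pow, norm_real,
    Real.norm_eq_abs, abs_of_pos hs]
  have : ‖z‖ ^ (n * (n + 1)) ≠ 0 := pow_ne_zero _ (norm_ne_zero_iff.2 hz)
  field_simp

theorem derivative_aeval_X_zero (F : MvPolynomial (Fin 2) ℂ) :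
    Polynomial.derivative (aeval ![Polynomial.X, 0] F : Polynomial ℂ) =
      aeval ![Polynomial.X, 0] (pderiv 0 F) := by
  induction F using MvPolynomial.induction_on with
  | C r => simp
  | add p q hp hq => rw [map_add, map_add, hp, hq, map_add, map_add]
  | mul_X p i hp =>
    have hX : Polynomial.derivative (aeval ![Polynomial.X, 0] (X i : MvPolynomial (Fin 2) ℂ) :
        Polynomial ℂ) = aeval ![Polynomial.X, 0] (pderiv 0 (X i : MvPolynomial (Fin 2) ℂ)) := by
      fin_cases i
      · simp
      · simp [pderiv_X]
    rw [map_mul, Polynomial.derivative_mul, hp, Derivation.leibniz, map_add, smul_eq_mul,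
      smul_eq_mul, map_mul, map_mul, hX]
    ring

/-- As `H` keeps its full degree on the `x`-axis, so does every factor `D`. An irreducible `D`
therefore depends on `x`, and `∂ₓD` is nonzero of smaller total degree than `D`. -/
theorem not_dvd_pderiv {N : ℕ} {H : MvPolynomial (Fin 2) ℂ} (hH : H ≠ 0) (hN : H.totalDegree ≤ N)
    (hN' : (aeval ![Polynomial.X, 0] H : Polynomial ℂ).natDegree = N)
    {D : MvPolynomial (Fin 2) ℂ} (hD : Irreducible D) (hDH : D ∣ H) : ¬D ∣ pderiv 0 D := by
  obtain ⟨E, rfl⟩ := hDH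
  have hD0 : D ≠ 0 := left_ne_zero_of_mul hH
  have hE0 : E ≠ 0 := right_ne_zero_of_mul hH
  have hpos : D.totalDegree ≠ 0 := fun h => by
    rw [totalDegree_eq_zero_iff_eq_C] at h
    refine hD.not_isUnit ?_
    rw [h] at hD0 ⊢
    exact (IsUnit.mk0 _ fun h0 => hD0 (by rw [h0, map_zero])).map C
  set φ : MvPolynomial (Fin 2) ℂ →ₐ[ℂ] Polynomial ℂ := aeval ![Polynomial.X, 0]
  have hle : ∀ F, (φ F).natDegree ≤ F.totalDegree := fun F => by
    have := MvPolynomial.aeval_natDegree_le F le_rfl ![Polynomial.X, 0] (n := 1)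
      (fun i => by fin_cases i <;> simp)
    simpa using this
  have hφD : (φ D).natDegree ≠ 0 := by
    have h1 := hle D
    have h2 := hle E
    rw [totalDegree_mul_of_isDomain hD0 hE0] at hN
    rw [map_mul] at hN'
    have h3 := Polynomial.natDegree_mul_le (p := φ D) (q := φ E)
    omega
  have hne : pderiv 0 D ≠ 0 := by
    intro h
    have h1 := derivative_aeval_X_zero D
    rw [h, map_zero] at h1
    exact hφD (Polynomial.natDegree_eq_zero_of_derivative_eq_zero h1)
  rintro ⟨F, hF⟩
  have hF0 : F ≠ 0 := by
    rintro rfl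
    exact hne (by rw [hF, mul_zero])
  have h1 : (pderiv 0 D).totalDegree < D.totalDegree := by
    refine (Finset.sup_lt_iff (Nat.pos_of_ne_zero hpos)).2 fun m hm => ?_
    have h2 : coeff (m + Finsupp.single 0 1) D ≠ 0 := by
      intro h0
      rw [mem_support_iff, coeff_pderiv, h0, zero_mul] at hm
      exact hm rfl
    have h3 := le_totalDegree (mem_support_iff.2 h2)
    rw [Finsupp.sum_add_index' (fun _ => rfl) (fun _ _ _ => rfl), Finsupp.sum_single_index rfl] at h3
    exact h3
  rw [hF, totalDegree_mul_of_isDomain hD0 hF0] at h1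
  omega

end Polynomial

end

end Manakov

namespace Manakov

noncomputable section

/-! ### Lowest terms and the shape of a rogue wave. -/

section Profile

open MvPolynomial

/-- The multiplicity argument is applied to `P`, its conjugate and `H`. As `H` is real, the equation
for the conjugate is the star of the one for `P`, with `-i` in place of `i`. -/
theorem exists_numerator (n : ℕ) (a : ℝ) {c : ℝ} (hc : c ≠ 0) {H : MvPolynomial (Fin 2) ℝ}
    (hH : polyHom (map ofRealHom H) = (gramMat n c (zFun a c) tFun).det)
    (hpos : ∀ x t : ℝ, 0 < eval ![x, t] H)
    (hdeg : H.totalDegree = n * (n + 1) ∧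
      (aeval ![Polynomial.X, 0] H : Polynomial ℝ).natDegree = n * (n + 1)) :
    ∃ P : MvPolynomial (Fin 2) ℂ, polyHom P = waveFun n a c * polyHom (map ofRealHom H) ∧
      ∀ D : MvPolynomial (Fin 2) ℂ, D ∣ P → D ∣ map ofRealHom H → IsUnit D := by
  obtain ⟨P, hP⟩ := waveFun_mul_det_mem n a c hc
  have hP : polyHom P = waveFun n a c * polyHom (map ofRealHom H) := by rw [hH]; exact hP
  have hH0 : map ofRealHom H ≠ 0 := by
    intro h
    have h1 := eval_map_ofReal H 0 0
    rw [h, map_zero] at h1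
    exact (hpos 0 0).ne (by exact_mod_cast h1)
  have hP0 : P ≠ 0 := by
    rintro rfl
    have h1 := congrArg (evalAt (0, 0)) hP
    rw [map_zero, map_zero, map_mul, evalAt_apply, (waveFun_origin n a hc).1, evalAt_apply,
      polyHom_apply, eval_map_ofReal] at h1
    have h2 : (c : ℂ) ≠ 0 := by exact_mod_cast hc
    have h3 : ((eval ![(0 : ℝ), 0] H : ℝ) : ℂ) ≠ 0 := by exact_mod_cast (hpos 0 0).ne'
    exact mul_ne_zero h2 h3 h1.symm
  have hreal : map (starRingEnd ℂ) (map ofRealHom H) = map ofRealHom H := by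
    rw [MvPolynomial.map_map]
    congr 2
    ext r
    exact conj_ofReal r
  have hQ0 : map (starRingEnd ℂ) P ≠ 0 :=
    (map_ne_zero_iff _ (map_injective _ (starRingEnd ℂ).injective)).2 hP0
  have hdar := isDarboux_smoothFun n a hc
  have hbil := hdar.bilinear (q := waveFun n a c) rfl hH hP
  have hlog := hdar.det_log_deriv (q := waveFun n a c) rfl
  have hbil' := congrArg star hbil
  have hHs : star (polyHom (map ofRealHom H)) = polyHom (map ofRealHom H) := by
    rw [star_polyHom, hreal]
  simp only [star_add, star_sub, star_mul', star_zero, star_ofNat, ← dirDeriv_star, hHs,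
    star_polyHom, IsDarboux.star_I, ← map_neg] at hbil'
  refine ⟨P, hP, fun D hDP hDH => ?_⟩
  by_contra hD
  obtain ⟨E, hE, hED⟩ := WfDvdMonoid.exists_irreducible_factor hD (ne_zero_of_dvd_ne_zero hH0 hDH)
  have hdegC : (aeval ![Polynomial.X, 0] (map ofRealHom H) : Polynomial ℂ).natDegree =
      n * (n + 1) := by
    have : (aeval ![Polynomial.X, 0] (map ofRealHom H) : Polynomial ℂ) =
        Polynomial.map ofRealHom (aeval ![Polynomial.X, 0] H) := by
      have h1 : (aeval ![Polynomial.X, 0] : MvPolynomial (Fin 2) ℂ →ₐ[ℂ] _).toRingHom.comp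
          (map ofRealHom) = (Polynomial.mapRingHom ofRealHom).comp
            (aeval ![Polynomial.X, 0] : MvPolynomial (Fin 2) ℝ →ₐ[ℝ] _).toRingHom := by
        refine ringHom_ext (fun r => by simp) fun i => ?_
        fin_cases i <;> simp
      exact congrArg (fun r => r H) h1
    rw [this, Polynomial.natDegree_map, hdeg.2]
  have hEx := not_dvd_pderiv (N := n * (n + 1)) hH0 (by
    rw [← hdeg.1]
    exact Finset.sup_mono (support_map_subset _ _)) hdegC hE (hED.trans hDH)
  have hEx' : ¬E ∣ polyDeriv (1, 0) E := by simpa [polyDeriv] using hEx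
  have hI : algebraMap ℂ smoothFun I = polyHom (algebraMap ℂ _ I) := (polyHom.commutes I).symm
  have hI' : algebraMap ℂ smoothFun (-I) = polyHom (algebraMap ℂ _ (-I)) :=
    (polyHom.commutes (-I)).symm
  have hc2 : algebraMap ℂ smoothFun c = polyHom (algebraMap ℂ _ c) := (polyHom.commutes _).symm
  refine not_dvd_of_bilinear (Dx := polyDeriv (1, 0)) (Dt := polyDeriv (2 * a, 1)) hE.prime hEx' hP0
    hQ0 hH0 (i := I) (i' := -I) (r := algebraMap ℂ _ c ^ 2) ?_ ?_ ?_ (hED.trans hDP)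
    (hED.trans hDH)
  · refine polyHom_injective ?_
    simp only [dirDeriv_polyHom, hI] at hbil
    simpa only [map_add, map_sub, map_mul, map_zero, map_ofNat] using hbil
  · refine polyHom_injective ?_
    simp only [dirDeriv_polyHom, hI'] at hbil'
    simpa only [map_add, map_sub, map_mul, map_zero, map_ofNat, map_neg] using hbil'
  · refine polyHom_injective ?_
    rw [← hH] at hlog
    have hPs := congrArg star hP
    rw [star_polyHom, star_mul', hHs] at hPs
    simp only [map_add, map_sub, map_mul, map_pow, ← dirDeriv_polyHom, ← hc2]
    rw [hPs, hP]
    linear_combination -hlog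

/-- The waves have the shape of a rogue wave. -/
theorem isRogueProfile_modulated {ι : Type} [Fintype ι] {n : ℕ} (hn : 1 ≤ n) (a : ℝ) {c : ℝ}
    (hc : 0 < c) {k : ι → ℝ} (hk : ∑ j, k j ^ 2 = 1) :
    IsRogueProfile n a (fun j => c * k j)
      (fun j x t => (modulated n a c (k j) : ℝ × ℝ → ℂ) (x, t)) := by
  have hsum : ∑ j, (c * k j) ^ 2 = c ^ 2 := by
    simp only [mul_pow, ← Finset.mul_sum, hk, mul_one]
  refine ⟨?_, fun j => ?_, ?_⟩
  · obtain ⟨H, hH, hpos, hev⟩ := exists_denominator n a hc.ne'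
    have hdeg := degree_denominator n a hc.ne' hpos hev
    obtain ⟨P, hP, hcop⟩ := exists_numerator n a hc.ne' hH hpos hdeg
    refine ⟨fun j => C (k j : ℂ) * P, H, hdeg.1, hpos, fun D hD hDH => ?_, fun j x t => ?_⟩
    · obtain ⟨j, hj⟩ : ∃ j, k j ≠ 0 := by
        by_contra! h
        simp [h] at hk
      refine hcop D ?_ hDH
      have := (hD j).mul_left (C (k j : ℂ)⁻¹)
      rwa [← mul_assoc, ← map_mul, inv_mul_cancel₀ (by exact_mod_cast hj), map_one, one_mul] at this
    · have h1 := congrArg (evalAt (x, t)) hP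
      rw [map_mul, evalAt_apply, evalAt_apply, evalAt_apply, polyHom_apply, polyHom_apply,
        eval_map_ofReal] at h1
      have h2 : ((eval ![x, t] H : ℝ) : ℂ) ≠ 0 := by exact_mod_cast (hpos x t).ne'
      rw [modulated_apply, freq, hsum, map_mul, eval_C, h1]
      field_simp
  · have h := (tendsto_norm_waveFun a hc.ne' n).const_mul |k j|
    rw [abs_mul, mul_comm |c|]
    exact h.congr fun p => (norm_modulated n a c (k j) p).symm
  · obtain ⟨x, hx⟩ := exists_lt_norm_waveFun hn a hc
    refine ⟨x, 0, ?_⟩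
    simp only [norm_modulated, mul_pow, sq_abs, ← Finset.sum_mul, ← Finset.mul_sum, hk, one_mul,
      mul_one]
    exact hx

end Profile

end

end Manakov

namespace Manakov

noncomputable section

/-! ### Maclaurin series of smooth functions of `ε`. -/

section Maclaurin

open PowerSeries (coeff X C expand mk)

/-- The Maclaurin series of a function of a real variable. -/
def maclaurin (f : ℝ → ℂ) : PowerSeries ℂ := mk fun k => iteratedDeriv k f 0 / (k.factorial : ℂ)

theorem factorial_mul_coeff_maclaurin (f : ℝ → ℂ) (k : ℕ) :
    (k.factorial : ℂ) * coeff k (maclaurin f) = iteratedDeriv k f 0 := by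
  rw [maclaurin, PowerSeries.coeff_mk, mul_div_cancel₀]
  exact_mod_cast k.factorial_ne_zero

theorem constantCoeff_maclaurin (f : ℝ → ℂ) : PowerSeries.constantCoeff (maclaurin f) = f 0 := by
  rw [← PowerSeries.coeff_zero_eq_constantCoeff_apply, maclaurin, PowerSeries.coeff_mk]
  simp

section

variable {f g : ℝ → ℂ} (hf : ContDiff ℝ ∞ f) (hg : ContDiff ℝ ∞ g)
include hf

theorem contDiff_nat (k : ℕ) : ContDiff ℝ k f := hf.of_le (by exact_mod_cast le_top)

theorem maclaurin_deriv : maclaurin (deriv f) = PowerSeries.derivative ℂ (maclaurin f) := by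
  ext k
  rw [PowerSeries.coeff_derivative, maclaurin, maclaurin, PowerSeries.coeff_mk,
    PowerSeries.coeff_mk, ← iteratedDeriv_succ', Nat.factorial_succ]
  have h1 : ((k : ℂ) + 1) ≠ 0 := by exact_mod_cast k.succ_ne_zero
  have h2 : (k.factorial : ℂ) ≠ 0 := by exact_mod_cast k.factorial_ne_zero
  push_cast
  field_simp

include hg

theorem maclaurin_add : maclaurin (fun ε => f ε + g ε) = maclaurin f + maclaurin g := by
  ext k
  simp only [maclaurin, map_add, PowerSeries.coeff_mk]
  rw [iteratedDeriv_fun_add (contDiff_nat hf k).contDiffAt (contDiff_nat hg k).contDiffAt, add_div]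

theorem maclaurin_mul : maclaurin (fun ε => f ε * g ε) = maclaurin f * maclaurin g := by
  ext k
  rw [PowerSeries.coeff_mul, Finset.Nat.sum_antidiagonal_eq_sum_range_succ_mk]
  simp only [maclaurin, PowerSeries.coeff_mk]
  rw [iteratedDeriv_fun_mul (contDiff_nat hf k).contDiffAt (contDiff_nat hg k).contDiffAt,
    Finset.sum_div]
  refine Finset.sum_congr rfl fun i hi => ?_
  have hi' : i ≤ k := Nat.lt_succ_iff.1 (Finset.mem_range.1 hi)
  rw [Nat.cast_choose ℂ hi']
  have h1 : (i.factorial : ℂ) ≠ 0 := by exact_mod_cast i.factorial_ne_zero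
  have h2 : ((k - i).factorial : ℂ) ≠ 0 := by exact_mod_cast (k - i).factorial_ne_zero
  have h3 : (k.factorial : ℂ) ≠ 0 := by exact_mod_cast k.factorial_ne_zero
  field_simp

end

theorem maclaurin_const (r : ℂ) : maclaurin (fun _ => r) = C r := by
  ext k
  rw [maclaurin, PowerSeries.coeff_mk, iteratedDeriv_const, PowerSeries.coeff_C]
  split_ifs with h
  · simp [h]
  · simp

theorem contDiff_coe : ContDiff ℝ ∞ fun ε : ℝ => (ε : ℂ) := ofRealCLM.contDiff

theorem maclaurin_coe : maclaurin (fun ε : ℝ => (ε : ℂ)) = X := by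
  refine PowerSeries.derivative.ext ?_ ?_
  · rw [← maclaurin_deriv contDiff_coe, PowerSeries.derivative_X]
    have : deriv (fun ε : ℝ => (ε : ℂ)) = fun _ => 1 :=
      funext fun ε => (ofRealCLM.hasDerivAt (x := ε)).deriv
    rw [this, maclaurin_const, map_one]
  · rw [constantCoeff_maclaurin]; simp

theorem maclaurin_pow {f : ℝ → ℂ} (hf : ContDiff ℝ ∞ f) (k : ℕ) :
    maclaurin (fun ε => f ε ^ k) = maclaurin f ^ k := by
  induction k with
  | zero => simp [maclaurin_const]
  | succ k ih => simp only [pow_succ]; rw [maclaurin_mul (hf.pow k) hf, ih]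

theorem maclaurin_neg {f : ℝ → ℂ} (hf : ContDiff ℝ ∞ f) :
    maclaurin (fun ε => -f ε) = -maclaurin f := by
  have h := maclaurin_mul (contDiff_const (c := (-1 : ℂ))) hf
  simpa [maclaurin_const] using h

/-- Odd derivatives of an even function vanish at zero; `expand 2` is the substitution `s = ε²`. -/
theorem maclaurin_even {f : ℝ → ℂ} (hf : ∀ ε, f (-ε) = f ε) :
    maclaurin f = expand 2 two_ne_zero (mk fun k => coeff (2 * k) (maclaurin f)) := by
  ext k
  rw [PowerSeries.coeff_expand]
  split_ifs with h
  · obtain ⟨i, rfl⟩ := h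
    rw [Nat.mul_div_cancel_left _ two_pos, PowerSeries.coeff_mk]
  · have h1 := iteratedDeriv_comp_neg k f 0
    simp only [hf, neg_zero] at h1
    rw [(Nat.odd_iff.2 (Nat.two_dvd_ne_zero.1 h)).neg_one_pow, neg_smul, one_smul] at h1
    rw [maclaurin, PowerSeries.coeff_mk, CharZero.eq_neg_self_iff.1 h1, zero_div]

/-! ### Exponentials -/

/-- The exponential of a power series without constant term. -/
def expSeries (A : PowerSeries ℂ) : PowerSeries ℂ :=
  lsum fun j => C (j.factorial : ℂ)⁻¹ * A ^ j

variable {A : PowerSeries ℂ}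

theorem X_pow_dvd_expSeries_term (hA : X ∣ A) (j : ℕ) : X ^ j ∣ C (j.factorial : ℂ)⁻¹ * A ^ j :=
  (pow_dvd_pow_of_dvd hA j).mul_left _

theorem constantCoeff_expSeries : PowerSeries.constantCoeff (expSeries A) = 1 := by
  rw [← PowerSeries.coeff_zero_eq_constantCoeff_apply, expSeries, lsum, PowerSeries.coeff_mk]
  simp

theorem derivative_expSeries (hA : X ∣ A) :
    PowerSeries.derivative ℂ (expSeries A) = PowerSeries.derivative ℂ A * expSeries A := by
  rw [expSeries, mul_lsum (X_pow_dvd_expSeries_term hA)]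
  ext k
  rw [PowerSeries.coeff_derivative, coeff_lsum (X_pow_dvd_expSeries_term hA) (Nat.lt_succ_self _),
    Finset.sum_mul, coeff_lsum (fun j => (X_pow_dvd_expSeries_term hA j).mul_left _)
      (Nat.lt_succ_self _)]
  simp only [← PowerSeries.coeff_derivative]
  rw [Finset.sum_range_succ']
  have h0 : PowerSeries.derivative ℂ (C ((0 : ℕ).factorial : ℂ)⁻¹ * A ^ 0) = 0 := by
    rw [pow_zero, mul_one, PowerSeries.derivative_C]
  rw [h0, map_zero, add_zero]
  refine Finset.sum_congr rfl fun j _ => congrArg (coeff k) ?_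
  rw [Derivation.leibniz, PowerSeries.derivative_C, smul_zero, add_zero, smul_eq_mul,
    PowerSeries.derivative_pow, Nat.add_sub_cancel]
  have h := cst_inv_factorial_succ_mul (R := ℂ) j
  simp only [cst, Algebra.algebraMap_self, RingHom.id_apply] at h
  rw [← h]
  ring

/-- Both sides solve the same linear differential equation: the product of such a solution with
`exp(-A)` has derivative zero and constant term one. -/
theorem eq_expSeries (hA : X ∣ A) {E : PowerSeries ℂ} (hE : PowerSeries.constantCoeff E = 1)
    (hd : PowerSeries.derivative ℂ E = PowerSeries.derivative ℂ A * E) : E = expSeries A := by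
  have hA' : X ∣ -A := (dvd_neg).2 hA
  have h1 : ∀ F : PowerSeries ℂ, PowerSeries.constantCoeff F = 1 →
      PowerSeries.derivative ℂ F = PowerSeries.derivative ℂ A * F → F * expSeries (-A) = 1 := by
    intro F hF hdF
    refine PowerSeries.derivative.ext ?_ ?_
    · rw [Derivation.leibniz, hdF, derivative_expSeries hA', PowerSeries.derivative_one, map_neg,
        smul_eq_mul, smul_eq_mul]
      ring
    · rw [map_mul, hF, constantCoeff_expSeries, map_one, mul_one]
  have h2 := h1 E hE hd
  have h3 := h1 _ constantCoeff_expSeries (derivative_expSeries hA)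
  calc E = E * (expSeries A * expSeries (-A)) := by rw [h3, mul_one]
    _ = expSeries A * (E * expSeries (-A)) := by ring
    _ = expSeries A := by rw [h2, mul_one]

theorem maclaurin_exp {f : ℝ → ℂ} (hf : ContDiff ℝ ∞ f) (h0 : f 0 = 0) :
    maclaurin (fun ε => exp (f ε)) = expSeries (maclaurin f) := by
  have hX : X ∣ maclaurin f := by rw [PowerSeries.X_dvd_iff, constantCoeff_maclaurin, h0]
  refine eq_expSeries hX ?_ ?_
  · rw [constantCoeff_maclaurin, h0, exp_zero]
  · have hd : Differentiable ℝ f := hf.differentiable (by simp)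
    have hd' : ContDiff ℝ ∞ (deriv f) := (contDiff_infty_iff_deriv.1 hf).2
    rw [← maclaurin_deriv hf.cexp, ← maclaurin_deriv hf, ← maclaurin_mul hd' hf.cexp]
    congr 1
    ext ε
    rw [((hd ε).hasDerivAt.cexp).deriv, mul_comm]

theorem sum_range_two_mul_pair {M : Type*} [AddCommMonoid M] (K : ℕ) (F : ℕ → M) :
    ∑ j ∈ Finset.range (2 * K), F j =
      ∑ i ∈ Finset.range K, F (2 * i) + ∑ i ∈ Finset.range K, F (2 * i + 1) := by
  induction K with
  | zero => simp
  | succ K ih =>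
    rw [show 2 * (K + 1) = 2 * K + 1 + 1 by ring, Finset.sum_range_succ, Finset.sum_range_succ, ih,
      Finset.sum_range_succ, Finset.sum_range_succ]
    abel

theorem X_pow_dvd_expand {F : PowerSeries ℂ} {K : ℕ} (h : X ^ K ∣ F) :
    X ^ (2 * K) ∣ expand 2 two_ne_zero F := by
  obtain ⟨G, rfl⟩ := h
  rw [map_mul, map_pow, PowerSeries.expand_X, ← pow_mul]
  exact dvd_mul_right _ _

theorem expand_C_mul (r : ℂ) (F : PowerSeries ℂ) :
    expand 2 two_ne_zero (C r * F) = C r * expand 2 two_ne_zero F := by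
  rw [map_mul, PowerSeries.expand_C]

section

variable {U W : PowerSeries ℂ} {c : ℝ} {z τ : ℂ}
  (hU : U ^ 2 = expand 2 two_ne_zero (uSq ℂ c)) (hX : X ∣ U)
include hU hX

/-- The odd and even parts of the exponential of `uw`: even powers of `u` are series in `ε²`, and
one factor `u` is left over in the odd part. The partial sums with `2K` terms are split by parity.
-/
theorem expSeries_sub_neg :
    expSeries (U * expand 2 two_ne_zero (phase z τ)) -
      expSeries (-(U * expand 2 two_ne_zero (phase z τ))) =
      2 * U * expand 2 two_ne_zero (sinhSeries c z τ) ∧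
    expSeries (U * expand 2 two_ne_zero (phase z τ)) +
      expSeries (-(U * expand 2 two_ne_zero (phase z τ))) =
      2 * expand 2 two_ne_zero (coshSeries c z τ) := by
  set A := U * expand 2 two_ne_zero (phase z τ) with hA
  have hXA : X ∣ A := hX.mul_right _
  have hXA' : X ∣ -A := (dvd_neg).2 hXA
  have heven : ∀ i, A ^ (2 * i) = expand 2 two_ne_zero (uSq ℂ c ^ i * phase z τ ^ (2 * i)) := by
    intro i
    rw [hA, mul_pow, pow_mul, hU, map_mul, map_pow, map_pow]
  have hodd : ∀ i, A ^ (2 * i + 1) =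
      U * expand 2 two_ne_zero (uSq ℂ c ^ i * phase z τ ^ (2 * i + 1)) := by
    intro i
    rw [pow_succ, heven, hA, map_mul, map_mul, pow_succ, map_mul]
    ring
  have hnegE : ∀ i, (-A) ^ (2 * i) = A ^ (2 * i) := fun i => (even_two_mul i).neg_pow A
  have hnegO : ∀ i, (-A) ^ (2 * i + 1) = -A ^ (2 * i + 1) :=
    fun i => (odd_two_mul_add_one i).neg_pow A
  constructor
  · refine eq_of_forall_X_pow_dvd_sub fun K => ?_
    refine (pow_dvd_pow X (show K ≤ 2 * K by omega)).trans ?_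
    have h1 := X_pow_dvd_lsum_sub (X_pow_dvd_expSeries_term hXA) (le_refl (2 * K))
    have h2 := X_pow_dvd_lsum_sub (X_pow_dvd_expSeries_term hXA') (le_refl (2 * K))
    have h3 := (X_pow_dvd_expand (X_pow_dvd_lsum_sub (fun j => X_pow_dvd_term c
      (cst ℂ ((2 * j + 1).factorial : ℂ)⁻¹) (phase z τ ^ (2 * j + 1)) j) (le_refl K))).mul_left
        (2 * U)
    refine (dvd_sub (dvd_sub h1 h2) h3).trans (dvd_of_eq ?_)
    rw [sum_range_two_mul_pair, sum_range_two_mul_pair]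
    simp only [hnegE, hnegO, map_sub, map_sum, mul_sub, mul_neg, Finset.sum_neg_distrib, heven, hodd, cst,
      Algebra.algebraMap_self, RingHom.id_apply, expand_C_mul, Finset.mul_sum]
    have h4 : ∀ i ∈ Finset.range K, 2 * U * (C ((2 * i + 1).factorial : ℂ)⁻¹ *
        expand 2 two_ne_zero (uSq ℂ c ^ i * phase z τ ^ (2 * i + 1))) =
        C ((2 * i + 1).factorial : ℂ)⁻¹ *
          (U * expand 2 two_ne_zero (uSq ℂ c ^ i * phase z τ ^ (2 * i + 1))) +
        C ((2 * i + 1).factorial : ℂ)⁻¹ *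
          (U * expand 2 two_ne_zero (uSq ℂ c ^ i * phase z τ ^ (2 * i + 1))) :=
      fun i _ => by ring
    rw [Finset.sum_congr rfl h4, Finset.sum_add_distrib, expSeries, expSeries, sinhSeries]
    simp only [cst, Algebra.algebraMap_self, RingHom.id_apply]
    ring
  · refine eq_of_forall_X_pow_dvd_sub fun K => ?_
    refine (pow_dvd_pow X (show K ≤ 2 * K by omega)).trans ?_
    have h1 := X_pow_dvd_lsum_sub (X_pow_dvd_expSeries_term hXA) (le_refl (2 * K))
    have h2 := X_pow_dvd_lsum_sub (X_pow_dvd_expSeries_term hXA') (le_refl (2 * K))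
    have h3 := (X_pow_dvd_expand (X_pow_dvd_lsum_sub (fun j => X_pow_dvd_term c
      (cst ℂ ((2 * j).factorial : ℂ)⁻¹) (phase z τ ^ (2 * j)) j) (le_refl K))).mul_left 2
    refine (dvd_sub (dvd_add h1 h2) h3).trans (dvd_of_eq ?_)
    rw [sum_range_two_mul_pair, sum_range_two_mul_pair]
    simp only [hnegE, hnegO, map_sub, map_sum, mul_sub, mul_neg, Finset.sum_neg_distrib, heven, hodd, cst,
      Algebra.algebraMap_self, RingHom.id_apply, expand_C_mul]
    rw [expSeries, expSeries, coshSeries]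
    simp only [cst, Algebra.algebraMap_self, RingHom.id_apply]
    ring

end

end Maclaurin

end

end Manakov

namespace Manakov

noncomputable section

/-! ### Expansion of the eigenfunctions in `ε`. -/

section Eigenfunction

open PowerSeries (coeff X C expand mk)

/-- The amplitude `√(c₁² + c₂²)` of the plane wave. -/
def amp (c₁ c₂ : ℝ) : ℝ := √(c₁ ^ 2 + c₂ ^ 2)

theorem amp_pos {c₁ c₂ : ℝ} (hc : c₁ ≠ 0 ∨ c₂ ≠ 0) : 0 < amp c₁ c₂ := by
  refine Real.sqrt_pos.2 ?_
  rcases hc with h | h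
  · have := sq_pos_of_ne_zero h; positivity
  · have := sq_pos_of_ne_zero h; positivity

theorem amp_sq (c₁ c₂ : ℝ) : amp c₁ c₂ ^ 2 = c₁ ^ 2 + c₂ ^ 2 := Real.sq_sqrt (by positivity)

/-- The smooth factor of `root`. -/
def rootFactor (c ε : ℝ) : ℂ := (-2 * I * c - (ε : ℂ) ^ 2) ^ (1 / 2 : ℂ)

theorem root_eq (c₁ c₂ ε : ℝ) : root c₁ c₂ ε = ε * rootFactor (amp c₁ c₂) ε := rfl

theorem rootFactor_sq (c ε : ℝ) : rootFactor c ε ^ 2 = -2 * I * c - (ε : ℂ) ^ 2 := by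
  simp [rootFactor]

section

variable {c : ℝ} (hc : 0 < c)
include hc

theorem contDiff_rootFactor : ContDiff ℝ ∞ (rootFactor c) := by
  have hb : ContDiff ℝ ∞ fun ε : ℝ => -2 * I * c - (ε : ℂ) ^ 2 :=
    contDiff_const.sub (contDiff_coe.pow 2)
  -- The imaginary part is `-2c` for every real `ε`, so the radicand never meets the branch cut.
  have him : ∀ ε : ℝ, (-2 * I * c - (ε : ℂ) ^ 2).im ≠ 0 := by
    intro ε
    have : ((ε : ℂ) ^ 2).im = 0 := by rw [← ofReal_pow, ofReal_im]
    simp [this, hc.ne']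
  have h : rootFactor c = fun ε : ℝ => exp (log (-2 * I * c - (ε : ℂ) ^ 2) * (1 / 2)) := by
    ext ε
    rw [rootFactor, cpow_def_of_ne_zero]
    intro h0
    exact him ε (by rw [h0, zero_im])
  rw [h]
  refine ContDiff.cexp (ContDiff.mul ?_ contDiff_const)
  rw [contDiff_iff_contDiffAt]
  intro ε
  have hlog := (contDiffAt_log (n := ∞) (mem_slitPlane_iff.2 (Or.inr (him ε)))).restrict_scalars ℝ
  exact hlog.comp ε hb.contDiffAt

/-- The expansion of `rootFactor` in powers of `ε ^ 2`. -/
def rootSeries (c : ℝ) : PowerSeries ℂ := mk fun k => coeff (2 * k) (maclaurin (rootFactor c))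

omit hc in
theorem maclaurin_rootFactor : maclaurin (rootFactor c) = expand 2 two_ne_zero (rootSeries c) :=
  maclaurin_even fun ε => by simp [rootFactor]

/-- The common factor `2 * rootSeries` of all components is thus a unit of the power series ring and
does not affect divisibility by powers of `s`. -/
theorem constantCoeff_rootSeries_ne_zero : PowerSeries.constantCoeff (rootSeries c) ≠ 0 := by
  have h : PowerSeries.constantCoeff (rootSeries c) = rootFactor c 0 := by
    rw [← constantCoeff_maclaurin (rootFactor c), maclaurin_rootFactor, PowerSeries.constantCoeff_expand]
  rw [h]
  intro h0
  have := rootFactor_sq c 0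
  rw [h0] at this
  simp [hc.ne'] at this

theorem maclaurin_root : maclaurin (fun ε : ℝ => (ε : ℂ) * rootFactor c ε) =
    X * expand 2 two_ne_zero (rootSeries c) := by
  rw [maclaurin_mul contDiff_coe (contDiff_rootFactor hc), maclaurin_coe, maclaurin_rootFactor]

theorem rootSeries_sq : (X * expand 2 two_ne_zero (rootSeries c)) ^ 2 =
    expand 2 two_ne_zero (uSq ℂ c) := by
  have h1 := maclaurin_pow (contDiff_rootFactor hc) 2
  simp only [rootFactor_sq, sub_eq_add_neg] at h1
  rw [maclaurin_add contDiff_const (contDiff_coe.pow 2).neg, maclaurin_const,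
    maclaurin_neg (contDiff_coe.pow 2), maclaurin_pow contDiff_coe, maclaurin_coe,
    maclaurin_rootFactor] at h1
  rw [mul_pow, ← h1]
  simp only [uSq, cst, map_neg, map_mul, map_add, PowerSeries.expand_X, PowerSeries.expand_C,
    Algebra.algebraMap_self, RingHom.id_apply]
  ring

theorem expand_phase (z τ : ℂ) : maclaurin (fun ε : ℝ => z + 2 * τ * (ε : ℂ) ^ 2) =
    expand 2 two_ne_zero (phase z τ) := by
  rw [maclaurin_add contDiff_const (contDiff_const.mul (contDiff_coe.pow 2)), maclaurin_const,
    maclaurin_mul contDiff_const (contDiff_coe.pow 2), maclaurin_const, maclaurin_pow contDiff_coe,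
    maclaurin_coe, phase]
  simp only [map_add, map_mul, PowerSeries.expand_C, PowerSeries.expand_X]

/-- The difference and the sum of the exponentials in the eigenfunctions. -/
theorem maclaurin_exp_sub_exp (z τ : ℂ) :
    maclaurin (fun ε : ℝ => exp (ε * rootFactor c ε * (z + 2 * τ * (ε : ℂ) ^ 2)) +
      -exp (-(ε * rootFactor c ε * (z + 2 * τ * (ε : ℂ) ^ 2)))) =
      2 * (X * expand 2 two_ne_zero (rootSeries c)) * expand 2 two_ne_zero (sinhSeries c z τ) ∧
    maclaurin (fun ε : ℝ => exp (ε * rootFactor c ε * (z + 2 * τ * (ε : ℂ) ^ 2)) +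
      exp (-(ε * rootFactor c ε * (z + 2 * τ * (ε : ℂ) ^ 2)))) =
      2 * expand 2 two_ne_zero (coshSeries c z τ) := by
  have hu : ContDiff ℝ ∞ fun ε : ℝ => (ε : ℂ) * rootFactor c ε :=
    contDiff_coe.mul (contDiff_rootFactor hc)
  have hw : ContDiff ℝ ∞ fun ε : ℝ => z + 2 * τ * (ε : ℂ) ^ 2 :=
    contDiff_const.add (contDiff_const.mul (contDiff_coe.pow 2))
  have h := hu.mul hw
  have h1 := expSeries_sub_neg (z := z) (τ := τ) (rootSeries_sq hc) (dvd_mul_right _ _)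
  have h2 : maclaurin (fun ε : ℝ => (ε : ℂ) * rootFactor c ε * (z + 2 * τ * (ε : ℂ) ^ 2)) =
      X * expand 2 two_ne_zero (rootSeries c) * expand 2 two_ne_zero (phase z τ) := by
    rw [maclaurin_mul hu hw, maclaurin_root hc, expand_phase hc]
  have h3 := maclaurin_exp h (by simp)
  have h4 := maclaurin_exp h.neg (by simp)
  rw [maclaurin_neg h] at h4
  rw [maclaurin_add h.cexp h.neg.cexp.neg, maclaurin_add h.cexp h.neg.cexp,
    maclaurin_neg h.neg.cexp, h3, h4, h2, ← sub_eq_add_neg]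
  exact h1

end

variable (m : ℕ) (a : ℝ) {c₁ c₂ : ℝ} (hc : c₁ ≠ 0 ∨ c₂ ≠ 0) (x t : ℝ)

theorem mode_root (u : ℂ) (ε : ℝ) : mode a c₁ c₂ u x t ε =
    exp (u * (x - 2 * a * t + 2 * I * amp c₁ c₂ * t + 2 * t * (ε : ℂ) ^ 2)) := by
  rw [mode, lam, lam₀, amp]
  congr 1
  ring

include hc

/-- Rationalising the denominator: by `u² = -s(2ic + s)`, the product of `u - i(ic + s)` and `u +
i(ic + s)` is `-c²`. The sign `s = ±1` in the statement covers both roots. -/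
theorem weight_root (s : ℂ) (hs : s ^ 2 = 1) (ε : ℝ) :
    weight a c₁ c₂ (s * root c₁ c₂ ε) ε =
      -((amp c₁ c₂ : ℂ)⁻¹ ^ 2 * (s * root c₁ c₂ ε + I * (I * amp c₁ c₂ + (ε : ℂ) ^ 2))) := by
  have hc' : ((amp c₁ c₂ : ℝ) : ℂ) ≠ 0 := by exact_mod_cast (amp_pos hc).ne'
  have hden : s * root c₁ c₂ ε - I * lam a c₁ c₂ ε - I * a / 2 =
      s * root c₁ c₂ ε - I * (I * amp c₁ c₂ + (ε : ℂ) ^ 2) := by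
    rw [lam, lam₀, amp]; ring
  have hr : root c₁ c₂ ε ^ 2 = (ε : ℂ) ^ 2 * (-2 * I * amp c₁ c₂ - (ε : ℂ) ^ 2) := by
    rw [root_eq, mul_pow, rootFactor_sq]
  have hprod : (s * root c₁ c₂ ε - I * (I * amp c₁ c₂ + (ε : ℂ) ^ 2)) *
      (s * root c₁ c₂ ε + I * (I * amp c₁ c₂ + (ε : ℂ) ^ 2)) = -(amp c₁ c₂ : ℂ) ^ 2 := by
    linear_combination root c₁ c₂ ε ^ 2 * hs + hr
      - ((amp c₁ c₂ : ℂ) ^ 2 * (I ^ 2 - 1) + 2 * I * amp c₁ c₂ * (ε : ℂ) ^ 2 + (ε : ℂ) ^ 4) * I_sq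
  have hne : s * root c₁ c₂ ε - I * (I * amp c₁ c₂ + (ε : ℂ) ^ 2) ≠ 0 := by
    intro h0
    rw [h0, zero_mul] at hprod
    exact hc' (by simpa using hprod.symm)
  rw [weight, hden, div_eq_iff hne]
  field_simp
  linear_combination hprod

/-- The Maclaurin series of the component `f` of the eigenfunction. -/
theorem maclaurin_eigenF : maclaurin (eigenF m a c₁ c₂ x t) =
    X ^ (m + 1) * expand 2 two_ne_zero (2 * rootSeries (amp c₁ c₂) *
      fSeries (amp c₁ c₂) (x - 2 * a * t + 2 * I * amp c₁ c₂ * t) t) ∧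
    ContDiff ℝ ∞ (eigenF m a c₁ c₂ x t) := by
  set c := amp c₁ c₂
  set z : ℂ := x - 2 * a * t + 2 * I * c * t
  have hcp : 0 < c := amp_pos hc
  have h : eigenF m a c₁ c₂ x t = fun ε : ℝ => (ε : ℂ) ^ m *
      (exp (ε * rootFactor c ε * (z + 2 * t * (ε : ℂ) ^ 2)) +
        -exp (-(ε * rootFactor c ε * (z + 2 * t * (ε : ℂ) ^ 2)))) := by
    ext ε
    rw [eigenF, mode_root, mode_root, root_eq, neg_mul]
    ring
  have hu : ContDiff ℝ ∞ fun ε : ℝ => (ε : ℂ) * rootFactor c ε :=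
    contDiff_coe.mul (contDiff_rootFactor hcp)
  have hw : ContDiff ℝ ∞ fun ε : ℝ => z + 2 * t * (ε : ℂ) ^ 2 :=
    contDiff_const.add (contDiff_const.mul (contDiff_coe.pow 2))
  have hs := (hu.mul hw).cexp.add (hu.mul hw).neg.cexp.neg
  rw [h]
  refine ⟨?_, (contDiff_coe.pow m).mul hs⟩
  rw [maclaurin_mul (contDiff_coe.pow m) hs, maclaurin_pow contDiff_coe, maclaurin_coe,
    (maclaurin_exp_sub_exp hcp z t).1, map_mul, map_mul, map_ofNat]
  ring

/-- Stated for a general `k` in order to serve for `g` with `k = c₁` and for `h` with `k = c₂`. -/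
theorem maclaurin_component {G : ℝ → ℂ} {k : ℝ}
    (hG : ∀ ε : ℝ, G ε = (ε : ℂ) ^ m * (-k * weight a c₁ c₂ (root c₁ c₂ ε) ε) *
        mode a c₁ c₂ (root c₁ c₂ ε) x t ε
      - (ε : ℂ) ^ m * (-k * weight a c₁ c₂ (-root c₁ c₂ ε) ε) *
        mode a c₁ c₂ (-root c₁ c₂ ε) x t ε) :
    maclaurin G =
    X ^ (m + 1) * expand 2 two_ne_zero (2 * rootSeries (amp c₁ c₂) *
      (cst ℂ (k / amp c₁ c₂) *
        gSeries (amp c₁ c₂) (x - 2 * a * t + 2 * I * amp c₁ c₂ * t) t)) ∧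
    ContDiff ℝ ∞ G := by
  have hcp : 0 < amp c₁ c₂ := amp_pos hc
  have hw1 := fun ε => weight_root a hc 1 (one_pow 2) ε
  have hw2 := fun ε => weight_root a hc (-1) (by norm_num) ε
  simp only [one_mul, neg_one_mul] at hw1 hw2
  simp only [hw1, hw2, mode_root] at hG
  simp only [root_eq, neg_mul] at hG
  generalize amp c₁ c₂ = c at *
  set z : ℂ := x - 2 * a * t + 2 * I * c * t
  have hu : ContDiff ℝ ∞ fun ε : ℝ => (ε : ℂ) * rootFactor c ε :=
    contDiff_coe.mul (contDiff_rootFactor hcp)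
  have hw : ContDiff ℝ ∞ fun ε : ℝ => z + 2 * t * (ε : ℂ) ^ 2 :=
    contDiff_const.add (contDiff_const.mul (contDiff_coe.pow 2))
  have hs := (hu.mul hw).cexp.add (hu.mul hw).neg.cexp.neg
  have hch := (hu.mul hw).cexp.add (hu.mul hw).neg.cexp
  have h : G = fun ε : ℝ => (ε : ℂ) ^ m * ((k * (c : ℂ)⁻¹ ^ 2) *
      (((ε : ℂ) * rootFactor c ε) * (exp (ε * rootFactor c ε * (z + 2 * t * (ε : ℂ) ^ 2)) +
        exp (-(ε * rootFactor c ε * (z + 2 * t * (ε : ℂ) ^ 2)))) +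
      (I * (I * c) + I * (ε : ℂ) ^ 2) *
        (exp (ε * rootFactor c ε * (z + 2 * t * (ε : ℂ) ^ 2)) +
          -exp (-(ε * rootFactor c ε * (z + 2 * t * (ε : ℂ) ^ 2)))))) := by
    ext ε
    rw [hG]
    ring
  have hmu : ContDiff ℝ ∞ fun ε : ℝ => I * (I * c) + I * (ε : ℂ) ^ 2 :=
    contDiff_const.add (contDiff_const.mul (contDiff_coe.pow 2))
  have hk : ContDiff ℝ ∞ fun _ : ℝ => k * (c : ℂ)⁻¹ ^ 2 := contDiff_const
  have hin := (hu.mul hch).add (hmu.mul hs)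
  rw [h]
  refine ⟨?_, (contDiff_coe.pow m).mul (hk.mul hin)⟩
  rw [maclaurin_mul (contDiff_coe.pow m) (hk.mul hin), maclaurin_mul hk hin,
    maclaurin_add (hu.mul hch) (hmu.mul hs), maclaurin_mul hu hch, maclaurin_mul hmu hs,
    (maclaurin_exp_sub_exp hcp z t).1, (maclaurin_exp_sub_exp hcp z t).2, maclaurin_root hcp,
    maclaurin_add contDiff_const (contDiff_const.mul (contDiff_coe.pow 2)),
    maclaurin_mul contDiff_const (contDiff_coe.pow 2), maclaurin_const, maclaurin_const,
    maclaurin_const, maclaurin_pow contDiff_coe, maclaurin_coe, maclaurin_pow contDiff_coe,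
    maclaurin_coe, gSeries]
  simp only [map_mul, map_add, map_pow, cst, PowerSeries.expand_C, PowerSeries.expand_X,
    Algebra.algebraMap_self, RingHom.id_apply, map_ofNat, div_eq_mul_inv]
  ring

/-- The three components `f, g, h` of the eigenfunctions, up to a common factor. -/
def component (c₁ c₂ : ℝ) (z τ : ℂ) : Fin 3 → PowerSeries ℂ :=
  ![fSeries (amp c₁ c₂) z τ, cst ℂ (c₁ / amp c₁ c₂) * gSeries (amp c₁ c₂) z τ,
    cst ℂ (c₂ / amp c₁ c₂) * gSeries (amp c₁ c₂) z τ]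

theorem maclaurin_row (q : Fin 3) : maclaurin (fun ε => block m a c₁ c₂ x t ε 0 q) =
    X ^ (m + 1) * expand 2 two_ne_zero (2 * rootSeries (amp c₁ c₂) *
      component c₁ c₂ (x - 2 * a * t + 2 * I * amp c₁ c₂ * t) t q) ∧
    ContDiff ℝ ∞ (fun ε => block m a c₁ c₂ x t ε 0 q) := by
  fin_cases q
  · exact maclaurin_eigenF m a hc x t
  · exact maclaurin_component m a hc x t fun ε => rfl
  · exact maclaurin_component m a hc x t fun ε => rfl

/-- The derivatives in the first row of a block of `omega`. -/
theorem iteratedDeriv_lam_mul (q : Fin 3) (l k : ℕ) :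
    iteratedDeriv (2 * k + 1 + m)
      (fun ε => lam a c₁ c₂ ε ^ l * block m a c₁ c₂ x t ε 0 q) 0 =
    ((2 * k + 1 + m).factorial : ℂ) * coeff k (2 * rootSeries (amp c₁ c₂) *
      ((cst ℂ (lam₀ a c₁ c₂) + X) ^ l *
        component c₁ c₂ (x - 2 * a * t + 2 * I * amp c₁ c₂ * t) t q)) := by
  obtain ⟨h1, h2⟩ := maclaurin_row m a hc x t q
  have hl : ContDiff ℝ ∞ (lam a c₁ c₂) := contDiff_const.add (contDiff_coe.pow 2)
  have hlm : maclaurin (lam a c₁ c₂) = expand 2 two_ne_zero (cst ℂ (lam₀ a c₁ c₂) + X) := by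
    have : lam a c₁ c₂ = fun ε : ℝ => lam₀ a c₁ c₂ + (ε : ℂ) ^ 2 := rfl
    rw [this, maclaurin_add contDiff_const (contDiff_coe.pow 2), maclaurin_const,
      maclaurin_pow contDiff_coe, maclaurin_coe, map_add, PowerSeries.expand_X, cst,
      PowerSeries.expand_C]
    rfl
  rw [← factorial_mul_coeff_maclaurin, maclaurin_mul (hl.pow l) h2, maclaurin_pow hl, hlm, h1,
    mul_left_comm, ← map_pow, ← map_mul, show 2 * k + 1 + m = 2 * k + (m + 1) by ring,
    PowerSeries.coeff_X_pow_mul, PowerSeries.coeff_expand_mul]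
  congr 2
  ring

end Eigenfunction

end

end Manakov

namespace Manakov

noncomputable section

/-! ### The interpolation problem behind the linear system. -/

section Interpolation

open Matrix Polynomial
open PowerSeries (coeff)

/-- Evaluation of a polynomial in `λ` at `λ₀ + s`. -/
def shiftEval (lam : ℂ) : ℂ[X] →ₐ[ℂ] PowerSeries ℂ := aeval (cst ℂ lam + PowerSeries.X)

/-- The polynomial with conjugate coefficients. -/
def conjPoly : ℂ[X] →+* ℂ[X] := mapRingHom (starRingEnd ℂ)

theorem conjPoly_conjPoly (A : ℂ[X]) : conjPoly (conjPoly A) = A := by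
  rw [conjPoly, coe_mapRingHom, Polynomial.map_map]
  have : (starRingEnd ℂ).comp (starRingEnd ℂ) = RingHom.id ℂ := by ext; simp
  rw [this, Polynomial.map_id]

theorem natDegree_conjPoly (A : ℂ[X]) : (conjPoly A).natDegree = A.natDegree :=
  natDegree_map _

theorem shiftEval_eq (lam : ℂ) (A : ℂ[X]) :
    shiftEval lam A = ((A.comp (X + C lam) : ℂ[X]) : PowerSeries ℂ) := by
  have h : shiftEval lam = (coeToPowerSeries.algHom ℂ).comp (aeval (X + C lam)) := by
    ext
    simp [shiftEval, cst, add_comm]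
  rw [h, AlgHom.comp_apply, coeToPowerSeries.algHom_apply, comp_eq_aeval]
  simp

theorem X_sub_C_pow_dvd_of_shiftEval {lam : ℂ} {n : ℕ} {A : ℂ[X]}
    (h : PowerSeries.X ^ n ∣ shiftEval lam A) : (X - C lam) ^ n ∣ A := by
  rw [X_sub_C_pow_dvd_iff, X_pow_dvd_iff]
  intro d hd
  rw [shiftEval_eq, PowerSeries.X_pow_dvd_iff] at h
  simpa using h d hd

theorem eq_zero_of_shiftEval {lam : ℂ} {n : ℕ} {A : ℂ[X]} (hA : A.natDegree < n)
    (h : PowerSeries.X ^ n ∣ shiftEval lam A) : A = 0 := by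
  refine eq_zero_of_dvd_of_natDegree_lt (X_sub_C_pow_dvd_of_shiftEval h) ?_
  rwa [natDegree_pow, natDegree_X_sub_C, mul_one]

theorem dvd_of_dvd_unit_mul {n : ℕ} {F G : PowerSeries ℂ}
    (hF : PowerSeries.constantCoeff F ≠ 0) (h : PowerSeries.X ^ n ∣ F * G) :
    PowerSeries.X ^ n ∣ G :=
  (PowerSeries.isUnit_iff_constantCoeff.2 (isUnit_iff_ne_zero.2 hF)).dvd_mul_left.1 h

theorem eval_ofReal_conjPoly (A : ℂ[X]) (r : ℝ) :
    (conjPoly A).eval (r : ℂ) = conj (A.eval (r : ℂ)) := by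
  have h := eval₂_at_apply (p := A) (starRingEnd ℂ) (r : ℂ)
  rwa [conj_ofReal, ← eval_map] at h

/-- The homogeneous interpolation problem has only the trivial solution. -/
theorem interpolation_unique {lam : ℂ} (hlam : lam.im ≠ 0) {n : ℕ} {F G : PowerSeries ℂ}
    (hF : PowerSeries.constantCoeff F ≠ 0) {A B : ℂ[X]} (hA : A.natDegree < n)
    (hB : B.natDegree < n)
    (h1 : PowerSeries.X ^ n ∣ shiftEval lam A * F + shiftEval lam B * G)
    (h2 : PowerSeries.X ^ n ∣ shiftEval lam (conjPoly B) * F - shiftEval lam (conjPoly A) * G) :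
    A = 0 ∧ B = 0 := by
  -- The first condition times `A*` plus the second times `B` eliminates `G` and gives `E F ≡ 0`,
  -- where `F` is a unit.
  set E := A * conjPoly A + B * conjPoly B with hEdef
  have hE : PowerSeries.X ^ n ∣ shiftEval lam E := by
    refine dvd_of_dvd_unit_mul hF ?_
    have := dvd_add (h1.mul_left (shiftEval lam (conjPoly A))) (h2.mul_left (shiftEval lam B))
    convert this using 1
    rw [hEdef]
    simp only [map_add, map_mul]
    ring
  have hd1 := X_sub_C_pow_dvd_of_shiftEval hE
  have hconj : conjPoly E = E := by
    rw [hEdef]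
    simp only [map_add, map_mul, conjPoly_conjPoly]
    ring
  -- `E` is its own conjugate, so it also vanishes to order `n` at the conjugate point; these `2n`
  -- roots exceed its degree.
  have hd2 : (X - C (conj lam)) ^ n ∣ E := by
    have := map_dvd conjPoly hd1
    rwa [hconj, map_pow, map_sub, conjPoly, coe_mapRingHom, map_X, map_C] at this
  have hcop : IsCoprime ((X - C lam) ^ n) ((X - C (conj lam)) ^ n) := by
    refine IsCoprime.pow (isCoprime_X_sub_C_of_isUnit_sub ?_)
    rw [isUnit_iff_ne_zero, sub_conj]
    simpa using hlam
  have hE0 : E = 0 := by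
    refine eq_zero_of_dvd_of_natDegree_lt (hcop.mul_dvd hd1 hd2) ?_
    rw [(monic_X_sub_C _).pow n |>.natDegree_mul ((monic_X_sub_C _).pow n), natDegree_pow,
      natDegree_pow, natDegree_X_sub_C, natDegree_X_sub_C]
    have e1 := natDegree_mul_le (p := A) (q := conjPoly A)
    have e2 := natDegree_mul_le (p := B) (q := conjPoly B)
    rw [natDegree_conjPoly] at e1 e2
    have e3 : E.natDegree ≤ _ := natDegree_add_le (A * conjPoly A) (B * conjPoly B)
    omega
  -- On the real line `E` is `|A|² + |B|²`.
  have hev : ∀ r : ℝ, A.eval (r : ℂ) = 0 ∧ B.eval (r : ℂ) = 0 := by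
    intro r
    have h := congrArg (eval (r : ℂ)) hE0
    rw [hEdef, eval_add, eval_mul, eval_mul, eval_ofReal_conjPoly, eval_ofReal_conjPoly, mul_conj,
      mul_conj, eval_zero] at h
    have h' : normSq (A.eval (r : ℂ)) + normSq (B.eval (r : ℂ)) = 0 := by exact_mod_cast h
    have p1 := normSq_nonneg (A.eval (r : ℂ))
    have p2 := normSq_nonneg (B.eval (r : ℂ))
    exact ⟨normSq_eq_zero.1 (by linarith), normSq_eq_zero.1 (by linarith)⟩
  have hinf : ∀ D : ℂ[X], (∀ r : ℝ, D.eval (r : ℂ) = 0) → D = 0 := fun D hD =>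
    eq_zero_of_infinite_isRoot D ((Set.infinite_range_of_injective ofReal_injective).mono
      (by rintro _ ⟨r, rfl⟩; exact hD r))
  exact ⟨hinf A fun r => (hev r).1, hinf B fun r => (hev r).2⟩

/-! ### The explicit solution -/

/-- A telescoping sum that holds without commutativity; it converts the Sylvester equation into a
statement about `n`-th powers, where the shift vanishes. -/
theorem sum_pow_mul_sub_mul_pow {M : Type*} [Ring M] (P Q N : M) (n : ℕ) :
    ∑ j ∈ Finset.range n, P ^ (n - 1 - j) * (P * N - N * Q) * Q ^ j = P ^ n * N - N * Q ^ n := by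
  induction n with
  | zero => simp
  | succ n ih =>
    rw [Finset.sum_range_succ]
    have h : ∑ j ∈ Finset.range n, P ^ (n + 1 - 1 - j) * (P * N - N * Q) * Q ^ j =
        P * ∑ j ∈ Finset.range n, P ^ (n - 1 - j) * (P * N - N * Q) * Q ^ j := by
      rw [Finset.mul_sum]
      refine Finset.sum_congr rfl fun j hj => ?_
      have := Finset.mem_range.1 hj
      rw [show n + 1 - 1 - j = n - 1 - j + 1 by omega, pow_succ']
      simp only [mul_assoc]
    rw [h, ih, Nat.add_sub_cancel, Nat.sub_self, pow_zero, one_mul, pow_succ', pow_succ' Q]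
    noncomm_ring

/-- A convolution: the two degrees always add up to `k + i - (n - 1)`, and as `i, k < n` every
splitting occurs. The point is that the result is symmetric in `F` and `G`. -/
theorem sum_coeff_mul_coeff {n i k : ℕ} (hi : i < n) (hk : k < n) (F G : PowerSeries ℂ) :
    ∑ j ∈ Finset.range n, coeff k (PowerSeries.X ^ j * G) *
      coeff i (PowerSeries.X ^ (n - 1 - j) * F) =
    coeff (k + i) (PowerSeries.X ^ (n - 1) * (G * F)) := by
  simp only [PowerSeries.coeff_X_pow_mul', ite_mul, mul_ite, zero_mul, mul_zero, ← ite_and]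
  split_ifs with h
  · rw [PowerSeries.coeff_mul, Finset.Nat.sum_antidiagonal_eq_sum_range_succ_mk,
      ← Finset.sum_filter]
    refine Finset.sum_nbij' (fun j => k - j) (fun j => k - j) ?_ ?_ ?_ ?_ ?_
    · intro j hj
      simp only [Finset.mem_filter, Finset.mem_range] at hj ⊢
      omega
    · intro j hj
      simp only [Finset.mem_filter, Finset.mem_range] at hj ⊢
      omega
    · intro j hj
      simp only [Finset.mem_filter, Finset.mem_range] at hj ⊢
      omega
    · intro j hj
      simp only [Finset.mem_range] at hj ⊢
      omega
    · intro j hj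
      simp only [Finset.mem_filter, Finset.mem_range] at hj
      rw [show i - (n - 1 - j) = k + i - (n - 1) - (k - j) by omega]
  · refine Finset.sum_eq_zero fun j hj => if_neg fun h' => ?_
    have := Finset.mem_range.1 hj
    omega

theorem pow_mulVec_trunc {n : ℕ} (z : ℂ) (j : ℕ) (F : PowerSeries ℂ) :
    specMat ℂ n z ^ j *ᵥ trunc n F = trunc n ((cst ℂ z + PowerSeries.X) ^ j * F) := by
  induction j with
  | zero => simp
  | succ j ih => rw [pow_succ', ← mulVec_mulVec, ih, specMat_mulVec_trunc, pow_succ', mul_assoc]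

theorem shift_pow_mulVec_trunc {n : ℕ} (j : ℕ) (F : PowerSeries ℂ) :
    shift ℂ n ^ j *ᵥ trunc n F = trunc n (PowerSeries.X ^ j * F) := by
  induction j with
  | zero => simp
  | succ j ih => rw [pow_succ', ← mulVec_mulVec, ih, shift_mulVec_trunc, pow_succ', mul_assoc]

theorem shift_pow_eq_zero (n : ℕ) : shift ℂ n ^ n = 0 := by
  refine Matrix.ext_of_mulVec_single fun i => ?_
  have h : Pi.single i 1 = trunc n (PowerSeries.monomial (i : ℕ) (1 : ℂ)) := by
    ext k
    simp [trunc, PowerSeries.coeff_monomial, Pi.single_apply, Fin.ext_iff]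
  rw [h, shift_pow_mulVec_trunc, zero_mulVec, trunc_eq_zero_iff]
  exact dvd_mul_right _ _

variable {n : ℕ} {c : ℝ} (hc : c ≠ 0) (z τ : ℂ)

/-- The coefficients of the explicit solution of the interpolation problem. -/
def interpCoeff (n : ℕ) (c : ℝ) (z τ : ℂ) (u : Fin n → ℂ) (j : ℕ) : ℂ :=
  I * c * (star u ⬝ᵥ ((shift ℂ n)ᴴ ^ j *ᵥ ((gramMat n c z τ)⁻¹ *ᵥ trunc n (fSeries c z τ))))

/-- The polynomial with the coefficients `interpCoeff`. -/
def interpPoly (n : ℕ) (c : ℝ) (z τ lam : ℂ) (u : Fin n → ℂ) : ℂ[X] :=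
  ∑ j ∈ Finset.range n, C (interpCoeff n c z τ u j) * (X - C (conj lam)) ^ (n - 1 - j)

theorem natDegree_interpPoly (hn : 1 ≤ n) (lam : ℂ) (u : Fin n → ℂ) :
    (interpPoly n c z τ lam u).natDegree < n := by
  refine lt_of_le_of_lt (natDegree_sum_le_of_forall_le (n := n - 1) _ _ fun j _ => ?_)
    (Nat.sub_lt hn one_pos)
  refine (natDegree_C_mul_le _ _).trans ?_
  rw [natDegree_pow, natDegree_X_sub_C]
  omega

theorem coeff_interpPoly (hn : 1 ≤ n) (lam : ℂ) (u : Fin n → ℂ) :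
    (interpPoly n c z τ lam u).coeff (n - 1) = interpCoeff n c z τ u 0 := by
  rw [interpPoly, finsetSum_coeff, Finset.sum_eq_single 0]
  · have h := (monic_X_sub_C (conj lam)).pow (n - 1)
    have h2 : ((X - C (conj lam)) ^ (n - 1)).natDegree = n - 1 := by
      rw [natDegree_pow, natDegree_X_sub_C, mul_one]
    rw [coeff_C_mul, Nat.sub_zero]
    nth_rw 2 [← h2]
    rw [h.coeff_natDegree, mul_one]
  · intro j hj hj0
    have := Finset.mem_range.1 hj
    rw [coeff_C_mul, coeff_eq_zero_of_natDegree_lt, mul_zero]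
    rw [natDegree_pow, natDegree_X_sub_C]
    omega
  · intro h
    exact absurd (Finset.mem_range.2 hn) h

include hc

/-- The Sylvester equation with a multiple of `N` moved from one side to the other, so that the
nilpotent shift stands on the right. -/
theorem specMat_mul_gramMat : specMat ℂ n (2 * I * c) * gramMat n c z τ -
    gramMat n c z τ * (shift ℂ n)ᴴ = (I * c : ℂ) •
      (vecMulVec (trunc n (fSeries c z τ)) (star (trunc n (fSeries c z τ)))
        + vecMulVec (trunc n (gSeries c z τ)) (star (trunc n (gSeries c z τ)))) := by
  have h := sylvester_gramMat n hc z τ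
  rw [Algebra.algebraMap_self, RingHom.id_apply] at h
  rw [← h, conjTranspose_specMat, specMat, specMat]
  simp only [add_mul, mul_add, smul_mul_assoc, mul_smul_comm, one_mul, mul_one,
    Algebra.algebraMap_self, RingHom.id_apply, map_mul, conj_I, conj_ofReal]
  ext i j
  simp only [Matrix.add_apply, Matrix.sub_apply, Matrix.smul_apply, smul_eq_mul]
  ring

/-- At `λ₀ + s` the factor `λ - λ̄₀` becomes `P = 2ic + s`, and by the Sylvester equation the first
sum telescopes to `Pⁿ N N⁻¹f = Pⁿf`, since `Zⁿ = 0`. In the conjugate polynomials the factor becomes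
`s`, and the second condition is the symmetry of `sum_coeff_mul_coeff` in `f` and `g`. -/
theorem interpolation_solution {lam : ℂ} (hlam : lam - conj lam = 2 * I * c) :
    PowerSeries.X ^ n ∣
      shiftEval lam (interpPoly n c z τ lam (trunc n (fSeries c z τ)) - (X - C (conj lam)) ^ n) *
        fSeries c z τ +
      shiftEval lam (interpPoly n c z τ lam (trunc n (gSeries c z τ))) * gSeries c z τ ∧
    PowerSeries.X ^ n ∣
      shiftEval lam (conjPoly (interpPoly n c z τ lam (trunc n (gSeries c z τ)))) *
        fSeries c z τ -
      shiftEval lam (conjPoly (interpPoly n c z τ lam (trunc n (fSeries c z τ)) -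
        (X - C (conj lam)) ^ n)) * gSeries c z τ := by
  have hp : shiftEval lam (X - C (conj lam)) = cst ℂ (2 * I * c) + PowerSeries.X := by
    rw [shiftEval, map_sub, aeval_X, aeval_C, ← hlam, sub_eq_add_neg lam, cst_add, cst_neg]
    simp only [cst, PowerSeries.algebraMap_apply]
    ring
  have hpc : shiftEval lam (conjPoly (X - C (conj lam))) = PowerSeries.X := by
    rw [shiftEval, conjPoly, coe_mapRingHom, Polynomial.map_sub, map_X, map_C, conj_conj, map_sub,
      aeval_X, aeval_C]
    simp only [cst, PowerSeries.algebraMap_apply]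
    ring
  have hC : ∀ r : ℂ, shiftEval lam (C r) = cst ℂ r := fun r => by
    rw [shiftEval, aeval_C]
    simp only [cst, PowerSeries.algebraMap_apply]
  have hCc : ∀ r : ℂ, conjPoly (C r) = C (conj r) := fun r => by
    rw [conjPoly, coe_mapRingHom, map_C]
  set f := trunc n (fSeries c z τ) with hf
  set g := trunc n (gSeries c z τ) with hg
  set N := gramMat n c z τ with hN
  set Z := shift ℂ n
  set P := specMat ℂ n (2 * I * c)
  have hw : N *ᵥ (N⁻¹ *ᵥ f) = f := by
    rw [mulVec_mulVec, mul_nonsing_inv _ (det_gramMat_ne_zero n hc z τ).isUnit, one_mulVec]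
  constructor
  · rw [← trunc_eq_zero_iff]
    simp only [interpPoly, map_sub, map_sum, map_mul, map_pow, hp, hC, sub_mul, Finset.sum_mul]
    have htr : ∀ (u : ℂ) (j : ℕ) (F : PowerSeries ℂ),
        trunc n (cst ℂ u * (cst ℂ (2 * I * c) + PowerSeries.X) ^ j * F) =
          u • (P ^ j *ᵥ trunc n F) := by
      intro u j F
      rw [mul_assoc, trunc_cst_mul, pow_mulVec_trunc]
      rfl
    have hsum : ∀ H : ℕ → PowerSeries ℂ, trunc n (∑ j ∈ Finset.range n, H j) =
        ∑ j ∈ Finset.range n, trunc n (H j) := by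
      intro H
      ext i
      simp [trunc]
    rw [trunc_add, trunc_sub, hsum, hsum]
    simp only [htr]
    rw [← pow_mulVec_trunc, ← hf, ← hg, sub_add_eq_add_sub, ← Finset.sum_add_distrib, sub_eq_zero]
    have hterm : ∀ j ∈ Finset.range n, interpCoeff n c z τ f j • P ^ (n - 1 - j) *ᵥ f +
        interpCoeff n c z τ g j • P ^ (n - 1 - j) *ᵥ g =
        (P ^ (n - 1 - j) * (P * N - N * Zᴴ) * Zᴴ ^ j) *ᵥ (N⁻¹ *ᵥ f) := by
      intro j _
      rw [specMat_mul_gramMat hc, ← hf, ← hg, ← mulVec_mulVec, ← mulVec_mulVec, smul_mulVec,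
        add_mulVec, vecMulVec_mulVec, vecMulVec_mulVec, mulVec_smul, mulVec_add]
      simp only [interpCoeff, op_smul_eq_smul, mulVec_smul, smul_add, smul_smul]
      rfl
    rw [Finset.sum_congr rfl hterm, ← sum_mulVec, sum_pow_mul_sub_mul_pow,
      ← conjTranspose_pow Z, shift_pow_eq_zero, conjTranspose_zero, mul_zero, sub_zero,
      ← mulVec_mulVec, hw]
  · have hstar : ∀ u : PowerSeries ℂ, ∀ j, conj (interpCoeff n c z τ (trunc n u) j) =
        -(I * c) * ∑ k : Fin n, star ((N⁻¹ *ᵥ f) k) * coeff (k : ℕ) (PowerSeries.X ^ j * u) := by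
      intro u j
      have h1 : conj (star (trunc n u) ⬝ᵥ (Zᴴ ^ j *ᵥ (N⁻¹ *ᵥ f))) =
          star (N⁻¹ *ᵥ f) ⬝ᵥ trunc n (PowerSeries.X ^ j * u) := by
        rw [← shift_pow_mulVec_trunc, ← conjTranspose_pow, starRingEnd_apply, ← star_dotProduct_star,
          star_star, star_mulVec, conjTranspose_conjTranspose, ← dotProduct_mulVec]
      rw [interpCoeff, map_mul, h1]
      simp only [map_mul, conj_I, conj_ofReal, neg_mul]
      rfl
    have hA : shiftEval lam (conjPoly (interpPoly n c z τ lam f - (X - C (conj lam)) ^ n)) =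
        ∑ j ∈ Finset.range n, cst ℂ (conj (interpCoeff n c z τ f j)) * PowerSeries.X ^ (n - 1 - j)
          - PowerSeries.X ^ n := by
      rw [map_sub, map_sub, map_pow, map_pow, hpc]
      simp only [interpPoly, map_sum, map_mul, map_pow, hCc, hC, hpc]
    have hB : shiftEval lam (conjPoly (interpPoly n c z τ lam g)) =
        ∑ j ∈ Finset.range n, cst ℂ (conj (interpCoeff n c z τ g j)) *
          PowerSeries.X ^ (n - 1 - j) := by
      simp only [interpPoly, map_sum, map_mul, map_pow, hCc, hC, hpc]
    rw [hA, hB, sub_mul, ← sub_add]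
    refine dvd_add ?_ (dvd_mul_right _ _)
    rw [PowerSeries.X_pow_dvd_iff]
    intro i hi
    rw [map_sub, sub_eq_zero]
    simp only [Finset.sum_mul, map_sum, mul_assoc, cst, PowerSeries.coeff_C_mul,
      Algebra.algebraMap_self, RingHom.id_apply, hstar, hf, hg]
    simp only [← Finset.mul_sum]
    congr 1
    rw [Finset.sum_comm, Finset.sum_comm (s := Finset.range n)]
    refine Finset.sum_congr rfl fun k _ => ?_
    rw [← Finset.mul_sum, ← Finset.mul_sum, sum_coeff_mul_coeff hi k.2, sum_coeff_mul_coeff hi k.2,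
      mul_comm (fSeries c z τ)]

end Interpolation

end

end Manakov

namespace Manakov

noncomputable section

/-! ### The determinants by Cramer's rule. -/

section Determinants

open Matrix Polynomial
open PowerSeries (coeff)

theorem iteratedDeriv_conj (f : ℝ → ℂ) (k : ℕ) (x : ℝ) :
    iteratedDeriv k (fun y => conj (f y)) x = conj (iteratedDeriv k f x) := by
  induction k generalizing x with
  | zero => simp
  | succ k ih =>
    rw [iteratedDeriv_succ, iteratedDeriv_succ, funext ih]
    exact deriv.star

/-- Conjugation in the last two rows of a block. -/
def twist (r : Fin 3) : ℂ →+* ℂ := if r = 0 then RingHom.id ℂ else starRingEnd ℂ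

theorem twist_twist (r : Fin 3) (y : ℂ) : twist r (twist r y) = y := by
  unfold twist
  split_ifs <;> simp

/-- The rows of a block, before the conjugation `twist`. -/
def blockSeries (c₁ c₂ : ℝ) (z τ : ℂ) : Matrix (Fin 3) (Fin 3) (PowerSeries ℂ) :=
  !![component c₁ c₂ z τ 0, component c₁ c₂ z τ 1, component c₁ c₂ z τ 2;
     -component c₁ c₂ z τ 1, component c₁ c₂ z τ 0, 0;
     -component c₁ c₂ z τ 2, 0, component c₁ c₂ z τ 0]

/-- The second and third rows are conjugates of expressions holomorphic in the series, so
differentiation reduces to the first row followed by `twist`. -/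
theorem iteratedDeriv_block (m : ℕ) (a : ℝ) {c₁ c₂ : ℝ} (hc : c₁ ≠ 0 ∨ c₂ ≠ 0) (x t : ℝ)
    (r q : Fin 3) (l k : ℕ) :
    iteratedDeriv (2 * k + 1 + m)
      (fun ε => rowLam a c₁ c₂ ε r ^ l * block m a c₁ c₂ x t ε r q) 0 =
    ((2 * k + 1 + m).factorial : ℂ) * twist r (coeff k (2 * rootSeries (amp c₁ c₂) *
      (shiftEval (lam₀ a c₁ c₂) (X ^ l) *
        blockSeries c₁ c₂ (x - 2 * a * t + 2 * I * amp c₁ c₂ * t) t r q))) := by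
  have h := fun q => iteratedDeriv_lam_mul m a hc x t q l k
  have hX : shiftEval (lam₀ a c₁ c₂) (X ^ l) = (cst ℂ (lam₀ a c₁ c₂) + PowerSeries.X) ^ l := by
    rw [map_pow, shiftEval, aeval_X]
  have hneg : ∀ q, iteratedDeriv (2 * k + 1 + m)
      (fun ε => conj (lam a c₁ c₂ ε) ^ l * -conj (block m a c₁ c₂ x t ε 0 q)) 0 =
      -conj (iteratedDeriv (2 * k + 1 + m)
        (fun ε => lam a c₁ c₂ ε ^ l * block m a c₁ c₂ x t ε 0 q) 0) := by
    intro q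
    rw [← iteratedDeriv_conj, ← iteratedDeriv_fun_neg]
    simp only [map_mul, map_pow, mul_neg]
  have hpos : ∀ q, iteratedDeriv (2 * k + 1 + m)
      (fun ε => conj (lam a c₁ c₂ ε) ^ l * conj (block m a c₁ c₂ x t ε 0 q)) 0 =
      conj (iteratedDeriv (2 * k + 1 + m)
        (fun ε => lam a c₁ c₂ ε ^ l * block m a c₁ c₂ x t ε 0 q) 0) := by
    intro q
    rw [← iteratedDeriv_conj]
    simp only [map_mul, map_pow]
  have hzero : iteratedDeriv (2 * k + 1 + m)
      (fun ε => conj (lam a c₁ c₂ ε) ^ l * (0 : ℂ)) 0 = 0 := by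
    simp
  rw [hX]
  fin_cases r
  · fin_cases q
    · exact h 0
    · exact h 1
    · exact h 2
  · fin_cases q
    · refine (hneg 1).trans ?_
      rw [h]
      simp [twist, blockSeries]
    · refine (hpos 0).trans ?_
      rw [h]
      simp [twist, blockSeries]
    · refine hzero.trans ?_
      simp [twist, blockSeries]
  · fin_cases q
    · refine (hneg 2).trans ?_
      rw [h]
      simp [twist, blockSeries]
    · refine hzero.trans ?_
      simp [twist, blockSeries]
    · refine (hpos 0).trans ?_
      rw [h]
      simp [twist, blockSeries]

/-- The combination of the `r`-th row of a block with polynomial coefficients. -/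
def residual (c₁ c₂ : ℝ) (lam z τ : ℂ) (r : Fin 3) (T : Fin 3 → ℂ[X]) : PowerSeries ℂ :=
  ∑ q, shiftEval lam ((T q).map (twist r)) * blockSeries c₁ c₂ z τ r q

/-- The rows of `omega` as linear functionals of the polynomial coefficients. -/
def rowForm (m : ℕ) (a c₁ c₂ x t : ℝ) (k : ℕ) (r : Fin 3) : (Fin 3 → ℂ[X]) →ₗ[ℂ] ℂ where
  toFun T := ((2 * k + 1 + m).factorial : ℂ) * twist r (coeff k (2 * rootSeries (amp c₁ c₂) *
    residual c₁ c₂ (lam₀ a c₁ c₂) (x - 2 * a * t + 2 * I * amp c₁ c₂ * t) t r T))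
  map_add' S T := by
    simp only [residual, Pi.add_apply, Polynomial.map_add, map_add, add_mul, Finset.sum_add_distrib,
      mul_add]
  map_smul' y T := by
    have h : residual c₁ c₂ (lam₀ a c₁ c₂) (x - 2 * a * t + 2 * I * amp c₁ c₂ * t) t r (y • T) =
        twist r y • residual c₁ c₂ (lam₀ a c₁ c₂) (x - 2 * a * t + 2 * I * amp c₁ c₂ * t) t r T := by
      simp only [residual, Pi.smul_apply, Polynomial.map_smul, map_smul, smul_mul_assoc,
        Finset.smul_sum]
    rw [h, mul_smul_comm, map_smul, smul_eq_mul, map_mul, twist_twist, RingHom.id_apply,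
      smul_eq_mul]
    ring

theorem rowForm_apply (m : ℕ) (a c₁ c₂ x t : ℝ) (k : ℕ) (r : Fin 3) (T : Fin 3 → ℂ[X]) :
    rowForm m a c₁ c₂ x t k r T =
      ((2 * k + 1 + m).factorial : ℂ) * twist r (coeff k (2 * rootSeries (amp c₁ c₂) *
        residual c₁ c₂ (lam₀ a c₁ c₂) (x - 2 * a * t + 2 * I * amp c₁ c₂ * t) t r T)) := rfl

/-- The polynomial coefficients belonging to a single column. -/
def colPoly (p : ℕ × Fin 3) : Fin 3 → ℂ[X] := Pi.single p.2 (X ^ p.1)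

variable {n : ℕ} (m : ℕ) (a : ℝ) {c₁ c₂ : ℝ} (hc : c₁ ≠ 0 ∨ c₂ ≠ 0) (x t : ℝ)

theorem omega_apply (hc : c₁ ≠ 0 ∨ c₂ ≠ 0) (col : ℕ → ℕ → ℕ × Fin 3) (i j : Fin (3 * n)) :
    omega col n m a c₁ c₂ x t i j =
      rowForm m a c₁ c₂ x t ((i : ℕ) / 3) (Fin.ofNat 3 i) (colPoly (col n j)) := by
  rw [omega, Matrix.of_apply, iteratedDeriv_block m a hc]
  simp only [rowForm_apply, residual, colPoly]
  rw [Finset.sum_eq_single (col n j).2]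
  · simp
  · intro q _ hq
    simp [hq]
  · simp

/-- The polynomial coefficients belonging to a vector of column coefficients. -/
def vecPoly (y : Fin (3 * n) → ℂ) : Fin 3 → ℂ[X] := ∑ j, y j • colPoly (col₂ n j)

theorem omega_mulVec (hc : c₁ ≠ 0 ∨ c₂ ≠ 0) (y : Fin (3 * n) → ℂ) (i : Fin (3 * n)) :
    (omega col₂ n m a c₁ c₂ x t *ᵥ y) i =
      rowForm m a c₁ c₂ x t ((i : ℕ) / 3) (Fin.ofNat 3 i) (vecPoly y) := by
  rw [vecPoly, map_sum]
  simp only [mulVec, dotProduct, omega_apply m a x t hc, map_smul, smul_eq_mul]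
  exact Finset.sum_congr rfl fun j _ => mul_comm _ _

theorem coeff_vecPoly (y : Fin (3 * n) → ℂ) (q : Fin 3) (l : ℕ) :
    (vecPoly y q).coeff l = if h : 3 * l + q < 3 * n then y ⟨3 * l + q, h⟩ else 0 := by
  have h1 : (vecPoly y q).coeff l =
      ∑ j : Fin (3 * n), if (j : ℕ) = 3 * l + q then y j else 0 := by
    rw [vecPoly, Finset.sum_apply, finsetSum_coeff]
    refine Finset.sum_congr rfl fun j _ => ?_
    have hq : (q : ℕ) < 3 := q.2
    simp only [colPoly, col₂, Pi.smul_apply, Pi.single_apply, Polynomial.coeff_smul, smul_eq_mul]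
    by_cases hj : (j : ℕ) = 3 * l + q
    · have e1 : q = Fin.ofNat 3 (j : ℕ) := by
        ext; simp only [Fin.val_ofNat]; omega
      have e2 : (j : ℕ) / 3 = l := by omega
      rw [if_pos e1, if_pos hj, e2, coeff_X_pow_self, mul_one]
    · rw [if_neg hj]
      split_ifs with e1
      · have e2 : l ≠ (j : ℕ) / 3 := by
          rintro rfl
          have := congrArg Fin.val e1
          simp only [Fin.val_ofNat] at this
          omega
        rw [coeff_X_pow, if_neg e2, mul_zero]
      · simp
  rw [h1]
  split_ifs with h
  · rw [Finset.sum_eq_single ⟨3 * l + q, h⟩]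
    · simp
    · intro j _ hj
      exact if_neg fun h' => hj (Fin.ext h')
    · simp
  · refine Finset.sum_eq_zero fun j _ => if_neg fun h' => h ?_
    rw [← h']
    exact j.2

theorem natDegree_vecPoly (hn : 1 ≤ n) (y : Fin (3 * n) → ℂ) (q : Fin 3) :
    (vecPoly y q).natDegree < n := by
  refine lt_of_le_of_lt (natDegree_le_iff_coeff_eq_zero.2 fun l hl => ?_) (Nat.sub_lt hn one_pos)
  rw [coeff_vecPoly, dif_neg]
  omega

theorem vecPoly_eq_zero {y : Fin (3 * n) → ℂ} (h : vecPoly y = 0) : y = 0 := by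
  ext j
  have hj := coeff_vecPoly y (Fin.ofNat 3 (j : ℕ)) ((j : ℕ) / 3)
  have e : 3 * ((j : ℕ) / 3) + (Fin.ofNat 3 (j : ℕ) : ℕ) = j := by
    simp only [Fin.val_ofNat]; omega
  rw [h] at hj
  simp only [e, Fin.is_lt, dite_true, Fin.eta] at hj
  simpa using hj.symm

/-- The vector of column coefficients belonging to three polynomials. -/
def polyVec (n : ℕ) (T : Fin 3 → ℂ[X]) : Fin (3 * n) → ℂ :=
  fun j => (T (Fin.ofNat 3 (j : ℕ))).coeff ((j : ℕ) / 3)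

theorem vecPoly_polyVec {T : Fin 3 → ℂ[X]} (hT : ∀ q, (T q).natDegree < n) :
    vecPoly (polyVec n T) = T := by
  ext q l
  rw [coeff_vecPoly]
  have hq : (q : ℕ) < 3 := q.2
  split_ifs with h
  · have e1 : Fin.ofNat 3 (3 * l + q) = q := by ext; simp only [Fin.val_ofNat]; omega
    have e2 : (3 * l + q) / 3 = l := by omega
    simp only [polyVec, e1, e2]
  · exact (coeff_eq_zero_of_natDegree_lt ((hT q).trans_le (by omega))).symm

include hc

theorem X_pow_dvd_residual {T : Fin 3 → ℂ[X]}
    (h : ∀ i : Fin (3 * n), rowForm m a c₁ c₂ x t ((i : ℕ) / 3) (Fin.ofNat 3 i) T = 0) (r : Fin 3) :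
    PowerSeries.X ^ n ∣
      residual c₁ c₂ (lam₀ a c₁ c₂) (x - 2 * a * t + 2 * I * amp c₁ c₂ * t) t r T := by
  have hF : PowerSeries.constantCoeff (2 * rootSeries (amp c₁ c₂)) ≠ 0 := by
    rw [map_mul, map_ofNat]
    exact mul_ne_zero two_ne_zero (constantCoeff_rootSeries_ne_zero (amp_pos hc))
  refine dvd_of_dvd_unit_mul hF (PowerSeries.X_pow_dvd_iff.2 fun k hk => ?_)
  have hr : (r : ℕ) < 3 := r.2
  have hi := h ⟨3 * k + r, by omega⟩
  have e1 : Fin.ofNat 3 (3 * k + r) = r := by ext; simp only [Fin.val_ofNat]; omega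
  have e2 : (3 * k + r) / 3 = k := by omega
  simp only [e1, e2, rowForm_apply] at hi
  rcases mul_eq_zero.1 hi with h' | h'
  · exact absurd h' (by exact_mod_cast (Nat.factorial_pos _).ne')
  · rwa [map_eq_zero] at h'

omit hc in
theorem rowForm_eq_zero {T : Fin 3 → ℂ[X]} {k : ℕ} (hk : k < n) (r : Fin 3)
    (h : PowerSeries.X ^ n ∣
      residual c₁ c₂ (lam₀ a c₁ c₂) (x - 2 * a * t + 2 * I * amp c₁ c₂ * t) t r T) :
    rowForm m a c₁ c₂ x t k r T = 0 := by
  rw [rowForm_apply, PowerSeries.X_pow_dvd_iff.1 (h.mul_left _) k hk, map_zero, mul_zero]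

theorem sq_add_sq_div_amp : ((c₁ : ℂ) / amp c₁ c₂) ^ 2 + ((c₂ : ℂ) / amp c₁ c₂) ^ 2 = 1 := by
  have h : (c₁ / amp c₁ c₂) ^ 2 + (c₂ / amp c₁ c₂) ^ 2 = 1 := by
    rw [div_pow, div_pow, ← add_div, ← amp_sq, div_self (pow_ne_zero 2 (amp_pos hc).ne')]
  exact_mod_cast h

omit hc in
theorem residual_zero (lam z τ : ℂ) (T : Fin 3 → ℂ[X]) : residual c₁ c₂ lam z τ 0 T =
    shiftEval lam (T 0) * fSeries (amp c₁ c₂) z τ +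
      shiftEval lam (C ((c₁ : ℂ) / amp c₁ c₂) * T 1 + C ((c₂ : ℂ) / amp c₁ c₂) * T 2) *
        gSeries (amp c₁ c₂) z τ := by
  have h : twist 0 = RingHom.id ℂ := rfl
  have hC : ∀ r : ℂ, shiftEval lam (C r) = cst ℂ r := fun r => by rw [shiftEval, aeval_C]; rfl
  simp only [residual, Fin.sum_univ_three, h, Polynomial.map_id, map_add, map_mul, hC]
  simp only [blockSeries, component, of_apply, cons_val_zero, cons_val_one, cons_val]
  ring

omit hc in
theorem residual_one (lam z τ : ℂ) (T : Fin 3 → ℂ[X]) : residual c₁ c₂ lam z τ 1 T =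
    shiftEval lam (conjPoly (T 1)) * fSeries (amp c₁ c₂) z τ -
      cst ℂ ((c₁ : ℂ) / amp c₁ c₂) * shiftEval lam (conjPoly (T 0)) *
        gSeries (amp c₁ c₂) z τ := by
  have h : ∀ A : ℂ[X], A.map (twist 1) = conjPoly A := fun _ => rfl
  simp only [residual, Fin.sum_univ_three, h]
  simp only [blockSeries, component, of_apply, cons_val_zero, cons_val_one, cons_val]
  ring

omit hc in
theorem residual_two (lam z τ : ℂ) (T : Fin 3 → ℂ[X]) : residual c₁ c₂ lam z τ 2 T =
    shiftEval lam (conjPoly (T 2)) * fSeries (amp c₁ c₂) z τ -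
      cst ℂ ((c₂ : ℂ) / amp c₁ c₂) * shiftEval lam (conjPoly (T 0)) *
        gSeries (amp c₁ c₂) z τ := by
  have h : ∀ A : ℂ[X], A.map (twist 2) = conjPoly A := fun _ => rfl
  simp only [residual, Fin.sum_univ_three, h]
  simp only [blockSeries, component, of_apply, cons_val_zero, cons_val_one, cons_val]
  ring

/-- The last two conditions, weighted by `c₁/c` and `c₂/c`, combine to the scalar interpolation
problem and give `T 0 = 0`. They then decouple and force `T 1 = T 2 = 0`. The assumption `z ≠ 0`
makes `f` a unit. -/
theorem eq_zero_of_residual {lam z τ : ℂ} (hlam : lam.im ≠ 0) (hz : z ≠ 0) {T : Fin 3 → ℂ[X]}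
    (hT : ∀ q, (T q).natDegree < n)
    (h : ∀ r, PowerSeries.X ^ n ∣ residual c₁ c₂ lam z τ r T) : T = 0 := by
  have hF : PowerSeries.constantCoeff (fSeries (amp c₁ c₂) z τ) ≠ 0 := by
    rw [← PowerSeries.coeff_zero_eq_constantCoeff_apply, fSeries, coeff_zero_sinhSeries]
    exact hz
  have h0 := h 0
  have h1 := h 1
  have h2 := h 2
  rw [residual_zero] at h0
  rw [residual_one] at h1
  rw [residual_two] at h2
  set α := (c₁ : ℂ) / amp c₁ c₂ with hα
  set β := (c₂ : ℂ) / amp c₁ c₂ with hβ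
  have hsq : α ^ 2 + β ^ 2 = 1 := sq_add_sq_div_amp hc
  have hαc : conj α = α := by rw [hα, map_div₀, conj_ofReal, conj_ofReal]
  have hβc : conj β = β := by rw [hβ, map_div₀, conj_ofReal, conj_ofReal]
  have hC : ∀ r : ℂ, shiftEval lam (C r) = cst ℂ r := fun r => by rw [shiftEval, aeval_C]; rfl
  have hCc : ∀ r : ℂ, conjPoly (C r) = C (conj r) := fun r => by
    rw [conjPoly, coe_mapRingHom, map_C]
  have hcst : cst ℂ α ^ 2 + cst ℂ β ^ 2 = 1 := by
    rw [← hC, ← hC]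
    simp only [← map_pow, ← map_add, hsq, map_one]
  have hB : (C α * T 1 + C β * T 2).natDegree < n := by
    have e1 := natDegree_C_mul_le α (T 1)
    have e2 := natDegree_C_mul_le β (T 2)
    exact (natDegree_add_le _ _).trans_lt
      (max_lt (e1.trans_lt (hT 1)) (e2.trans_lt (hT 2)))
  obtain ⟨hA, -⟩ := interpolation_unique hlam hF (hT 0) hB h0 (by
    convert dvd_add (h1.mul_left (cst ℂ α)) (h2.mul_left (cst ℂ β)) using 1
    simp only [map_add, map_mul, hCc, hC, hαc, hβc]
    linear_combination shiftEval lam (conjPoly (T 0)) * gSeries (amp c₁ c₂) z τ * hcst)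
  have hzero : ∀ A : ℂ[X], A.natDegree < n →
      PowerSeries.X ^ n ∣ shiftEval lam (conjPoly A) * fSeries (amp c₁ c₂) z τ → A = 0 := by
    intro A hd hA
    rw [mul_comm] at hA
    rw [← conjPoly_conjPoly A, eq_zero_of_shiftEval (by rwa [natDegree_conjPoly])
      (dvd_of_dvd_unit_mul hF hA), map_zero]
  rw [hA, map_zero, map_zero, mul_zero, zero_mul, sub_zero] at h1 h2
  ext1 q
  fin_cases q
  · exact hA
  · exact hzero _ (hT 1) h1
  · exact hzero _ (hT 2) h2

omit hc in
theorem lam₀_im : (lam₀ a c₁ c₂).im = amp c₁ c₂ := by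
  simp [lam₀, amp]

/-- A kernel vector is a triple of polynomials of degree below `n` solving the homogeneous
interpolation problem; `z = 0` only at the origin. -/
theorem det_omega_ne_zero (hn : 1 ≤ n) (hxt : (x, t) ≠ (0, 0)) :
    (omega col₂ n m a c₁ c₂ x t).det ≠ 0 := by
  have hcp := amp_pos hc
  intro hdet
  obtain ⟨y, hy, h⟩ := exists_mulVec_eq_zero_iff.2 hdet
  refine hy (vecPoly_eq_zero (eq_zero_of_residual hc (lam := lam₀ a c₁ c₂)
    (z := x - 2 * a * t + 2 * I * amp c₁ c₂ * t) (τ := t) ?_ ?_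
    (natDegree_vecPoly hn y) (X_pow_dvd_residual m a hc x t fun i => ?_)))
  · rw [lam₀_im]
    exact hcp.ne'
  · intro hz
    have him := congrArg Complex.im hz
    have hre := congrArg Complex.re hz
    simp at him hre
    have ht : t = 0 := by
      rcases him with h | h
      · exact absurd h hcp.ne'
      · exact h
    refine hxt ?_
    rw [ht] at hre ⊢
    simpa using hre
  · rw [← omega_mulVec m a x t hc, h, Pi.zero_apply]

/-- The polynomials solving the linear system with matrix `omega col₂` whose right hand side is the
column of type `λⁿ f`. -/
def solPoly (n : ℕ) (a c₁ c₂ : ℝ) (z τ : ℂ) : Fin 3 → ℂ[X] :=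
  let c := amp c₁ c₂
  let lam := lam₀ a c₁ c₂
  ![interpPoly n c z τ lam (trunc n (fSeries c z τ)) - (X - C (conj lam)) ^ n + X ^ n,
    C ((c₁ : ℂ) / c) * interpPoly n c z τ lam (trunc n (gSeries c z τ)),
    C ((c₂ : ℂ) / c) * interpPoly n c z τ lam (trunc n (gSeries c z τ))]

omit hc in
theorem natDegree_solPoly (hn : 1 ≤ n) (z τ : ℂ) (q : Fin 3) :
    (solPoly n a c₁ c₂ z τ q).natDegree < n := by
  have h := natDegree_interpPoly (n := n) (c := amp c₁ c₂) z τ hn (lam₀ a c₁ c₂)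
  have hg := fun y : ℂ => (natDegree_C_mul_le y _).trans_lt
    (h (trunc n (gSeries (amp c₁ c₂) z τ)))
  fin_cases q
  -- Both powers are monic of degree `n`, so their difference has degree below `n`.
  · have hlt : ((X - C (conj (lam₀ a c₁ c₂))) ^ n - X ^ n).natDegree < n :=
      IsMonicOfDegree.natDegree_sub_lt (Nat.one_le_iff_ne_zero.1 hn)
        ⟨by rw [natDegree_pow, natDegree_X_sub_C, mul_one], (monic_X_sub_C _).pow n⟩
        ⟨natDegree_X_pow n, monic_X_pow n⟩
    have e : solPoly n a c₁ c₂ z τ 0 = interpPoly n (amp c₁ c₂) z τ (lam₀ a c₁ c₂)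
        (trunc n (fSeries (amp c₁ c₂) z τ)) - ((X - C (conj (lam₀ a c₁ c₂))) ^ n - X ^ n) := by
      simp only [solPoly, cons_val_zero]
      ring
    exact e ▸ (natDegree_sub_le _ _).trans_lt (max_lt (h _) hlt)
  · exact hg _
  · exact hg _

/-- After subtraction of the column `λⁿf` the triple is `(A, (c₁/c) B, (c₂/c) B)` with `(A, B)` from
`interpolation_solution`; the identity `(c₁/c)² + (c₂/c)² = 1` recovers `B` in the first row. -/
theorem omega_mulVec_polyVec (hn : 1 ≤ n) (i : Fin (3 * n)) :
    (omega col₂ n m a c₁ c₂ x t *ᵥ polyVec n (solPoly n a c₁ c₂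
      (x - 2 * a * t + 2 * I * amp c₁ c₂ * t) t)) i =
      rowForm m a c₁ c₂ x t ((i : ℕ) / 3) (Fin.ofNat 3 i) (colPoly (n, 0)) := by
  rw [omega_mulVec m a x t hc, vecPoly_polyVec (natDegree_solPoly a hn _ _), ← sub_eq_zero,
    ← map_sub]
  refine rowForm_eq_zero m a x t (n := n) (by omega) _ ?_
  set z : ℂ := x - 2 * a * t + 2 * I * amp c₁ c₂ * t
  have hlam : lam₀ a c₁ c₂ - conj (lam₀ a c₁ c₂) = 2 * I * amp c₁ c₂ := by
    rw [sub_conj, lam₀_im]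
    push_cast
    ring
  obtain ⟨h1, h2⟩ := interpolation_solution (n := n) (amp_pos hc).ne' z t hlam
  set A := interpPoly n (amp c₁ c₂) z t (lam₀ a c₁ c₂) (trunc n (fSeries (amp c₁ c₂) z t)) -
    (X - C (conj (lam₀ a c₁ c₂))) ^ n
  set B := interpPoly n (amp c₁ c₂) z t (lam₀ a c₁ c₂) (trunc n (gSeries (amp c₁ c₂) z t))
  have hT : solPoly n a c₁ c₂ z t - colPoly (n, 0) =
      ![A, C ((c₁ : ℂ) / amp c₁ c₂) * B, C ((c₂ : ℂ) / amp c₁ c₂) * B] := by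
    ext1 q
    fin_cases q
    · simp [solPoly, colPoly, A]
    · simp [solPoly, colPoly, B]
    · simp [solPoly, colPoly, B]
  have hC : ∀ r : ℂ, shiftEval (lam₀ a c₁ c₂) (C r) = cst ℂ r := fun r => by
    rw [shiftEval, aeval_C]; rfl
  have hCc : ∀ r : ℝ, conjPoly (C ((r : ℂ) / amp c₁ c₂)) = C ((r : ℂ) / amp c₁ c₂) := fun r => by
    rw [conjPoly, coe_mapRingHom, map_C, map_div₀, conj_ofReal, conj_ofReal]
  have hB : C ((c₁ : ℂ) / amp c₁ c₂) * (C ((c₁ : ℂ) / amp c₁ c₂) * B) +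
      C ((c₂ : ℂ) / amp c₁ c₂) * (C ((c₂ : ℂ) / amp c₁ c₂) * B) = B := by
    rw [← mul_assoc, ← mul_assoc, ← add_mul, ← C_mul, ← C_mul, ← C_add, ← sq, ← sq,
      sq_add_sq_div_amp hc, C_1, one_mul]
  have hres : ∀ r, PowerSeries.X ^ n ∣ residual c₁ c₂ (lam₀ a c₁ c₂) z t r
      ![A, C ((c₁ : ℂ) / amp c₁ c₂) * B, C ((c₂ : ℂ) / amp c₁ c₂) * B] := by
    intro r
    fin_cases r
    · change _ ∣ residual _ _ _ _ _ 0 _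
      rw [residual_zero]
      simp only [cons_val_zero, cons_val_one, cons_val, hB]
      exact h1
    · change _ ∣ residual _ _ _ _ _ 1 _
      rw [residual_one]
      simp only [cons_val_zero, cons_val_one, map_mul, hCc, hC]
      rw [mul_assoc, mul_assoc, ← mul_sub]
      exact h2.mul_left _
    · change _ ∣ residual _ _ _ _ _ 2 _
      rw [residual_two]
      simp only [cons_val_zero, cons_val, map_mul, hCc, hC]
      rw [mul_assoc, mul_assoc, ← mul_sub]
      exact h2.mul_left _
  rw [hT]
  exact hres _

theorem det_updateCol_omega (hn : 1 ≤ n) (j : Fin (3 * n)) :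
    ((omega col₂ n m a c₁ c₂ x t).updateCol j fun i =>
      rowForm m a c₁ c₂ x t ((i : ℕ) / 3) (Fin.ofNat 3 i) (colPoly (n, 0))).det =
      (omega col₂ n m a c₁ c₂ x t).det * polyVec n (solPoly n a c₁ c₂
        (x - 2 * a * t + 2 * I * amp c₁ c₂ * t) t) j := by
  rw [← cramer_apply, ← funext (omega_mulVec_polyVec m a hc x t hn), cramer_eq_adjugate_mulVec,
    mulVec_mulVec, adjugate_mul, smul_mulVec, one_mulVec, Pi.smul_apply, smul_eq_mul]

theorem det_omega_col₃ (hn : 1 ≤ n) : (omega col₃ n m a c₁ c₂ x t).det =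
    (omega col₂ n m a c₁ c₂ x t).det * polyVec n (solPoly n a c₁ c₂
        (x - 2 * a * t + 2 * I * amp c₁ c₂ * t) t) ⟨3 * n - 1, by omega⟩ := by
  rw [← det_updateCol_omega m a hc x t hn]
  congr 1
  ext i j
  rw [updateCol_apply, omega_apply m a x t hc, omega_apply m a x t hc]
  by_cases hj : j = ⟨3 * n - 1, by omega⟩
  · rw [if_pos hj, hj, col₃, if_pos (by simp only; omega)]
  · have : (j : ℕ) ≠ 3 * n - 1 := fun h => hj (Fin.ext h)
    rw [if_neg hj, col₃, if_neg (by omega)]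

/-- Replacing the column `λⁿ⁻¹g` by `λⁿf` leaves the last two columns in the wrong order; the
transposition is the source of the sign. -/
theorem det_omega_col₁ (hn : 1 ≤ n) : (omega col₁ n m a c₁ c₂ x t).det =
    -((omega col₂ n m a c₁ c₂ x t).det * polyVec n (solPoly n a c₁ c₂
        (x - 2 * a * t + 2 * I * amp c₁ c₂ * t) t) ⟨3 * n - 2, by omega⟩) := by
  set j₁ : Fin (3 * n) := ⟨3 * n - 2, by omega⟩ with hj₁
  set j₂ : Fin (3 * n) := ⟨3 * n - 1, by omega⟩ with hj₂
  have hne : j₁ ≠ j₂ := by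
    rw [hj₁, hj₂, Ne, Fin.mk.injEq]
    omega
  rw [← det_updateCol_omega m a hc x t hn, ← neg_one_mul]
  have h := det_permute' (Equiv.swap j₁ j₂) ((omega col₂ n m a c₁ c₂ x t).updateCol j₁ fun i =>
      rowForm m a c₁ c₂ x t ((i : ℕ) / 3) (Fin.ofNat 3 i) (colPoly (n, 0)))
  rw [Equiv.Perm.sign_swap hne] at h
  push_cast at h
  rw [← h]
  congr 1
  ext i j
  rw [submatrix_apply, updateCol_apply, omega_apply m a x t hc, omega_apply m a x t hc, id]
  by_cases h2 : j = j₂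
  · rw [h2, Equiv.swap_apply_right, if_pos rfl, col₁, if_neg (by rw [hj₂]; simp only; omega),
      if_pos (by rw [hj₂]; simp only; omega)]
  · have h2' : (j : ℕ) ≠ 3 * n - 1 := fun h => h2 (Fin.ext h)
    by_cases h1 : j = j₁
    · have e : Fin.ofNat 3 (3 * n - 1) = 2 := by ext; simp only [Fin.val_ofNat]; simp; omega
      have e' : (3 * n - 1) / 3 = n - 1 := by omega
      rw [h1, Equiv.swap_apply_left, if_neg hne.symm, col₁, if_pos (by rw [hj₁]; simp only; omega),
        col₂, hj₂]
      simp only [e, e']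
    · have h1' : (j : ℕ) ≠ 3 * n - 2 := fun h => h1 (Fin.ext h)
      rw [Equiv.swap_apply_of_ne_of_ne h1 h2, if_neg h1, col₁, if_neg (by omega),
        if_neg (by omega)]

omit hc in
theorem freq_pair : freq a ![c₁, c₂] = 2 * amp c₁ c₂ ^ 2 - a ^ 2 := by
  simp [freq, amp_sq]

omit hc in
/-- The coefficients of the solution that enter the formulas. -/
theorem polyVec_solPoly (hn : 1 ≤ n) (z τ : ℂ) :
    polyVec n (solPoly n a c₁ c₂ z τ) ⟨3 * n - 2, by omega⟩ =
      c₁ / amp c₁ c₂ * (I * amp c₁ c₂ * gramForm (gramMat n (amp c₁ c₂) z τ)⁻¹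
        (trunc n (gSeries (amp c₁ c₂) z τ)) (trunc n (fSeries (amp c₁ c₂) z τ))) ∧
    polyVec n (solPoly n a c₁ c₂ z τ) ⟨3 * n - 1, by omega⟩ =
      c₂ / amp c₁ c₂ * (I * amp c₁ c₂ * gramForm (gramMat n (amp c₁ c₂) z τ)⁻¹
        (trunc n (gSeries (amp c₁ c₂) z τ)) (trunc n (fSeries (amp c₁ c₂) z τ))) := by
  have h := coeff_interpPoly (c := amp c₁ c₂) z τ hn (lam₀ a c₁ c₂)
    (trunc n (gSeries (amp c₁ c₂) z τ))
  rw [interpCoeff, pow_zero, one_mulVec] at h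
  have e1 : Fin.ofNat 3 (3 * n - 2) = 1 := by ext; simp only [Fin.val_ofNat]; simp; omega
  have e1' : (3 * n - 2) / 3 = n - 1 := by omega
  have e2 : Fin.ofNat 3 (3 * n - 1) = 2 := by ext; simp only [Fin.val_ofNat]; simp; omega
  have e2' : (3 * n - 1) / 3 = n - 1 := by omega
  constructor
  · simp only [polyVec, e1, e1', solPoly, cons_val_one, cons_val_zero, coeff_C_mul, h]
    rfl
  · simp only [polyVec, e2, e2', solPoly, cons_val, coeff_C_mul, h]
    rfl

/-- The determinant formulas are the multiples of the wave. -/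
theorem formula_eq_modulated (hn : 1 ≤ n) (hxt : (x, t) ≠ (0, 0)) :
    formula₁ n m a c₁ c₂ x t =
      (modulated n a (amp c₁ c₂) (c₁ / amp c₁ c₂) : ℝ × ℝ → ℂ) (x, t) ∧
    formula₂ n m a c₁ c₂ x t =
      (modulated n a (amp c₁ c₂) (c₂ / amp c₁ c₂) : ℝ × ℝ → ℂ) (x, t) := by
  have hdet := det_omega_ne_zero m a hc x t hn hxt
  have hcp : (amp c₁ c₂ : ℂ) ≠ 0 := by exact_mod_cast (amp_pos hc).ne'
  obtain ⟨h1, h2⟩ := polyVec_solPoly a (c₁ := c₁) (c₂ := c₂) hn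
    (x - 2 * a * t + 2 * I * amp c₁ c₂ * t) t
  constructor
  · rw [formula₁, det_omega_col₁ m a hc x t hn, h1, modulated_apply, waveFun_apply n a (amp_pos hc).ne',
      wave, freq_pair, neg_div, mul_div_cancel_left₀ _ hdet]
    push_cast
    congr 1
    field_simp
    linear_combination (-2 * c₁ * gramForm (gramMat n (amp c₁ c₂) (x - 2 * a * t + 2 * I * amp c₁ c₂ * t) t)⁻¹
        (trunc n (gSeries (amp c₁ c₂) (x - 2 * a * t + 2 * I * amp c₁ c₂ * t) t)) (trunc n (fSeries (amp c₁ c₂) (x - 2 * a * t + 2 * I * amp c₁ c₂ * t) t))) * I_sq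
  · rw [formula₂, det_omega_col₃ m a hc x t hn, h2, modulated_apply, waveFun_apply n a (amp_pos hc).ne',
      wave, freq_pair, mul_div_cancel_left₀ _ hdet]
    push_cast
    congr 1
    field_simp
    linear_combination (-2 * c₂ * gramForm (gramMat n (amp c₁ c₂) (x - 2 * a * t + 2 * I * amp c₁ c₂ * t) t)⁻¹
        (trunc n (gSeries (amp c₁ c₂) (x - 2 * a * t + 2 * I * amp c₁ c₂ * t) t)) (trunc n (fSeries (amp c₁ c₂) (x - 2 * a * t + 2 * I * amp c₁ c₂ * t) t))) * I_sq

end Determinants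

end

end Manakov

namespace Manakov

noncomputable section

/-! ### Explicit data for `c = 1`, `a = 0` and orders up to three. -/

section LowOrder

open Matrix
open PowerSeries (coeff)

/-! ### The first coefficients of the eigenfunctions -/

theorem coeff_one_mul' {R : Type*} [CommRing R] (F G : PowerSeries R) :
    coeff 1 (F * G) = coeff 0 F * coeff 1 G + coeff 1 F * coeff 0 G := by
  rw [PowerSeries.coeff_mul, Finset.Nat.sum_antidiagonal_eq_sum_range_succ_mk]
  simp [Finset.sum_range_succ]

theorem coeff_two_mul' {R : Type*} [CommRing R] (F G : PowerSeries R) :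
    coeff 2 (F * G) = coeff 0 F * coeff 2 G + coeff 1 F * coeff 1 G + coeff 2 F * coeff 0 G := by
  rw [PowerSeries.coeff_mul, Finset.Nat.sum_antidiagonal_eq_sum_range_succ_mk]
  simp [Finset.sum_range_succ]

theorem coeff_uSq_one : coeff 0 (uSq ℂ 1) = 0 ∧ coeff 1 (uSq ℂ 1) = -(2 * I) ∧
    coeff 2 (uSq ℂ 1) = -1 := by
  simp [uSq, cst, PowerSeries.coeff_X]

theorem coeff_phase (z τ : ℂ) : coeff 0 (phase z τ) = z ∧ coeff 1 (phase z τ) = 2 * τ ∧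
    coeff 2 (phase z τ) = 0 := by
  simp [phase, PowerSeries.coeff_C]

theorem coeff_cst (y : ℂ) : coeff 0 (cst ℂ y) = y ∧ coeff 1 (cst ℂ y) = 0 ∧
    coeff 2 (cst ℂ y) = 0 := by
  simp [cst, PowerSeries.coeff_C]

theorem coeff_one_series : coeff 0 (1 : PowerSeries ℂ) = 1 ∧ coeff 1 (1 : PowerSeries ℂ) = 0 ∧
    coeff 2 (1 : PowerSeries ℂ) = 0 := by
  simp [PowerSeries.coeff_one]

theorem coeff_mul_zero {R : Type*} [CommRing R] (F G : PowerSeries R) :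
    coeff 0 (F * G) = coeff 0 F * coeff 0 G := by simp

/-- The `j`-th term is divisible by `s^j`, so three terms suffice. -/
theorem coeff_sinhSeries_one (z τ : ℂ) :
    coeff 1 (sinhSeries 1 z τ) = 2 * τ - I * z ^ 3 / 3 ∧
    coeff 2 (sinhSeries 1 z τ) = -z ^ 3 / 6 - 2 * I * z ^ 2 * τ - z ^ 5 / 30 := by
  have hF := fun j => X_pow_dvd_term 1 (cst ℂ ((2 * j + 1).factorial : ℂ)⁻¹)
    (phase z τ ^ (2 * j + 1)) j
  obtain ⟨u0, u1, u2⟩ := coeff_uSq_one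
  obtain ⟨p0, p1, p2⟩ := coeff_phase z τ
  obtain ⟨o0, o1, o2⟩ := coeff_one_series
  have hc := coeff_cst
  constructor
  · rw [sinhSeries, coeff_lsum hF (K := 2) (by norm_num)]
    simp only [Finset.sum_range_succ, Finset.sum_range_zero, pow_succ, pow_zero, mul_zero, zero_add,
      mul_one, one_mul, coeff_one_mul', coeff_mul_zero, u0, u1, p0, p1, o0, o1, (hc _).1, (hc _).2.1,
      Nat.factorial, zero_mul, add_zero]
    push_cast
    ring
  · rw [sinhSeries, coeff_lsum hF (K := 3) (by norm_num)]
    simp only [Finset.sum_range_succ, Finset.sum_range_zero, pow_succ, pow_zero, mul_zero, zero_add,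
      mul_one, one_mul, coeff_one_mul', coeff_two_mul', coeff_mul_zero, u0, u1, u2, p0, p1, p2, o0, o1, o2,
      (hc _).1, (hc _).2.1, (hc _).2.2, Nat.factorial, zero_mul, add_zero]
    push_cast
    linear_combination z ^ 5 / 30 * I_sq

theorem coeff_coshSeries_one (z τ : ℂ) :
    coeff 1 (coshSeries 1 z τ) = -(I * z ^ 2) ∧
    coeff 2 (coshSeries 1 z τ) = -z ^ 2 / 2 - 4 * I * z * τ - z ^ 4 / 6 := by
  have hF := fun j => X_pow_dvd_term 1 (cst ℂ ((2 * j).factorial : ℂ)⁻¹)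
    (phase z τ ^ (2 * j)) j
  obtain ⟨u0, u1, u2⟩ := coeff_uSq_one
  obtain ⟨p0, p1, p2⟩ := coeff_phase z τ
  obtain ⟨o0, o1, o2⟩ := coeff_one_series
  have hc := coeff_cst
  constructor
  · rw [coshSeries, coeff_lsum hF (K := 2) (by norm_num)]
    simp only [Finset.sum_range_succ, Finset.sum_range_zero, pow_succ, pow_zero, mul_zero, zero_add,
      mul_one, one_mul, coeff_one_mul', coeff_mul_zero, u0, u1, p0, p1, o0, o1, (hc _).1, (hc _).2.1,
      Nat.factorial, zero_mul, add_zero]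
    push_cast
    ring
  · rw [coshSeries, coeff_lsum hF (K := 3) (by norm_num)]
    simp only [Finset.sum_range_succ, Finset.sum_range_zero, pow_succ, pow_zero, mul_zero, zero_add,
      mul_one, one_mul, coeff_one_mul', coeff_two_mul', coeff_mul_zero, u0, u1, u2, p0, p1, p2, o0, o1, o2,
      (hc _).1, (hc _).2.1, (hc _).2.2, Nat.factorial, zero_mul, add_zero]
    push_cast
    linear_combination z ^ 4 / 6 * I_sq

/-- The coefficients of `f` at `c = 1`, rescaled to be rational in `x` and `y = 2 i t`. -/
def lowF (x y : ℂ) : Fin 3 → ℂ :=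
  ![x + y, (x + y) ^ 3 / 3 + y, (x + y) ^ 5 / 30 + (x + y) ^ 3 / 6 + (x + y) ^ 2 * y]

/-- The coefficients of `g` at `c = 1`, rescaled to be rational in `x` and `y = 2 i t`. -/
def lowG (x y : ℂ) : Fin 3 → ℂ :=
  ![1 - lowF x y 0, (x + y) ^ 2 - lowF x y 1 - lowF x y 0,
    (x + y) ^ 4 / 6 + (x + y) ^ 2 / 2 + 2 * (x + y) * y - lowF x y 2 - lowF x y 1]

theorem I_pow_mul_coeff_fSeries (x t : ℂ) (k : Fin 3) :
    I ^ (k : ℕ) * coeff k (fSeries 1 (x + 2 * I * t) t) = lowF x (2 * I * t) k := by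
  obtain ⟨h1, h2⟩ := coeff_sinhSeries_one (x + 2 * I * t) t
  fin_cases k
  · simp [lowF, coeff_zero_sinhSeries]
  · simp only [lowF, fSeries, Fin.mk_one, Fin.isValue, pow_one, h1, cons_val_one, cons_val_zero]
    linear_combination -(x + 2 * I * t) ^ 3 / 3 * I_sq
  · simp only [lowF, fSeries, Fin.reduceFinMk, h2, cons_val]
    linear_combination (-(x + 2 * I * t) ^ 5 / 30 - (x + 2 * I * t) ^ 3 / 6
      - 2 * I * (x + 2 * I * t) ^ 2 * t) * I_sq

theorem I_pow_mul_coeff_gSeries (x t : ℂ) (k : Fin 3) :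
    I ^ (k : ℕ) * coeff k (gSeries 1 (x + 2 * I * t) t) = lowG x (2 * I * t) k := by
  obtain ⟨h1, h2⟩ := coeff_coshSeries_one (x + 2 * I * t) t
  have hf := I_pow_mul_coeff_fSeries x t
  have f0 := hf 0
  have f1 := hf 1
  have f2 := hf 2
  have c1 : coeff 1 (PowerSeries.X : PowerSeries ℂ) = 1 := PowerSeries.coeff_one_X
  have c2 : coeff 2 (PowerSeries.X : PowerSeries ℂ) = 0 := by simp [PowerSeries.coeff_X]
  have c0 : coeff 0 (PowerSeries.X : PowerSeries ℂ) = 0 := PowerSeries.coeff_zero_X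
  have hc := coeff_cst
  simp only [Fin.isValue, Fin.val_zero, Fin.val_one, Fin.val_two, pow_zero, pow_one, one_mul] at f0 f1 f2
  fin_cases k
  · simp only [lowG, Fin.zero_eta, Fin.isValue, cons_val_zero, gSeries, coeff_mul_zero,
      map_add, c0, (hc _).1, coeff_zero_coshSeries, ← f0, fSeries, ofReal_one]
    linear_combination coeff 0 (sinhSeries 1 (x + 2 * I * t) t) * I_sq
  · simp only [lowG, Fin.mk_one, Fin.isValue, cons_val_one, cons_val_zero, gSeries,
      coeff_mul_zero, coeff_one_mul', map_add, c0, c1, (hc _).1, (hc _).2.1, coeff_zero_coshSeries,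
      ← f0, ← f1, fSeries, ofReal_one, h1]
    linear_combination (I * coeff 1 (sinhSeries 1 (x + 2 * I * t) t)
      + coeff 0 (sinhSeries 1 (x + 2 * I * t) t) - (x + 2 * I * t) ^ 2) * I_sq
  · simp only [lowG, Fin.reduceFinMk, Fin.isValue, cons_val, gSeries,
      coeff_mul_zero, coeff_one_mul', coeff_two_mul', map_add, c0, c1, c2, (hc _).1, (hc _).2.1,
      (hc _).2.2, coeff_zero_coshSeries, ← f1, ← f2, fSeries, ofReal_one, h1, h2]
    linear_combination (I ^ 2 * coeff 2 (sinhSeries 1 (x + 2 * I * t) t)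
      + I * coeff 1 (sinhSeries 1 (x + 2 * I * t) t) - (x + 2 * I * t) ^ 2 / 2
      - 4 * I * (x + 2 * I * t) * t - (x + 2 * I * t) ^ 4 / 6) * I_sq

/-! ### The rescaled Gram matrix -/

/-- The unitary rescaling. -/
def phaseMat (n : ℕ) : Matrix (Fin n) (Fin n) ℂ := diagonal fun k => I ^ (k : ℕ)

theorem conjTranspose_phaseMat_mul (n : ℕ) : (phaseMat n)ᴴ * phaseMat n = 1 := by
  rw [phaseMat, diagonal_conjTranspose, diagonal_mul_diagonal, ← diagonal_one]
  congr 1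
  ext k
  rw [Pi.star_apply, star_pow, ← mul_pow]
  simp

/-- The rescaled Gram matrix for `c = 1`. -/
def lowGram (n : ℕ) (x t : ℂ) : Matrix (Fin n) (Fin n) ℂ :=
  phaseMat n * gramMat n 1 (x + 2 * I * t) t * (phaseMat n)ᴴ

theorem det_lowGram (n : ℕ) (x t : ℂ) :
    (lowGram n x t).det = (gramMat n 1 (x + 2 * I * t) t).det := by
  rw [lowGram, det_mul, det_mul, mul_right_comm, ← det_mul,
    mul_eq_one_comm.1 (conjTranspose_phaseMat_mul n), det_one, one_mul]

/-- The rescaling by powers of `i` is unitary and changes neither the determinant nor the form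
`g†N⁻¹f`; the adjugate avoids denominators. -/
theorem wave_mul_det (n : ℕ) (x t : ℂ) :
    wave n 1 (x + 2 * I * t) t * (lowGram n x t).det = (lowGram n x t).det +
      2 * (star (phaseMat n *ᵥ trunc n (gSeries 1 (x + 2 * I * t) t)) ⬝ᵥ
        ((lowGram n x t).adjugate *ᵥ (phaseMat n *ᵥ trunc n (fSeries 1 (x + 2 * I * t) t)))) := by
  set N := gramMat n 1 (x + 2 * I * t) t with hN
  have hdet : N.det ≠ 0 := det_gramMat_ne_zero n one_ne_zero _ _
  have hinv : (lowGram n x t).det • N⁻¹ = (phaseMat n)ᴴ * (lowGram n x t).adjugate * phaseMat n := by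
    have h1 := mul_adjugate (lowGram n x t)
    have h2 : N * ((phaseMat n)ᴴ * (lowGram n x t).adjugate * phaseMat n) =
        (lowGram n x t).det • 1 := by
      calc _ = (phaseMat n)ᴴ * phaseMat n * N * (phaseMat n)ᴴ * (lowGram n x t).adjugate *
            phaseMat n := by
            rw [conjTranspose_phaseMat_mul, one_mul]
            simp only [Matrix.mul_assoc]
        _ = (phaseMat n)ᴴ * (lowGram n x t * (lowGram n x t).adjugate) * phaseMat n := by
            rw [lowGram]
            simp only [Matrix.mul_assoc, hN]
        _ = _ := by
            rw [h1, mul_smul_comm, Matrix.mul_one, smul_mul_assoc, conjTranspose_phaseMat_mul]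
    rw [← Matrix.one_mul ((phaseMat n)ᴴ * _ * _), ← nonsing_inv_mul N hdet.isUnit, Matrix.mul_assoc,
      h2, mul_smul_comm, Matrix.mul_one]
  rw [wave, ofReal_one, one_mul, add_mul, one_mul, mul_assoc, mul_comm (gramForm _ _ _), gramForm,
    ← smul_eq_mul (lowGram n x t).det, ← dotProduct_smul, ← smul_mulVec, hinv, star_mulVec,
    ← dotProduct_mulVec, mulVec_mulVec, mulVec_mulVec, Matrix.mul_assoc]

theorem phaseMat_mulVec_apply (n : ℕ) (F : PowerSeries ℂ) (k : Fin n) :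
    (phaseMat n *ᵥ trunc n F) k = I ^ (k : ℕ) * coeff k F := by
  rw [phaseMat, mulVec_diagonal]
  rfl

theorem lowGram_apply (n : ℕ) (x t : ℂ) (k j : Fin n) : lowGram n x t k j =
    I ^ (k : ℕ) * (-I) ^ (j : ℕ) * gramMat n 1 (x + 2 * I * t) t k j := by
  rw [lowGram, phaseMat, diagonal_conjTranspose, mul_diagonal, diagonal_mul, Pi.star_apply, star_pow]
  simp
  ring

/-- The recursion for the entries of the rescaled Gram matrix. -/
theorem lowGram_rec (n : ℕ) (x t : ℂ) (k j : Fin n) : 2 * lowGram n x t k j =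
    I ^ (k : ℕ) * coeff k (fSeries 1 (x + 2 * I * t) t) *
        conj (I ^ (j : ℕ) * coeff j (fSeries 1 (x + 2 * I * t) t)) +
      I ^ (k : ℕ) * coeff k (gSeries 1 (x + 2 * I * t) t) *
        conj (I ^ (j : ℕ) * coeff j (gSeries 1 (x + 2 * I * t) t)) -
      (if h : 0 < (k : ℕ) then lowGram n x t ⟨k - 1, by omega⟩ j else 0) -
      (if h : 0 < (j : ℕ) then lowGram n x t k ⟨j - 1, by omega⟩ else 0) := by
  have h := congrFun (congrFun (specMat_mul_gramMat (n := n) one_ne_zero (x + 2 * I * t) t) k) j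
  rw [specMat, add_mul, Matrix.sub_apply, Matrix.add_apply, shift_mul_apply,
    mul_conjTranspose_shift_apply] at h
  simp only [smul_mul_assoc, one_mul, Matrix.smul_apply, Matrix.add_apply, vecMulVec_apply, trunc,
    Pi.star_apply, smul_eq_mul, ofReal_one, mul_one, Algebra.algebraMap_self, RingHom.id_apply] at h
  simp only [lowGram_apply, map_mul, map_pow, conj_I]
  have hk : ∀ i : ℕ, 0 < i → I ^ i = I * I ^ (i - 1) := fun i hi => by
    rw [← pow_succ', Nat.sub_add_cancel hi]
  have hj : ∀ i : ℕ, 0 < i → (-I) ^ i = -I * (-I) ^ (i - 1) := fun i hi => by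
    rw [← pow_succ', Nat.sub_add_cancel hi]
  simp only [← starRingEnd_apply] at h
  generalize conj (coeff (j : ℕ) (fSeries 1 (x + 2 * I * t) t)) = fj at *
  generalize conj (coeff (j : ℕ) (gSeries 1 (x + 2 * I * t) t)) = gj at *
  generalize coeff (k : ℕ) (fSeries 1 (x + 2 * I * t) t) = fk at *
  generalize coeff (k : ℕ) (gSeries 1 (x + 2 * I * t) t) = gk at *
  have h' : 2 * gramMat n 1 (x + 2 * I * t) t k j = fk * fj + gk * gj +
      I * (if h : 0 < (k : ℕ) then gramMat n 1 (x + 2 * I * t) t ⟨k - 1, by omega⟩ j else 0) -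
      I * (if h : 0 < (j : ℕ) then gramMat n 1 (x + 2 * I * t) t k ⟨j - 1, by omega⟩ else 0) := by
    linear_combination -I * h + (2 * gramMat n 1 (x + 2 * I * t) t k j - fk * fj - gk * gj) * I_sq
  rw [mul_left_comm, h']
  split_ifs with h1 h2 h2
  · generalize gramMat n 1 (x + 2 * I * t) t ⟨k - 1, _⟩ j = u
    generalize gramMat n 1 (x + 2 * I * t) t k ⟨j - 1, _⟩ = v
    rw [hk _ h1, hj _ h2]
    linear_combination I ^ ((k : ℕ) - 1) * (-I) ^ ((j : ℕ) - 1) * I * (v - u) * I_sq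
  · generalize gramMat n 1 (x + 2 * I * t) t ⟨k - 1, _⟩ j = u
    rw [hk _ h1]
    linear_combination I ^ ((k : ℕ) - 1) * (-I) ^ (j : ℕ) * u * I_sq
  · generalize gramMat n 1 (x + 2 * I * t) t k ⟨j - 1, _⟩ = v
    rw [hj _ h2]
    linear_combination I ^ (k : ℕ) * (-I) ^ ((j : ℕ) - 1) * v * I_sq
  · ring

theorem conj_lowF (x t : ℝ) (k : Fin 3) :
    conj (lowF x (2 * I * t) k) = lowF x (-(2 * I * t)) k := by
  fin_cases k <;> simp [lowF, map_ofNat (starRingEnd ℂ)]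

theorem conj_lowG (x t : ℝ) (k : Fin 3) :
    conj (lowG x (2 * I * t) k) = lowG x (-(2 * I * t)) k := by
  have h := conj_lowF x t
  fin_cases k <;> simp [lowG, h, map_ofNat (starRingEnd ℂ)]

end LowOrder

end

end Manakov

namespace Manakov

noncomputable section

/-! ### The Gram matrix of order three in closed form. -/

section Explicit

open Matrix
open PowerSeries (coeff)

/-- An entry of `lowPoly`. -/
def entry₀₀ (x y : ℂ) : ℂ :=
  x ^ 2 - y ^ 2 - x + 1 / 2

/-- An entry of `lowPoly`. -/
def entry₁₀ (x y : ℂ) : ℂ :=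
  x ^ 4 / 3 + 2 * x ^ 3 * y / 3 - 2 * x * y ^ 3 / 3 - y ^ 4 / 3 - 2 * x ^ 3 / 3
    - x ^ 2 * y + y ^ 3 / 3 + x ^ 2 / 2 + 2 * x * y - y ^ 2 / 2 - y - 1 / 4

/-- An entry of `lowPoly`. -/
def entry₁₁ (x y : ℂ) : ℂ :=
  x ^ 6 / 9 - x ^ 4 * y ^ 2 / 3 + x ^ 2 * y ^ 4 / 3 - y ^ 6 / 9
    - x ^ 5 / 3 + 2 * x ^ 3 * y ^ 2 / 3 - x * y ^ 4 / 3 + x ^ 4 / 2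
    - 3 * x ^ 2 * y ^ 2 - y ^ 4 / 6 - x ^ 3 / 3 + 3 * x * y ^ 2 - 2 * y ^ 2 + 1 / 4

/-- An entry of `lowPoly`. -/
def entry₂₀ (x y : ℂ) : ℂ :=
  x ^ 6 / 30 + 2 * x ^ 5 * y / 15 + x ^ 4 * y ^ 2 / 6 - x ^ 2 * y ^ 4 / 6
    - 2 * x * y ^ 5 / 15 - y ^ 6 / 30 - x ^ 5 / 10 - x ^ 4 * y / 3
    - x ^ 3 * y ^ 2 / 3 + x * y ^ 4 / 6 + y ^ 5 / 15 + x ^ 4 / 4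
    + 5 * x ^ 3 * y / 3 + 3 * x ^ 2 * y ^ 2 / 2 - x * y ^ 3 - 13 * y ^ 4 / 12 - x ^ 3 / 6
    - 2 * x ^ 2 * y - 3 * x * y ^ 2 / 2 + y ^ 3 / 3 + x * y + y ^ 2 + 1 / 8

/-- An entry of `lowPoly`. -/
def entry₂₁ (x y : ℂ) : ℂ :=
  x ^ 8 / 90 + x ^ 7 * y / 45 - x ^ 6 * y ^ 2 / 45 - x ^ 5 * y ^ 3 / 15
    + x ^ 3 * y ^ 5 / 15 + x ^ 2 * y ^ 6 / 45 - x * y ^ 7 / 45 - y ^ 8 / 90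
    - 2 * x ^ 7 / 45 - 7 * x ^ 6 * y / 90 + x ^ 5 * y ^ 2 / 15 + x ^ 4 * y ^ 3 / 6
    - x ^ 2 * y ^ 5 / 10 - x * y ^ 6 / 45 + y ^ 7 / 90 + 5 * x ^ 6 / 36
    + 7 * x ^ 5 * y / 15 - 3 * x ^ 4 * y ^ 2 / 4 - 4 * x ^ 3 * y ^ 3 / 3
    + 5 * x ^ 2 * y ^ 4 / 12 + x * y ^ 5 / 3 - 61 * y ^ 6 / 180 - x ^ 5 / 5
    - x ^ 4 * y + 4 * x ^ 3 * y ^ 2 / 3 + 2 * x ^ 2 * y ^ 3 - x * y ^ 4 / 3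
    - y ^ 5 / 5 + x ^ 4 / 8 + x ^ 3 * y - 11 * x ^ 2 * y ^ 2 / 4 - 4 * x * y ^ 3
    - 3 * y ^ 4 / 8 - x ^ 2 * y / 2 + 2 * x * y ^ 2 + 11 * y ^ 3 / 6 - y ^ 2 / 2
    - 3 / 16

/-- An entry of `lowPoly`. -/
def entry₂₂ (x y : ℂ) : ℂ :=
  x ^ 10 / 900 - x ^ 8 * y ^ 2 / 180 + x ^ 6 * y ^ 4 / 90 - x ^ 4 * y ^ 6 / 90
    + x ^ 2 * y ^ 8 / 180 - y ^ 10 / 900 - x ^ 9 / 180 + x ^ 7 * y ^ 2 / 45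
    - x ^ 5 * y ^ 4 / 30 + x ^ 3 * y ^ 6 / 45 - x * y ^ 8 / 180 + x ^ 8 / 40
    - 5 * x ^ 6 * y ^ 2 / 18 + 5 * x ^ 4 * y ^ 4 / 12 - x ^ 2 * y ^ 6 / 10
    - 23 * y ^ 8 / 360 - x ^ 7 / 18 + 23 * x ^ 5 * y ^ 2 / 30 - 5 * x ^ 3 * y ^ 4 / 6
    + 11 * x * y ^ 6 / 90 + x ^ 6 / 12 - 31 * x ^ 4 * y ^ 2 / 12 + 43 * x ^ 2 * y ^ 4 / 12
    - 13 * y ^ 6 / 12 - x ^ 5 / 20 + 23 * x ^ 3 * y ^ 2 / 6 - 13 * x * y ^ 4 / 4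
    - 3 * x ^ 2 * y ^ 2 + 2 * y ^ 4 + x * y ^ 2 + 3 / 16

/-- The rescaled Gram matrix as polynomials in `x` and `y = 2 i t`. -/
def lowPoly (x y : ℂ) : Matrix (Fin 3) (Fin 3) ℂ :=
  !![entry₀₀ x y, entry₁₀ x (-y), entry₂₀ x (-y);
     entry₁₀ x y, entry₁₁ x y, entry₂₁ x (-y);
     entry₂₀ x y, entry₂₁ x y, entry₂₂ x y]

/-- The entries satisfy the same recursion as the rescaled Gram matrix. Replacing `y` by `-y` plays
the role of conjugation, as `y = 2it`. -/
theorem lowPoly_rec (x y : ℂ) (k j : Fin 3) : 2 * lowPoly x y k j =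
    lowF x y k * lowF x (-y) j + lowG x y k * lowG x (-y) j -
      (if h : 0 < (k : ℕ) then lowPoly x y ⟨k - 1, by omega⟩ j else 0) -
      (if h : 0 < (j : ℕ) then lowPoly x y k ⟨j - 1, by omega⟩ else 0) := by
  fin_cases k <;> fin_cases j <;>
    simp [lowPoly, lowF, lowG, entry₀₀, entry₁₀, entry₁₁, entry₂₀, entry₂₁, entry₂₂] <;> ring

/-- The recursion expresses an entry through entries with smaller `k + j`, so it determines the
matrix; induction on `k + j`. -/
theorem lowGram_eq {n : ℕ} (hn : n ≤ 3) (x t : ℝ) (k j : Fin n) :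
    lowGram n x t k j = lowPoly x (2 * I * t) (Fin.castLE hn k) (Fin.castLE hn j) := by
  have key : ∀ s : ℕ, ∀ k j : Fin n, (k : ℕ) + j = s →
      lowGram n x t k j = lowPoly x (2 * I * t) (Fin.castLE hn k) (Fin.castLE hn j) := by
    intro s
    induction s using Nat.strong_induction_on with
    | _ s ih =>
      intro k j hs
      have h1 := lowGram_rec n x t k j
      have h2 := lowPoly_rec x (2 * I * t) (Fin.castLE hn k) (Fin.castLE hn j)
      have hf := fun k : Fin n => I_pow_mul_coeff_fSeries x t (Fin.castLE hn k)
      have hg := fun k : Fin n => I_pow_mul_coeff_gSeries x t (Fin.castLE hn k)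
      simp only [Fin.val_castLE] at hf hg
      rw [hf, hf, hg, hg, conj_lowF, conj_lowG] at h1
      refine mul_left_cancel₀ (two_ne_zero' ℂ) (h1.trans (Eq.trans ?_ h2.symm))
      congr 1
      · congr 1
        by_cases hk : 0 < (k : ℕ)
        · rw [dif_pos hk, dif_pos (by simpa using hk)]
          exact (ih (k - 1 + j) (by omega) ⟨k - 1, by omega⟩ j rfl).trans (by simp)
        · rw [dif_neg hk, dif_neg (by simpa using hk)]
      · by_cases hj : 0 < (j : ℕ)
        · rw [dif_pos hj, dif_pos (by simpa using hj)]
          exact (ih (k + (j - 1)) (by omega) k ⟨j - 1, by omega⟩ rfl).trans (by simp)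
        · rw [dif_neg hj, dif_neg (by simpa using hj)]
  exact key _ k j rfl

end Explicit

end

end Manakov

namespace Manakov

noncomputable section

/-! ### The waves of order two and three. -/

section ExplicitWaves

open Matrix

/-- The determinant of the rescaled Gram matrix of order 2, in terms of `x` and `Y = -4 t ^ 2`. -/
def secondDet (x Y : ℂ) : ℂ :=
  16 * x ^ 6 - 48 * x ^ 4 * Y + 48 * x ^ 2 * Y ^ 2 - 16 * Y ^ 3 - 48 * x ^ 5
  + 96 * x ^ 3 * Y - 48 * x * Y ^ 2 + 72 * x ^ 4 + 120 * Y ^ 2 - 72 * x ^ 3 - 72 * x * Y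
  + 72 * x ^ 2 - 72 * Y - 36 * x + 9

/-- The part of the numerator of order 2 that is even in `t`. -/
def secondEven (x Y : ℂ) : ℂ :=
  -24 * x ^ 4 + 144 * x ^ 2 * Y - 120 * Y ^ 2 + 48 * x ^ 3 - 144 * x * Y - 72 * x ^ 2
  + 144 * Y + 36 * x

/-- The part of the numerator of order 2 that is odd in `t`, divided by `2 i t`. -/
def secondOdd (x Y : ℂ) : ℂ :=
  -48 * x ^ 4 + 96 * x ^ 2 * Y - 48 * Y ^ 2 + 96 * x ^ 3 - 96 * x * Y + 48 * Y - 72 * x + 72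

/-- The determinant of the rescaled Gram matrix of order 3, in terms of `x` and `Y = -4 t ^ 2`. -/
def thirdDet (x Y : ℂ) : ℂ :=
  512 * x ^ 12 - 3072 * x ^ 10 * Y + 7680 * x ^ 8 * Y ^ 2 - 10240 * x ^ 6 * Y ^ 3
  + 7680 * x ^ 4 * Y ^ 4 - 3072 * x ^ 2 * Y ^ 5 + 512 * Y ^ 6 - 3072 * x ^ 11
  + 15360 * x ^ 9 * Y - 30720 * x ^ 7 * Y ^ 2 + 30720 * x ^ 5 * Y ^ 3
  - 15360 * x ^ 3 * Y ^ 4 + 3072 * x * Y ^ 5 + 9216 * x ^ 10 - 23040 * x ^ 8 * Y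
  + 30720 * x ^ 6 * Y ^ 2 - 46080 * x ^ 4 * Y ^ 3 + 46080 * x ^ 2 * Y ^ 4 - 16896 * Y ^ 5
  - 19200 * x ^ 9 + 23040 * x ^ 5 * Y ^ 2 + 30720 * x ^ 3 * Y ^ 3 - 34560 * x * Y ^ 4
  + 34560 * x ^ 8 + 23040 * x ^ 6 * Y - 115200 * x ^ 4 * Y ^ 2 - 437760 * x ^ 2 * Y ^ 3
  + 126720 * Y ^ 4 - 54720 * x ^ 7 - 8640 * x ^ 5 * Y + 273600 * x ^ 3 * Y ^ 2
  + 434880 * x * Y ^ 3 + 86400 * x ^ 6 - 129600 * x ^ 4 * Y + 345600 * x ^ 2 * Y ^ 2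
  - 233280 * Y ^ 3 - 108000 * x ^ 5 + 172800 * x ^ 3 * Y - 583200 * x * Y ^ 2
  + 97200 * x ^ 4 + 464400 * Y ^ 2 - 64800 * x ^ 3 - 64800 * x * Y + 36450 * x ^ 2
  - 36450 * Y - 12150 * x + 2025

/-- The part of the numerator of order 3 that is even in `t`. -/
def thirdEven (x Y : ℂ) : ℂ :=
  -512 * x ^ 12 + 3072 * x ^ 10 * Y - 7680 * x ^ 8 * Y ^ 2 + 10240 * x ^ 6 * Y ^ 3
  - 7680 * x ^ 4 * Y ^ 4 + 3072 * x ^ 2 * Y ^ 5 - 512 * Y ^ 6 + 3072 * x ^ 11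
  - 15360 * x ^ 9 * Y + 30720 * x ^ 7 * Y ^ 2 - 30720 * x ^ 5 * Y ^ 3
  + 15360 * x ^ 3 * Y ^ 4 - 3072 * x * Y ^ 5 - 7680 * x ^ 10 + 46080 * x ^ 6 * Y ^ 2
  - 61440 * x ^ 4 * Y ^ 3 + 23040 * x ^ 2 * Y ^ 4 + 11520 * x ^ 9 + 92160 * x ^ 7 * Y
  - 253440 * x ^ 5 * Y ^ 2 + 184320 * x ^ 3 * Y ^ 3 - 34560 * x * Y ^ 4 - 11520 * x ^ 8
  - 161280 * x ^ 6 * Y + 345600 * x ^ 4 * Y ^ 2 + 115200 * x ^ 2 * Y ^ 3 + 80640 * Y ^ 4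
  + 8640 * x ^ 7 + 77760 * x ^ 5 * Y - 273600 * x ^ 3 * Y ^ 2 - 273600 * x * Y ^ 3
  - 5760 * x ^ 6 + 129600 * x ^ 4 * Y + 172800 * x ^ 2 * Y ^ 2 + 2880 * Y ^ 3 + 8640 * x ^ 5
  - 302400 * x ^ 3 * Y - 86400 * x * Y ^ 2 - 32400 * x ^ 4 + 518400 * x ^ 2 * Y
  - 442800 * Y ^ 2 + 43200 * x ^ 3 - 324000 * x * Y - 36450 * x ^ 2 + 133650 * Y + 12150 * x

/-- The part of the numerator of order 3 that is odd in `t`, divided by `2 i t`. -/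
def thirdOdd (x Y : ℂ) : ℂ :=
  3072 * x ^ 10 - 15360 * x ^ 8 * Y + 30720 * x ^ 6 * Y ^ 2 - 30720 * x ^ 4 * Y ^ 3
  + 15360 * x ^ 2 * Y ^ 4 - 3072 * Y ^ 5 - 15360 * x ^ 9 + 61440 * x ^ 7 * Y
  - 92160 * x ^ 5 * Y ^ 2 + 61440 * x ^ 3 * Y ^ 3 - 15360 * x * Y ^ 4 + 23040 * x ^ 8
  - 46080 * x ^ 4 * Y ^ 2 + 23040 * Y ^ 4 - 230400 * x ^ 5 * Y + 276480 * x ^ 3 * Y ^ 2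
  - 46080 * x * Y ^ 3 - 69120 * x ^ 6 + 460800 * x ^ 4 * Y + 69120 * x ^ 2 * Y ^ 2
  + 184320 * Y ^ 3 + 146880 * x ^ 5 - 547200 * x ^ 3 * Y - 336960 * x * Y ^ 2
  - 216000 * x ^ 4 + 691200 * x ^ 2 * Y - 336960 * Y ^ 2 + 172800 * x ^ 3 - 388800 * x * Y
  + 108000 * Y - 64800 * x + 36450

/-- The factor `144` clears denominators and normalises the determinant to `secondDen`; in order
three this role is played by `1036800`. -/
theorem secondDet_eq (x y : ℂ) : secondDet x (y ^ 2) =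
    144 * (lowPoly x y 0 0 * lowPoly x y 1 1 - lowPoly x y 0 1 * lowPoly x y 1 0) := by
  simp only [lowPoly, of_apply, cons_val_zero, cons_val_one, entry₀₀, entry₁₀, entry₁₁,
    secondDet]
  ring

theorem second_numerator_eq (x y : ℂ) : secondEven x (y ^ 2) + y * secondOdd x (y ^ 2) =
    144 * (lowG x (-y) 0 * (lowPoly x y 1 1 * lowF x y 0 - lowPoly x y 0 1 * lowF x y 1)
      + lowG x (-y) 1 * (lowPoly x y 0 0 * lowF x y 1 - lowPoly x y 1 0 * lowF x y 0)) := by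
  simp only [lowPoly, of_apply, cons_val_zero, cons_val_one, cons_val, entry₀₀, entry₁₀, entry₁₁,
    secondEven, secondOdd, lowF, lowG]
  ring

set_option maxHeartbeats 1000000 in
theorem thirdDet_eq (x y : ℂ) : thirdDet x (y ^ 2) = 1036800 *
    (entry₀₀ x y * (entry₁₁ x y * entry₂₂ x y - entry₂₁ x (-y) * entry₂₁ x y) -
     entry₁₀ x (-y) * (entry₁₀ x y * entry₂₂ x y - entry₂₁ x (-y) * entry₂₀ x y) +
     entry₂₀ x (-y) * (entry₁₀ x y * entry₂₁ x y - entry₁₁ x y * entry₂₀ x y)) := by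
  simp only [entry₀₀, entry₁₀, entry₁₁, entry₂₀, entry₂₁, entry₂₂, thirdDet]
  ring

set_option maxHeartbeats 4000000 in
theorem third_numerator_eq (x y : ℂ) : thirdEven x (y ^ 2) + y * thirdOdd x (y ^ 2) = 1036800 *
    (lowG x (-y) 0 *
      ((entry₁₁ x y * entry₂₂ x y - entry₂₁ x (-y) * entry₂₁ x y) * lowF x y 0 +
       (entry₂₀ x (-y) * entry₂₁ x y - entry₁₀ x (-y) * entry₂₂ x y) * lowF x y 1 +
       (entry₁₀ x (-y) * entry₂₁ x (-y) - entry₂₀ x (-y) * entry₁₁ x y) * lowF x y 2) +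
     lowG x (-y) 1 *
      ((entry₂₁ x (-y) * entry₂₀ x y - entry₁₀ x y * entry₂₂ x y) * lowF x y 0 +
       (entry₀₀ x y * entry₂₂ x y - entry₂₀ x (-y) * entry₂₀ x y) * lowF x y 1 +
       (entry₂₀ x (-y) * entry₁₀ x y - entry₀₀ x y * entry₂₁ x (-y)) * lowF x y 2) +
     lowG x (-y) 2 *
      ((entry₁₀ x y * entry₂₁ x y - entry₁₁ x y * entry₂₀ x y) * lowF x y 0 +
       (entry₁₀ x (-y) * entry₂₀ x y - entry₀₀ x y * entry₂₁ x y) * lowF x y 1 +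
       (entry₀₀ x y * entry₁₁ x y - entry₁₀ x (-y) * entry₁₀ x y) * lowF x y 2)) := by
  simp only [cons_val_zero, cons_val_one, cons_val, entry₀₀, entry₁₀, entry₁₁, entry₂₀, entry₂₁,
    entry₂₂, thirdEven, thirdOdd, lowF, lowG]
  ring

theorem phaseMat_mulVec_fSeries {n : ℕ} (hn : n ≤ 3) (x t : ℝ) (k : Fin n) :
    (phaseMat n *ᵥ trunc n (fSeries 1 (x + 2 * I * t : ℂ) t)) k =
      lowF x (2 * I * t) (Fin.castLE hn k) := by
  rw [phaseMat_mulVec_apply, ← I_pow_mul_coeff_fSeries]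
  rfl

theorem star_phaseMat_mulVec_gSeries {n : ℕ} (hn : n ≤ 3) (x t : ℝ) (k : Fin n) :
    star (phaseMat n *ᵥ trunc n (gSeries 1 (x + 2 * I * t : ℂ) t)) k =
      lowG x (-(2 * I * t)) (Fin.castLE hn k) := by
  rw [Pi.star_apply, phaseMat_mulVec_apply, ← conj_lowG, ← I_pow_mul_coeff_gSeries]
  rfl

theorem two_I_mul_sq (t : ℝ) : (2 * I * t : ℂ) ^ 2 = -4 * t ^ 2 := by
  linear_combination 4 * (t : ℂ) ^ 2 * I_sq

theorem wave_two (x t : ℝ) :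
    secondDet x (-4 * t ^ 2) = 144 * (gramMat 2 1 (x + 2 * I * t) (t : ℂ)).det ∧
    wave 2 1 (x + 2 * I * t) t * secondDet x (-4 * t ^ 2) = secondDet x (-4 * t ^ 2) +
      2 * (secondEven x (-4 * t ^ 2) + 2 * I * t * secondOdd x (-4 * t ^ 2)) := by
  have hM := lowGram_eq (n := 2) (by norm_num) x t
  have hdet : secondDet x (-4 * t ^ 2) = 144 * (lowGram 2 x t).det := by
    rw [← two_I_mul_sq, secondDet_eq, det_fin_two, hM, hM, hM, hM]
    rfl
  refine ⟨by rw [hdet, det_lowGram], ?_⟩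
  have h := wave_mul_det 2 x t
  have hnum := second_numerator_eq x (2 * I * t)
  rw [two_I_mul_sq] at hnum
  have hf : phaseMat 2 *ᵥ trunc 2 (fSeries 1 (x + 2 * I * t : ℂ) t) =
      ![lowF x (2 * I * t) 0, lowF x (2 * I * t) 1] := by
    ext k
    rw [phaseMat_mulVec_fSeries (by norm_num)]
    fin_cases k <;> rfl
  have hg : star (phaseMat 2 *ᵥ trunc 2 (gSeries 1 (x + 2 * I * t : ℂ) t)) =
      ![lowG x (-(2 * I * t)) 0, lowG x (-(2 * I * t)) 1] := by
    ext k
    rw [star_phaseMat_mulVec_gSeries (by norm_num)]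
    fin_cases k <;> rfl
  have hM' : lowGram 2 x t = !![lowPoly x (2 * I * t) 0 0, lowPoly x (2 * I * t) 0 1;
      lowPoly x (2 * I * t) 1 0, lowPoly x (2 * I * t) 1 1] := by
    ext k j
    rw [hM]
    fin_cases k <;> fin_cases j <;> rfl
  rw [hnum, hdet, mul_left_comm, h, hf, hg, hM', adjugate_fin_two]
  simp only [dotProduct, mulVec, Fin.sum_univ_two, of_apply, cons_val_zero, cons_val_one]
  ring

theorem wave_three (x t : ℝ) :
    thirdDet x (-4 * t ^ 2) = 1036800 * (gramMat 3 1 (x + 2 * I * t) (t : ℂ)).det ∧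
    wave 3 1 (x + 2 * I * t) t * thirdDet x (-4 * t ^ 2) = thirdDet x (-4 * t ^ 2) +
      2 * (thirdEven x (-4 * t ^ 2) + 2 * I * t * thirdOdd x (-4 * t ^ 2)) := by
  have hM : lowGram 3 x t = lowPoly x (2 * I * t) := by
    ext k j
    exact lowGram_eq le_rfl x t k j
  have hdet : thirdDet x (-4 * t ^ 2) = 1036800 * (lowGram 3 x t).det := by
    rw [← two_I_mul_sq, thirdDet_eq, det_fin_three, hM]
    simp only [lowPoly, of_apply, cons_val_zero, cons_val_one, cons_val]
    ring
  refine ⟨by rw [hdet, det_lowGram], ?_⟩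
  have h := wave_mul_det 3 x t
  have hnum := third_numerator_eq x (2 * I * t)
  rw [two_I_mul_sq] at hnum
  have hf : phaseMat 3 *ᵥ trunc 3 (fSeries 1 (x + 2 * I * t : ℂ) t) = lowF x (2 * I * t) :=
    funext fun k => phaseMat_mulVec_fSeries le_rfl x t k
  have hg : star (phaseMat 3 *ᵥ trunc 3 (gSeries 1 (x + 2 * I * t : ℂ) t)) =
      lowG x (-(2 * I * t)) := funext fun k => star_phaseMat_mulVec_gSeries le_rfl x t k
  rw [hnum, hdet, mul_left_comm, h, hf, hg, hM, adjugate_fin_three]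
  simp only [dotProduct, mulVec, Fin.sum_univ_three, of_apply, cons_val_zero, cons_val_one, cons_val,
    lowPoly]
  generalize lowF x (2 * I * t) = f
  generalize lowG x (-(2 * I * t)) = g
  ring

theorem secondDet_ofReal (x t : ℝ) : secondDet x (-4 * t ^ 2) = (secondDen x t : ℝ) := by
  rw [secondDet, secondDen]
  push_cast
  ring

theorem thirdDet_ofReal (x t : ℝ) : thirdDet x (-4 * t ^ 2) = (thirdDen x t : ℝ) := by
  rw [thirdDet, thirdDen]
  push_cast
  ring

theorem secondNum_eq (x t : ℂ) : secondNum x t = (√2 : ℝ) *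
    (secondEven x (-4 * t ^ 2) + 2 * I * t * secondOdd x (-4 * t ^ 2)) := by
  rw [secondNum, secondEven, secondOdd]
  linear_combination 12 * (√2 : ℝ) * (48 * x ^ 2 * t ^ 2 - 4 * x ^ 3 + 6 * x ^ 2 + 160 * t ^ 4
    - 48 * x * t ^ 2 + 48 * t ^ 2 + 2 * x ^ 4 - 3 * x) * I_sq

theorem thirdNum_eq (x t : ℂ) : thirdNum x t = (√2 : ℝ) *
    (thirdEven x (-4 * t ^ 2) + 2 * I * t * thirdOdd x (-4 * t ^ 2)) := by
  rw [thirdNum, thirdEven, thirdOdd]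
  ring

open scoped ComplexOrder in
-- The polynomial is a positive multiple of the determinant of a positive definite matrix, so no
-- representation by sums of squares is required.
theorem secondDen_pos (x t : ℝ) : 0 < secondDen x t := by
  have h1 := (posDef_gramMat 2 one_ne_zero (x + 2 * I * t) t).det_pos
  have h2 := (wave_two x t).1
  rw [secondDet_ofReal] at h2
  have h3 : (0 : ℂ) < (secondDen x t : ℝ) := by
    rw [h2]
    exact mul_pos (by norm_num) h1
  exact_mod_cast h3

open scoped ComplexOrder in
theorem thirdDen_pos (x t : ℝ) : 0 < thirdDen x t := by
  have h1 := (posDef_gramMat 3 one_ne_zero (x + 2 * I * t) t).det_pos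
  have h2 := (wave_three x t).1
  rw [thirdDet_ofReal] at h2
  have h3 : (0 : ℂ) < (thirdDen x t : ℝ) := by
    rw [h2]
    exact mul_pos (by norm_num) h1
  exact_mod_cast h3

/-- The explicit wave of order two, up to the carrier. -/
theorem explicit_wave_two (x t : ℝ) : (√2 / 2 : ℝ) * wave 2 1 (x + 2 * I * t) t =
    (√2 / 2 : ℝ) + secondNum x t / (secondDen x t : ℝ) := by
  have hd : ((secondDen x t : ℝ) : ℂ) ≠ 0 := by exact_mod_cast (secondDen_pos x t).ne'
  have h := (wave_two x t).2
  rw [secondDet_ofReal] at h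
  rw [secondNum_eq, ← sub_eq_iff_eq_add', eq_div_iff hd]
  push_cast
  linear_combination ((√2 : ℝ) : ℂ) / 2 * h

/-- The explicit wave of order three, up to the carrier. -/
theorem explicit_wave_three (x t : ℝ) : (√2 / 2 : ℝ) * wave 3 1 (x + 2 * I * t) t =
    (√2 / 2 : ℝ) + thirdNum x t / (thirdDen x t : ℝ) := by
  have hd : ((thirdDen x t : ℝ) : ℂ) ≠ 0 := by exact_mod_cast (thirdDen_pos x t).ne'
  have h := (wave_three x t).2
  rw [thirdDet_ofReal] at h
  rw [thirdNum_eq, ← sub_eq_iff_eq_add', eq_div_iff hd]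
  push_cast
  linear_combination ((√2 : ℝ) : ℂ) / 2 * h

end ExplicitWaves

end

end Manakov

namespace Manakov

noncomputable section

/-! ### No centre of symmetry for orders two and three. -/

section Asymmetry

open Polynomial

/-- The limit of the wave itself, including the sign `(-1)^n`, is the same at both ends of the axis;
this rules out antisymmetry below. -/
theorem tendsto_waveFun_axis (n : ℕ) (a : ℝ) {c : ℝ} (hc : c ≠ 0) {l : Filter ℝ}
    (hl : l ≤ cocompact ℝ) :
    Tendsto (fun x : ℝ => (waveFun n a c : ℝ × ℝ → ℂ) (x, 0)) l (𝓝 (c * (-1) ^ n)) := by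
  have h := tendsto_wave (tendsto_coordinate a hc) (tendsto_time a hc) n hc
  have he : Topology.IsClosedEmbedding fun x : ℝ => (x, (0 : ℝ)) :=
    Isometry.isClosedEmbedding (Isometry.of_dist_eq fun x y => by simp [Prod.dist_eq])
  exact (h.comp (he.tendsto_cocompact.mono_left hl)).congr fun x => (waveFun_apply n a hc _).symm

/-- A wave whose restriction to the `x`-axis is a rational function that is not symmetric about
a point has a height that is not symmetric about this point. -/
theorem exists_norm_waveFun_sub_ne {n : ℕ} {a c : ℝ} (hc : c ≠ 0) {E D : ℝ[X]}
    (hD : ∀ x, D.eval x ≠ 0)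
    (h : ∀ x : ℝ, (waveFun n a c : ℝ × ℝ → ℂ) (x, 0) = ((E.eval x / D.eval x : ℝ) : ℂ)) (u : ℝ)
    (hne : ∃ x, E.eval x * D.eval (u - x) ≠ E.eval (u - x) * D.eval x) :
    ∃ x : ℝ, ‖(waveFun n a c : ℝ × ℝ → ℂ) (u - x, 0)‖ ≠ ‖(waveFun n a c : ℝ × ℝ → ℂ) (x, 0)‖ := by
  by_contra! heq
  set r : ℝ → ℝ := fun x => E.eval x / D.eval x with hr
  -- Equal absolute values of real numbers leave the alternatives `r x = ± r (u - x)`.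
  have hsq : ∀ x, (r x - r (u - x)) * (r x + r (u - x)) = 0 := by
    intro x
    have := heq x
    rw [h, h, norm_real, norm_real, Real.norm_eq_abs, Real.norm_eq_abs, ← sq_eq_sq_iff_abs_eq_abs]
      at this
    linear_combination -this
  have ht : ∀ {l : Filter ℝ}, l ≤ cocompact ℝ → Tendsto r l (𝓝 (c * (-1) ^ n)) := by
    intro l hl
    have := (Complex.continuous_re.tendsto _).comp (tendsto_waveFun_axis n a hc hl)
    convert this using 2
    · ext x
      simp only [Function.comp_apply, h, ofReal_re, hr]
    · rw [show (c : ℂ) * (-1) ^ n = ((c * (-1) ^ n : ℝ) : ℂ) by push_cast; rfl, ofReal_re]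
  have hsum : Tendsto (fun x => r x + r (u - x)) atTop (𝓝 (c * (-1) ^ n + c * (-1) ^ n)) :=
    (ht atTop_le_cocompact).add ((ht atBot_le_cocompact).comp
      (tendsto_atBot_add_const_left _ _ tendsto_neg_atTop_atBot))
  -- The sum of the two values tends to `2c(-1)^n ≠ 0`, so near infinity only `r x = r (u - x)` is
  -- possible, and the corresponding polynomial has infinitely many roots.
  have hlim : c * (-1) ^ n + c * (-1) ^ n ≠ 0 := by
    rw [← two_mul]
    exact mul_ne_zero two_ne_zero (mul_ne_zero hc (pow_ne_zero _ (by norm_num)))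
  set W : ℝ[X] := E * D.comp (C u - X) - E.comp (C u - X) * D with hW
  have heval : ∀ x, W.eval x = E.eval x * D.eval (u - x) - E.eval (u - x) * D.eval x := by
    intro x
    simp [hW]
  have hroot : ∀ᶠ x in atTop, W.IsRoot x := by
    filter_upwards [hsum.eventually_ne hlim] with x hx
    have h1 := (mul_eq_zero.1 (hsq x)).resolve_right hx
    rw [sub_eq_zero, hr] at h1
    rw [IsRoot, heval, sub_eq_zero]
    rwa [div_eq_div_iff (hD _) (hD _)] at h1
  have hW0 : W = 0 := by
    obtain ⟨b, hb⟩ := eventually_atTop.1 hroot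
    exact eq_zero_of_infinite_isRoot W ((Set.Ici_infinite b).mono hb)
  obtain ⟨x, hx⟩ := hne
  exact hx (sub_eq_zero.1 (by rw [← heval, hW0, eval_zero]))

/-- The denominator of the wave of order 2 on the line `t = 0`. -/
def secondAxisDen : ℝ[X] :=
    16 * X ^ 6 - 48 * X ^ 5 + 72 * X ^ 4 - 72 * X ^ 3 + 72 * X ^ 2 - 36 * X + 9

/-- The numerator of the wave of order 2 on the line `t = 0`. -/
def secondAxisNum : ℝ[X] :=
    16 * X ^ 6 - 48 * X ^ 5 + 24 * X ^ 4 + 24 * X ^ 3 - 72 * X ^ 2 + 36 * X + 9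

theorem secondAxis_asymmetric (u : ℝ) : ∃ x, secondAxisNum.eval x * secondAxisDen.eval (u - x) ≠
    secondAxisNum.eval (u - x) * secondAxisDen.eval x := by
  by_contra! H
  simp only [secondAxisNum, secondAxisDen, eval_add, eval_sub, eval_mul, eval_pow, eval_X,
    eval_ofNat] at H
  -- The ninth finite difference at `0` extracts `9!` times the coefficient of `x⁹` in the
  -- difference of both sides, which is `1536(u - 1)`. The only candidate `u = 1` is refuted at `x =
  -- 0`.
  have hu : (557383680 : ℝ) * (u - 1) = 0 := by
    linear_combination
      -1 * H 0 + 9 * H 1 - 36 * H 2 + 84 * H 3 - 126 * H 4 + 126 * H 5 - 84 * H 6 + 36 * H 7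
        - 9 * H 8 + 1 * H 9
  have h0 := H 0
  rw [show u = 1 by linarith] at h0
  norm_num at h0

/-- The denominator of the wave of order 3 on the line `t = 0`. -/
def thirdAxisDen : ℝ[X] :=
    512 * X ^ 12 - 3072 * X ^ 11 + 9216 * X ^ 10 - 19200 * X ^ 9 + 34560 * X ^ 8
      - 54720 * X ^ 7 + 86400 * X ^ 6 - 108000 * X ^ 5 + 97200 * X ^ 4 - 64800 * X ^ 3
      + 36450 * X ^ 2 - 12150 * X + 2025

/-- The numerator of the wave of order 3 on the line `t = 0`. -/
def thirdAxisNum : ℝ[X] :=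
    -512 * X ^ 12 + 3072 * X ^ 11 - 6144 * X ^ 10 + 3840 * X ^ 9 + 11520 * X ^ 8
      - 37440 * X ^ 7 + 74880 * X ^ 6 - 90720 * X ^ 5 + 32400 * X ^ 4 + 21600 * X ^ 3
      - 36450 * X ^ 2 + 12150 * X + 2025

theorem thirdAxis_asymmetric (u : ℝ) : ∃ x, thirdAxisNum.eval x * thirdAxisDen.eval (u - x) ≠
    thirdAxisNum.eval (u - x) * thirdAxisDen.eval x := by
  by_contra! H
  simp only [thirdAxisNum, thirdAxisDen, eval_add, eval_sub, eval_neg, eval_mul, eval_pow, eval_X,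
    eval_ofNat] at H
  -- The same with the finite difference of order `21`: the coefficient of `x²¹` is `-3145728(u -
  -- 1)`, and the constant here is `-3145728 · 21!`.
  have hu : (-160718207335927193272320000 : ℝ) * (u - 1) = 0 := by
    linear_combination
      -1 * H 0 + 21 * H 1 - 210 * H 2 + 1330 * H 3 - 5985 * H 4 + 20349 * H 5 - 54264 * H 6
        + 116280 * H 7 - 203490 * H 8 + 293930 * H 9 - 352716 * H 10 + 352716 * H 11
        - 293930 * H 12 + 203490 * H 13 - 116280 * H 14 + 54264 * H 15 - 20349 * H 16
        + 5985 * H 17 - 1330 * H 18 + 210 * H 19 - 21 * H 20 + 1 * H 21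
  have h0 := H 0
  rw [show u = 1 by linarith] at h0
  norm_num at h0

theorem waveFun_zero_one (n : ℕ) (x t : ℝ) :
    (waveFun n 0 1 : ℝ × ℝ → ℂ) (x, t) = wave n 1 (x + 2 * I * t) t := by
  rw [waveFun_apply n 0 one_ne_zero]
  congr 1
  push_cast
  ring

theorem exists_norm_waveFun_two_ne (u : ℝ) :
    ∃ x : ℝ, ‖(waveFun 2 0 1 : ℝ × ℝ → ℂ) (u - x, 0)‖ ≠ ‖(waveFun 2 0 1 : ℝ × ℝ → ℂ) (x, 0)‖ := by
  have hD : ∀ x, secondAxisDen.eval x = secondDen x 0 := by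
    intro x
    simp [secondAxisDen, secondDen]
  have hpos : ∀ x, secondAxisDen.eval x ≠ 0 := fun x => by
    rw [hD]
    exact (secondDen_pos x 0).ne'
  refine exists_norm_waveFun_sub_ne one_ne_zero hpos (fun x => ?_) u (secondAxis_asymmetric u)
  have h := (wave_two x 0).2
  rw [secondDet_ofReal, ← hD] at h
  rw [waveFun_zero_one, ofReal_div, eq_div_iff (by exact_mod_cast hpos x), h]
  simp [secondAxisDen, secondAxisNum, secondEven]
  ring

theorem exists_norm_waveFun_three_ne (u : ℝ) :
    ∃ x : ℝ, ‖(waveFun 3 0 1 : ℝ × ℝ → ℂ) (u - x, 0)‖ ≠ ‖(waveFun 3 0 1 : ℝ × ℝ → ℂ) (x, 0)‖ := by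
  have hD : ∀ x, thirdAxisDen.eval x = thirdDen x 0 := by
    intro x
    simp [thirdAxisDen, thirdDen]
  have hpos : ∀ x, thirdAxisDen.eval x ≠ 0 := fun x => by
    rw [hD]
    exact (thirdDen_pos x 0).ne'
  refine exists_norm_waveFun_sub_ne one_ne_zero hpos (fun x => ?_) u (thirdAxis_asymmetric u)
  have h := (wave_three x 0).2
  rw [thirdDet_ofReal, ← hD] at h
  rw [waveFun_zero_one, ofReal_div, eq_div_iff (by exact_mod_cast hpos x), h]
  simp [thirdAxisDen, thirdAxisNum, thirdEven]
  ring

end Asymmetry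

end

end Manakov

/-! ### Assembly of the rogue waves. -/

namespace Manakov

noncomputable section

theorem isVectorRogueWave_modulated {n : ℕ} (hn : 1 ≤ n) (a : ℝ) {c₁ c₂ : ℝ}
    (hc : c₁ ≠ 0 ∨ c₂ ≠ 0) :
    IsVectorRogueWave n a c₁ c₂
      (fun x t => (modulated n a (amp c₁ c₂) (c₁ / amp c₁ c₂) : ℝ × ℝ → ℂ) (x, t))
      (fun x t => (modulated n a (amp c₁ c₂) (c₂ / amp c₁ c₂) : ℝ × ℝ → ℂ) (x, t)) := by
  have hcp := amp_pos hc
  have hsq : (c₁ / amp c₁ c₂) ^ 2 + (c₂ / amp c₁ c₂) ^ 2 = 1 := by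
    rw [div_pow, div_pow, ← add_div, ← amp_sq, div_self (pow_ne_zero 2 hcp.ne')]
  refine ⟨isManakovSolution_modulated n a hcp.ne' hsq, ?_⟩
  have h := isRogueProfile_modulated hn a hcp (k := ![c₁ / amp c₁ c₂, c₂ / amp c₁ c₂])
    (by simpa [Fin.sum_univ_two] using hsq)
  convert h using 1
  · ext j
    fin_cases j <;> simp [mul_div_cancel₀ _ hcp.ne']
  · ext j
    fin_cases j <;> rfl

theorem isNLSRogueWave_modulated {n : ℕ} (hn : 1 ≤ n) (a : ℝ) {c : ℝ} (hc : 0 < c) :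
    IsNLSRogueWave n a c (fun x t => (modulated n a c 1 : ℝ × ℝ → ℂ) (x, t)) := by
  refine ⟨isNLSSolution_modulated n a hc.ne', ?_⟩
  have h := isRogueProfile_modulated hn a hc (k := fun _ : Unit => 1) (by simp)
  simpa using h

theorem modulated_eq_explicit (n : ℕ) (k x t : ℝ) : (modulated n 0 1 k : ℝ × ℝ → ℂ) (x, t) =
    k * wave n 1 (x + 2 * I * t) t * exp (2 * I * t) := by
  rw [modulated_apply, waveFun_zero_one, carrier]
  congr 2
  push_cast
  ring

end

end Manakov

open Manakov in
theorem theorem2 (n : ℕ) (hn : 1 ≤ n) (m : ℕ) (a c₁ c₂ : ℝ) (hc : c₁ ≠ 0 ∨ c₂ ≠ 0) :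
    (∀ x t : ℝ, (x, t) ≠ (0, 0) → (omega col₂ n m a c₁ c₂ x t).det ≠ 0) ∧
    ∃ q₁ q₂ : ℝ → ℝ → ℂ,
      (∀ x t : ℝ, (x, t) ≠ (0, 0) →
        q₁ x t = formula₁ n m a c₁ c₂ x t ∧ q₂ x t = formula₂ n m a c₁ c₂ x t) ∧
      IsVectorRogueWave n a c₁ c₂ q₁ q₂ ∧
      (a = 0 → c₁ = √2 / 2 → c₂ = √2 / 2 → ∃ q : ℝ → ℝ → ℂ,
        (∀ x t : ℝ, q x t = (√2 : ℝ) * q₁ x t ∧ q x t = (√2 : ℝ) * q₂ x t) ∧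
        IsNLSRogueWave n 0 1 q ∧
        (∃ x t : ℝ, ‖q (-x) t‖ ≠ ‖q x t‖) ∧
        (n = 2 ∨ n = 3 → ∀ x₀ : ℝ, ∃ x t : ℝ, ‖q (2 * x₀ - x) t‖ ≠ ‖q x t‖) ∧
        (n = 2 → ∀ x t : ℝ, 0 < secondDen x t ∧
          q₁ x t = ((√2 / 2 : ℝ) + secondNum x t / (secondDen x t : ℝ)) * exp (2 * I * t)) ∧
        (n = 3 → ∀ x t : ℝ, 0 < thirdDen x t ∧
          q₁ x t = ((√2 / 2 : ℝ) + thirdNum x t / (thirdDen x t : ℝ)) * exp (2 * I * t))) := by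
  refine ⟨fun x t h => det_omega_ne_zero m a hc x t hn h, _, _,
    fun x t h => ⟨(formula_eq_modulated m a hc x t hn h).1.symm,
      (formula_eq_modulated m a hc x t hn h).2.symm⟩, isVectorRogueWave_modulated hn a hc, ?_⟩
  rintro rfl rfl rfl
  have hamp : amp (√2 / 2) (√2 / 2) = 1 := by
    rw [amp, div_pow, Real.sq_sqrt zero_le_two]
    norm_num
  have hmod : ∀ x t : ℝ, (modulated n 0 1 1 : ℝ × ℝ → ℂ) (x, t) =
      (√2 : ℝ) * (modulated n 0 1 (√2 / 2) : ℝ × ℝ → ℂ) (x, t) := by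
    intro x t
    have h2 : ((√2 : ℝ) : ℂ) * √2 = 2 := by
      rw [← ofReal_mul, Real.mul_self_sqrt zero_le_two, ofReal_ofNat]
    rw [modulated_apply, modulated_apply]
    push_cast
    linear_combination -((waveFun n 0 1 : ℝ × ℝ → ℂ) (x, t) *
      carrier 0 (2 * 1 ^ 2 - 0 ^ 2) x t / 2) * h2
  have hnorm : ∀ p : ℝ × ℝ, ‖(modulated n 0 1 1 : ℝ × ℝ → ℂ) p‖ =
      ‖(waveFun n 0 1 : ℝ × ℝ → ℂ) p‖ := fun p => by
    rw [norm_modulated, abs_one, one_mul]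
  simp only [hamp, div_one]
  refine ⟨fun x t => (modulated n 0 1 1 : ℝ × ℝ → ℂ) (x, t), fun x t => ⟨hmod x t, hmod x t⟩,
    isNLSRogueWave_modulated hn 0 one_pos, ?_, ?_, ?_, ?_⟩
  · obtain ⟨x, hx⟩ := exists_norm_waveFun_neg_ne hn 0 one_pos
    exact ⟨x, 0, by rwa [hnorm, hnorm]⟩
  -- Reflection in `x₀` is `x ↦ u - x` with `u = 2x₀`, and the line `t = 0` already witnesses the
  -- asymmetry.
  · rintro (rfl | rfl) x₀
    · obtain ⟨x, hx⟩ := exists_norm_waveFun_two_ne (2 * x₀)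
      exact ⟨x, 0, by rwa [hnorm, hnorm]⟩
    · obtain ⟨x, hx⟩ := exists_norm_waveFun_three_ne (2 * x₀)
      exact ⟨x, 0, by rwa [hnorm, hnorm]⟩
  · rintro rfl x t
    exact ⟨secondDen_pos x t, by rw [modulated_eq_explicit, explicit_wave_two]⟩
  · rintro rfl x t
    exact ⟨thirdDen_pos x t, by rw [modulated_eq_explicit, explicit_wave_three]⟩
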